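/- **Theorem (error estimate for Ensemble Algorithm A1).** Let $d\in\{2,3\}$ and let $\Omega_1,\Omega_2\subset\mathbb R^d$ be disjoint (nonempty, bounded, open) convex polytopes with interface $\Gamma=\partial\Omega_1\cap\partial\Omega_2$. Put $X_i=\{v\in H^1(\Omega_i): v=0 \text{ on } \partial\Omega_i\setminus\Gamma\}$, $X=X_1\times X_2$, and for $\mathbf v=(v_1,v_2)\in X$ write $\|\mathbf v\|=\sum_i\|v_i\|_{L^2(\Omega_i)}$, $\|\nabla\mathbf v\|=\sum_i\|\nabla v_i\|_{L^2(\Omega_i)}$, $\|\mathbf v\|_\Gamma=\sum_i\|v_i\|_{L^2(\Gamma)}$, with traces on $\Gamma$, and $[\mathbf v]=v_1-v_2$. Let $0<\nu_{\min}\le\nu_{\max}$, $\bar\kappa>0$, $\sigma>0$ and an integer $l\ge1$ be given. Then there is a constant $C>0$, depending only on $d,\Omega_1,\Omega_2,\nu_{\min},\nu_{\max},\bar\kappa,\sigma,l$, such that the following holds. Let $\mathcal T_i$ $(i=1,2)$ be a triangulation of $\Omega_i$ with mesh size $h_i$ that is quasi-uniform with constant $\sigma$ (every simplex of $\mathcal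 T_i$ contains a ball of radius $\sigma h_i$). Let $X_{i,h}\subset X_i$ be the space of continuous piecewise polynomials of degree at most $l$ on $\mathcal T_i$ that lie in $X_i$, and $X_h=X_{1,h}\times X_{2,h}$. Let $T>0$, $N\ge1$, $\Delta t=T/N$, $t^n=n\Delta t$. Let $\nu_i(\mathbf x,t)$ be diffusion coefficients with $\nu_{\min}\le\nu_i\le\nu_{\max}$ on $\Omega_i\times[0,T]$, let $J\ge1$, let $\kappa_1,\dots,\kappa_J\in(0,\bar\kappa]$ be friction parameters and $\kappa_{\max}=\max_j\kappa_j$ (no smallness of the differences $\kappa_j-\kappa_{\max}$ is assumed), and let $f_{i,j}(t)\in X_i'$ be source terms. For each $j$ let $\mathbf u_j:[0,T]\to X$ satisfy $\mathbf u_{j,t}\in L^2(0,T;X)$, $\mathbf u_{j,tt}\in L^2(0,T;L^2(\Omega_1)\times L^2(\Omega_2))$ and, for all $t\in(0,T]$, $$\sum_i (u_{i,j,t},v_i)+\sum_i(\nu_i\nabla u_{i,j},\nabla v_i)+\int_\Gamma\kappa_j[\mathbf u_j][\mathbf v]\,ds=\sum_i(f_{i,j},v_i)\qquad\forall\,\mathbf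 v\in X .$$ Let $\mathbf u_j^n\in X_h$ $(0\le n\le N)$ satisfy, for all $j$, all $0\le n<N$ and $i\ne k$ in $\{1,2\}$, $$\Big(\tfrac{u_{i,j}^{n+1}-u_{i,j}^n}{\Delta t},v_i\Big)+(\nu_i(t^{n+1})\nabla u_{i,j}^{n+1},\nabla v_i)+\int_\Gamma\kappa_{\max}(u_{i,j}^{n+1}-u_{k,j}^n)v_i\,ds+\int_\Gamma(\kappa_j-\kappa_{\max})(u_{i,j}^n-u_{k,j}^n)v_i\,ds=(f_{i,j}(t^{n+1}),v_i)\quad\forall v_i\in X_{i,h}.$$ Then for every $j$ $$\begin{aligned} &\|\mathbf u_j(T)-\mathbf u_j^N\|^2+\kappa_{\max}\Delta t\,\|\mathbf u_j(T)-\mathbf u_j^N\|_\Gamma^2+\nu_{\min}\Delta t\sum_{n=0}^{N-1}\|\nabla\mathbf u_j(t^{n+1})-\nabla\mathbf u_j^{n+1}\|^2\\ &\le C\Big\{\|\mathbf u_j(0)-\mathbf u_j^0\|^2+\kappa_{\max}\Delta t\,\|\mathbf u_j(0)-\mathbf u_j^0\|_\Gamma^2+\Delta t^2\int_0^T\|\nabla\mathbf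 u_{j,t}\|^2dt+\Delta t^2\int_0^T\|\mathbf u_{j,tt}\|^2dt\\ &\qquad+\inf_{\mathbf v\in X_h}\big\{\|\mathbf u_j(0)-\mathbf v\|^2+\kappa_{\max}\Delta t\,\|\mathbf u_j(0)-\mathbf v\|_\Gamma^2\big\}+\inf_{\mathbf v\in H^1(0,T;X_h)}\int_0^T\|(\mathbf u_j-\mathbf v)_t\|^2dt\\ &\qquad+T\max_{0\le n\le N}\ \inf_{\mathbf v\in X_h}\|\nabla\mathbf u_j(t^n)-\nabla\mathbf v\|^2\Big\}. \end{aligned}$$ In particular $C$ is independent of the meshes (hence of $h$), of $\Delta t$ and of $J$. -/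

import Mathlib

open MeasureTheory Filter Topology Set
open scoped ENNReal ContDiff

noncomputable section

namespace HeatHeat

/-! ### Lebesgue spaces on a domain and on its boundary -/

/-- The Euclidean space `ℝ^d`. -/
abbrev E (d : ℕ) : Type := EuclideanSpace ℝ (Fin d)

/-- The `(d-1)`-dimensional surface measure on `ℝ^d` (Hausdorff measure, normalised so that it is
the usual length for `d = 2` and the usual area for `d = 3`). -/
def surf (d : ℕ) : Measure (E d) := μHE[d - 1]

/-- `L²(Ω)`. -/
abbrev L2 {d : ℕ} (Ω : Set (E d)) : Type := Lp ℝ 2 (volume.restrict Ω)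

/-- `L²(Ω; ℝ^d)`. -/
abbrev L2Vec {d : ℕ} (Ω : Set (E d)) : Type := Lp (E d) 2 (volume.restrict Ω)

/-- `L²(∂Ω)`. -/
abbrev L2Bdry {d : ℕ} (Ω : Set (E d)) : Type := Lp ℝ 2 ((surf d).restrict (frontier Ω))

/-! ### Sobolev functions and their traces -/

/-- `g` is the weak gradient of `v` in `Ω`:
`∫_Ω v ∇φ = - ∫_Ω φ g` for all `φ ∈ C_c^∞(Ω)`. -/
def IsWeakGradient {d : ℕ} (Ω : Set (E d)) (v : L2 Ω) (g : L2Vec Ω) : Prop :=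
  ∀ φ : E d → ℝ, ContDiff ℝ ∞ φ → HasCompactSupport φ → tsupport φ ⊆ Ω →
    ∫ x in Ω, v x • gradient φ x = -∫ x in Ω, φ x • g x

/-- `w` is the trace on `∂Ω` of the Sobolev function `v ∈ H¹(Ω)` with gradient `g`: there are smooth
functions on `ℝ^d` which converge to `v` in `H¹(Ω)` and whose boundary values converge to `w` in
`L²(∂Ω)`. -/
def IsTrace {d : ℕ} (Ω : Set (E d)) (v : L2 Ω) (g : L2Vec Ω) (w : L2Bdry Ω) : Prop :=
  ∃ φ : ℕ → E d → ℝ, (∀ n, ContDiff ℝ ∞ (φ n)) ∧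
    Tendsto (fun n => eLpNorm (fun x => φ n x - v x) 2 (volume.restrict Ω)) atTop (𝓝 0) ∧
    Tendsto (fun n => eLpNorm (fun x => gradient (φ n) x - g x) 2 (volume.restrict Ω))
      atTop (𝓝 0) ∧
    Tendsto (fun n => eLpNorm (fun x => φ n x - w x) 2 ((surf d).restrict (frontier Ω)))
      atTop (𝓝 0)

theorem integrable_smul_gradient {d : ℕ} {Ω : Set (E d)} (v : L2 Ω) {φ : E d → ℝ}
    (hφ : ContDiff ℝ ∞ φ) (hc : HasCompactSupport φ) :
    Integrable (fun x => v x • gradient φ x) (volume.restrict Ω) := by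
  have hcont : Continuous (gradient φ) := by
    have h1 : Continuous (fderiv ℝ φ) := hφ.continuous_fderiv (by simp)
    exact (InnerProductSpace.toDual ℝ (E d)).symm.continuous.comp h1
  have hsupp : HasCompactSupport (gradient φ) := by
    have h2 : HasCompactSupport (fderiv ℝ φ) := hc.fderiv (𝕜 := ℝ)
    exact h2.comp_left (g := (InnerProductSpace.toDual ℝ (E d)).symm) (map_zero _)
  have hm : MemLp (gradient φ) 2 (volume.restrict Ω) :=
    hcont.memLp_of_hasCompactSupport hsupp
  exact memLp_one_iff_integrable.1 (hm.smul (Lp.memLp v) (r := 1))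

theorem integrable_test_smul {d : ℕ} {Ω : Set (E d)} (g : L2Vec Ω) {φ : E d → ℝ}
    (hφ : ContDiff ℝ ∞ φ) (hc : HasCompactSupport φ) :
    Integrable (fun x => φ x • g x) (volume.restrict Ω) := by
  have hm : MemLp φ 2 (volume.restrict Ω) :=
    hφ.continuous.memLp_of_hasCompactSupport hc
  exact memLp_one_iff_integrable.1 ((Lp.memLp g).smul hm (r := 1))

theorem IsWeakGradient.zero {d : ℕ} (Ω : Set (E d)) : IsWeakGradient Ω 0 0 := by
  intro φ _ _ _
  have h1 : ∫ x in Ω, (0 : L2 Ω) x • gradient φ x = 0 := by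
    rw [← integral_zero (E d) (E d) (μ := volume.restrict Ω)]
    refine integral_congr_ae ?_
    filter_upwards [Lp.coeFn_zero ℝ 2 (volume.restrict Ω)] with x hx
    rw [hx, Pi.zero_apply, zero_smul]
  have h2 : ∫ x in Ω, φ x • (0 : L2Vec Ω) x = 0 := by
    rw [← integral_zero (E d) (E d) (μ := volume.restrict Ω)]
    refine integral_congr_ae ?_
    filter_upwards [Lp.coeFn_zero (E d) 2 (volume.restrict Ω)] with x hx
    rw [hx, Pi.zero_apply, smul_zero]
  rw [h1, h2, neg_zero]

theorem IsWeakGradient.add {d : ℕ} {Ω : Set (E d)} {v v' : L2 Ω} {g g' : L2Vec Ω}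
    (h : IsWeakGradient Ω v g) (h' : IsWeakGradient Ω v' g') :
    IsWeakGradient Ω (v + v') (g + g') := by
  intro φ hφ hc hs
  have h1 : ∫ x in Ω, (v + v') x • gradient φ x
      = ∫ x in Ω, (v x • gradient φ x + v' x • gradient φ x) := by
    refine integral_congr_ae ?_
    filter_upwards [Lp.coeFn_add v v'] with x hx
    rw [hx, Pi.add_apply, add_smul]
  have h2 : ∫ x in Ω, φ x • (g + g') x = ∫ x in Ω, (φ x • g x + φ x • g' x) := by
    refine integral_congr_ae ?_
    filter_upwards [Lp.coeFn_add g g'] with x hx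
    rw [hx, Pi.add_apply, smul_add]
  rw [h1, h2, integral_add (integrable_smul_gradient v hφ hc) (integrable_smul_gradient v' hφ hc),
    integral_add (integrable_test_smul g hφ hc) (integrable_test_smul g' hφ hc),
    h φ hφ hc hs, h' φ hφ hc hs, neg_add]

theorem IsWeakGradient.smul {d : ℕ} {Ω : Set (E d)} {v : L2 Ω} {g : L2Vec Ω} (c : ℝ)
    (h : IsWeakGradient Ω v g) : IsWeakGradient Ω (c • v) (c • g) := by
  intro φ hφ hc hs
  have h1 : ∫ x in Ω, (c • v) x • gradient φ x = ∫ x in Ω, c • (v x • gradient φ x) := by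
    refine integral_congr_ae ?_
    filter_upwards [Lp.coeFn_smul c v] with x hx
    rw [hx, Pi.smul_apply, smul_eq_mul, mul_smul]
  have h2 : ∫ x in Ω, φ x • (c • g) x = ∫ x in Ω, c • (φ x • g x) := by
    refine integral_congr_ae ?_
    filter_upwards [Lp.coeFn_smul c g] with x hx
    rw [hx, Pi.smul_apply, smul_comm]
  rw [h1, h2, integral_smul, integral_smul, h φ hφ hc hs, smul_neg]

theorem gradient_add' {d : ℕ} {φ ψ : E d → ℝ} (hφ : ContDiff ℝ ∞ φ) (hψ : ContDiff ℝ ∞ ψ)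
    (x : E d) : gradient (fun y => φ y + ψ y) x = gradient φ x + gradient ψ x := by
  have h1 : DifferentiableAt ℝ φ x := (hφ.differentiable (by simp)) x
  have h2 : DifferentiableAt ℝ ψ x := (hψ.differentiable (by simp)) x
  simp only [gradient]
  rw [fderiv_fun_add h1 h2, map_add]

theorem gradient_smul' {d : ℕ} {φ : E d → ℝ} (hφ : ContDiff ℝ ∞ φ) (c : ℝ)
    (x : E d) : gradient (fun y => c * φ y) x = c • gradient φ x := by
  have h1 : DifferentiableAt ℝ φ x := (hφ.differentiable (by simp)) x
  simp only [gradient]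
  rw [fderiv_const_mul h1, map_smul]

theorem tendsto_eLpNorm_add {d : ℕ} {F : Type*} [NormedAddCommGroup F] {μ : Measure (E d)}
    {a a' b : ℕ → E d → F} (ha : ∀ n, AEStronglyMeasurable (a n) μ)
    (ha' : ∀ n, AEStronglyMeasurable (a' n) μ)
    (h : Tendsto (fun n => eLpNorm (a n) 2 μ) atTop (𝓝 0))
    (h' : Tendsto (fun n => eLpNorm (a' n) 2 μ) atTop (𝓝 0))
    (hb : ∀ n, b n =ᵐ[μ] fun x => a n x + a' n x) :
    Tendsto (fun n => eLpNorm (b n) 2 μ) atTop (𝓝 0) := by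
  have hsum := h.add h'
  rw [add_zero] at hsum
  refine tendsto_of_tendsto_of_tendsto_of_le_of_le tendsto_const_nhds hsum
    (fun n => zero_le) (fun n => ?_)
  rw [eLpNorm_congr_ae (hb n)]
  exact eLpNorm_add_le (ha n) (ha' n) (by norm_num)

theorem tendsto_eLpNorm_smul {d : ℕ} {F : Type*} [NormedAddCommGroup F] [NormedSpace ℝ F]
    {μ : Measure (E d)} {a b : ℕ → E d → F} (c : ℝ)
    (h : Tendsto (fun n => eLpNorm (a n) 2 μ) atTop (𝓝 0))
    (hb : ∀ n, b n =ᵐ[μ] fun x => c • a n x) :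
    Tendsto (fun n => eLpNorm (b n) 2 μ) atTop (𝓝 0) := by
  have hmul := ENNReal.Tendsto.const_mul (a := ‖c‖ₑ) h (Or.inr enorm_ne_top)
  rw [mul_zero] at hmul
  refine hmul.congr (fun n => ?_)
  rw [eLpNorm_congr_ae (hb n)]
  exact (eLpNorm_const_smul c (a n) 2 μ).symm

theorem continuous_gradient {d : ℕ} {φ : E d → ℝ} (hφ : ContDiff ℝ ∞ φ) :
    Continuous (gradient φ) :=
  (InnerProductSpace.toDual ℝ (E d)).symm.continuous.comp (hφ.continuous_fderiv (by simp))

theorem IsTrace.zero {d : ℕ} (Ω : Set (E d)) : IsTrace Ω 0 0 0 := by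
  refine ⟨fun _ _ => 0, fun _ => contDiff_const, ?_, ?_, ?_⟩
  · refine tendsto_const_nhds.congr (fun n => ?_)
    rw [eq_comm]
    refine (eLpNorm_congr_ae (g := 0) ?_).trans eLpNorm_zero
    filter_upwards [Lp.coeFn_zero ℝ 2 (volume.restrict Ω)] with x hx
    rw [hx]
    simp
  · refine tendsto_const_nhds.congr (fun n => ?_)
    rw [eq_comm]
    refine (eLpNorm_congr_ae (g := 0) ?_).trans eLpNorm_zero
    filter_upwards [Lp.coeFn_zero (E d) 2 (volume.restrict Ω)] with x hx
    rw [hx]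
    simp [gradient]
  · refine tendsto_const_nhds.congr (fun n => ?_)
    rw [eq_comm]
    refine (eLpNorm_congr_ae (g := 0) ?_).trans eLpNorm_zero
    filter_upwards [Lp.coeFn_zero ℝ 2 ((surf d).restrict (frontier Ω))] with x hx
    rw [hx]
    simp

theorem IsTrace.add {d : ℕ} {Ω : Set (E d)} {v v' : L2 Ω} {g g' : L2Vec Ω} {w w' : L2Bdry Ω}
    (h : IsTrace Ω v g w) (h' : IsTrace Ω v' g' w') :
    IsTrace Ω (v + v') (g + g') (w + w') := by
  obtain ⟨φ, hφ, h1, h2, h3⟩ := h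
  obtain ⟨ψ, hψ, k1, k2, k3⟩ := h'
  refine ⟨fun n x => φ n x + ψ n x, fun n => (hφ n).add (hψ n), ?_, ?_, ?_⟩
  · refine tendsto_eLpNorm_add
      (fun n => (hφ n).continuous.aestronglyMeasurable.sub (Lp.aestronglyMeasurable v))
      (fun n => (hψ n).continuous.aestronglyMeasurable.sub (Lp.aestronglyMeasurable v')) h1 k1
      (fun n => ?_)
    filter_upwards [Lp.coeFn_add v v'] with x hx
    simp only [hx, Pi.add_apply, Pi.sub_apply]
    ring
  · refine tendsto_eLpNorm_add
      (fun n => (continuous_gradient (hφ n)).aestronglyMeasurable.sub (Lp.aestronglyMeasurable g))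
      (fun n => (continuous_gradient (hψ n)).aestronglyMeasurable.sub (Lp.aestronglyMeasurable g'))
      h2 k2 (fun n => ?_)
    filter_upwards [Lp.coeFn_add g g'] with x hx
    rw [gradient_add' (hφ n) (hψ n), hx]
    simp only [Pi.add_apply, Pi.sub_apply]
    abel
  · refine tendsto_eLpNorm_add
      (fun n => (hφ n).continuous.aestronglyMeasurable.sub (Lp.aestronglyMeasurable w))
      (fun n => (hψ n).continuous.aestronglyMeasurable.sub (Lp.aestronglyMeasurable w')) h3 k3
      (fun n => ?_)
    filter_upwards [Lp.coeFn_add w w'] with x hx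
    simp only [hx, Pi.add_apply, Pi.sub_apply]
    ring

theorem IsTrace.smul {d : ℕ} {Ω : Set (E d)} {v : L2 Ω} {g : L2Vec Ω} {w : L2Bdry Ω} (c : ℝ)
    (h : IsTrace Ω v g w) : IsTrace Ω (c • v) (c • g) (c • w) := by
  obtain ⟨φ, hφ, h1, h2, h3⟩ := h
  refine ⟨fun n x => c * φ n x, fun n => contDiff_const.mul (hφ n), ?_, ?_, ?_⟩
  · refine tendsto_eLpNorm_smul c h1 (fun n => ?_)
    filter_upwards [Lp.coeFn_smul c v] with x hx
    simp only [hx, Pi.smul_apply, smul_eq_mul]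
    ring
  · refine tendsto_eLpNorm_smul c h2 (fun n => ?_)
    filter_upwards [Lp.coeFn_smul c g] with x hx
    rw [gradient_smul' (hφ n), hx, Pi.smul_apply, smul_sub]
  · refine tendsto_eLpNorm_smul c h3 (fun n => ?_)
    filter_upwards [Lp.coeFn_smul c w] with x hx
    simp only [hx, Pi.smul_apply, smul_eq_mul]
    ring

/-- The space `{v ∈ H¹(Ω) : v = 0 on ∂Ω \ Γ}`. A function `v ∈ H¹(Ω)` is recorded together with its
weak gradient and its trace on `∂Ω`, as the triple `(v, ∇v, v|_∂Ω)`. -/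
def X {d : ℕ} (Ω Γ : Set (E d)) : Submodule ℝ (L2 Ω × L2Vec Ω × L2Bdry Ω) where
  carrier := {p | IsWeakGradient Ω p.1 p.2.1 ∧ IsTrace Ω p.1 p.2.1 p.2.2 ∧
    ∀ᵐ x ∂((surf d).restrict (frontier Ω)), x ∉ Γ → p.2.2 x = 0}
  zero_mem' := by
    refine ⟨IsWeakGradient.zero Ω, IsTrace.zero Ω, ?_⟩
    filter_upwards [Lp.coeFn_zero ℝ 2 ((surf d).restrict (frontier Ω))] with x hx _
    simpa using hx
  add_mem' := by
    rintro p q ⟨h1, h2, h3⟩ ⟨k1, k2, k3⟩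
    refine ⟨h1.add k1, h2.add k2, ?_⟩
    filter_upwards [Lp.coeFn_add p.2.2 q.2.2, h3, k3] with x hx hp hq hΓ
    change (p.2.2 + q.2.2 : L2Bdry Ω) x = 0
    rw [hx, Pi.add_apply, hp hΓ, hq hΓ, add_zero]
  smul_mem' := by
    rintro c p ⟨h1, h2, h3⟩
    refine ⟨h1.smul c, h2.smul c, ?_⟩
    filter_upwards [Lp.coeFn_smul c p.2.2, h3] with x hx hp hΓ
    change (c • p.2.2 : L2Bdry Ω) x = 0
    rw [hx, Pi.smul_apply, hp hΓ, smul_zero]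

/-- The function `v ∈ L²(Ω)` underlying an element of `X`. -/
abbrev val {d : ℕ} {Ω Γ : Set (E d)} (v : X Ω Γ) : L2 Ω := v.1.1

/-- The weak gradient `∇v`. -/
abbrev grad {d : ℕ} {Ω Γ : Set (E d)} (v : X Ω Γ) : L2Vec Ω := v.1.2.1

/-- The trace `v|_∂Ω`. -/
abbrev tr {d : ℕ} {Ω Γ : Set (E d)} (v : X Ω Γ) : L2Bdry Ω := v.1.2.2

/-! ### Geometry: the two subdomains, their meshes and the finite element spaces -/

/-- `Ω` is a (nonempty, bounded, open) convex polygon or polyhedron. -/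
def IsConvexPolytope {d : ℕ} (Ω : Set (E d)) : Prop :=
  Ω.Nonempty ∧ ∃ s : Finset (E d), Ω = interior (convexHull ℝ (s : Set (E d)))

/-- The interface `Γ = ∂Ω₁ ∩ ∂Ω₂`; the two subdomains are indexed by `Fin 2`. -/
def interface {d : ℕ} (Ω : Fin 2 → Set (E d)) : Set (E d) := frontier (Ω 0) ∩ frontier (Ω 1)

/-- `K` is a (conforming, finite) triangulation of the closure of `Ω`. The elements of the
triangulation are the simplices of `K` with `d + 1` vertices. -/
def IsTriangulation {d : ℕ} (K : Geometry.SimplicialComplex ℝ (E d)) (Ω : Set (E d)) : Prop :=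
  K.faces.Finite ∧ K.space = closure Ω

/-- Quasi-uniformity with constant `σ`: each element contains a ball whose radius is `σ` times the
diameter of any element, hence `σ` times the mesh size `h`, the largest of these diameters. -/
def IsQuasiUniform {d : ℕ} (σ : ℝ) (K : Geometry.SimplicialComplex ℝ (E d)) : Prop :=
  ∀ s ∈ K.faces, s.card = d + 1 → ∀ t ∈ K.faces, t.card = d + 1 →
    ∃ x : E d, Metric.ball x (σ * Metric.diam (convexHull ℝ (t : Set (E d))))
      ⊆ convexHull ℝ (s : Set (E d))

/-- `f` is continuous on the closure of `Ω`, and on each element of `K` it is a polynomial of total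
degree at most `l`. -/
def IsPiecewisePolynomial {d : ℕ} (Ω : Set (E d)) (K : Geometry.SimplicialComplex ℝ (E d)) (l : ℕ)
    (f : E d → ℝ) : Prop :=
  ContinuousOn f (closure Ω) ∧ ∀ s ∈ K.faces, s.card = d + 1 →
    ∃ p : MvPolynomial (Fin d) ℝ, p.totalDegree ≤ l ∧
      ∀ x ∈ convexHull ℝ (s : Set (E d)), f x = MvPolynomial.eval (fun i => x i) p

/-- The finite element space of continuous piecewise polynomials of degree at most `l` on the
triangulation `K` of `Ω` that belong to `X`. -/
def Xh {d : ℕ} (Ω Γ : Set (E d)) (K : Geometry.SimplicialComplex ℝ (E d)) (l : ℕ) :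
    Submodule ℝ (X Ω Γ) where
  carrier := {v | ∃ f : E d → ℝ, IsPiecewisePolynomial Ω K l f ∧
    val v =ᵐ[volume.restrict Ω] f}
  zero_mem' := by
    refine ⟨fun _ => 0, ⟨continuousOn_const, fun s _ _ => ⟨0, by simp, fun x _ => by simp⟩⟩, ?_⟩
    exact Lp.coeFn_zero ℝ 2 (volume.restrict Ω)
  add_mem' := by
    rintro v w ⟨f, ⟨hf, hf'⟩, hvf⟩ ⟨g, ⟨hg, hg'⟩, hwg⟩
    refine ⟨fun x => f x + g x, ⟨hf.add hg, fun s hs hcard => ?_⟩, ?_⟩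
    · obtain ⟨p, hp, hp'⟩ := hf' s hs hcard
      obtain ⟨q, hq, hq'⟩ := hg' s hs hcard
      exact ⟨p + q, (MvPolynomial.totalDegree_add p q).trans (max_le hp hq),
        fun x hx => by simp only [hp' x hx, hq' x hx, map_add]⟩
    · filter_upwards [Lp.coeFn_add (val v) (val w), hvf, hwg] with x hx h1 h2
      change (val v + val w : L2 Ω) x = _
      rw [hx, Pi.add_apply, h1, h2]
  smul_mem' := by
    rintro c v ⟨f, ⟨hf, hf'⟩, hvf⟩
    refine ⟨fun x => c * f x, ⟨continuousOn_const.mul hf, fun s hs hcard => ?_⟩, ?_⟩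
    · obtain ⟨p, hp, hp'⟩ := hf' s hs hcard
      exact ⟨c • p, (MvPolynomial.totalDegree_smul_le c p).trans hp,
        fun x hx => by simp only [hp' x hx, MvPolynomial.smul_eval]⟩
    · filter_upwards [Lp.coeFn_smul c (val v), hvf] with x hx h1
      change (c • val v : L2 Ω) x = _
      rw [hx, Pi.smul_apply, h1, smul_eq_mul]

/-! ### Product spaces and their norms -/

/-- `X = X₁ × X₂`. -/
abbrev XX {d : ℕ} (Ω : Fin 2 → Set (E d)) : Type := ∀ i, X (Ω i) (interface Ω)

/-- `X_h = X_{1,h} × X_{2,h}`. -/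
abbrev XXh {d : ℕ} (Ω : Fin 2 → Set (E d)) (K : Fin 2 → Geometry.SimplicialComplex ℝ (E d))
    (l : ℕ) : Type :=
  ∀ i, Xh (Ω i) (interface Ω) (K i) l

/-- An element of `X_h` seen in `X`. -/
def XXh.toXX {d : ℕ} {Ω : Fin 2 → Set (E d)} {K : Fin 2 → Geometry.SimplicialComplex ℝ (E d)}
    {l : ℕ} (v : XXh Ω K l) : XX Ω := fun i => (v i : X (Ω i) (interface Ω))

/-- The product norm `‖v₁‖_{L²(Ω₁)} + ‖v₂‖_{L²(Ω₂)}`. -/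
def normL2 {d : ℕ} {Ω : Fin 2 → Set (E d)} (v : ∀ i, L2 (Ω i)) : ℝ := ∑ i, ‖v i‖

/-- `‖v‖`. -/
def nrm {d : ℕ} {Ω : Fin 2 → Set (E d)} (v : XX Ω) : ℝ := normL2 fun i => val (v i)

/-- `‖∇v‖`. -/
def nrmGrad {d : ℕ} {Ω : Fin 2 → Set (E d)} (v : XX Ω) : ℝ := ∑ i, ‖grad (v i)‖

/-- `‖v‖_Γ`. -/
def nrmInterface {d : ℕ} {Ω : Fin 2 → Set (E d)} (v : XX Ω) : ℝ :=
  ∑ i, √(∫ x in interface Ω, (tr (v i) x) ^ 2 ∂(surf d))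

/-! ### The exact solution and the ensemble algorithm -/

/-- `u ∈ H¹(0,T;F)` with time derivative `u' ∈ L²(0,T;F)`. -/
def HasL2TimeDeriv {F : Type*} [NormedAddCommGroup F] [NormedSpace ℝ F] (T : ℝ)
    (u u' : ℝ → F) : Prop :=
  MemLp u' 2 (volume.restrict (Ioc 0 T)) ∧
    ∀ t ∈ Icc 0 T, u t = u 0 + ∫ s in (0 : ℝ)..t, u' s

/-- Time regularity of `u : [0,T] → X`: `u_t ∈ L²(0,T;X)` and `u_tt ∈ L²(0,T;L²(Ω))`.
Here `ut` is `u_t` as an element of `L²(0,T;X)`, and `ut0` is the representative of `u_t` which is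
continuous with values in `L²(Ω)`. -/
structure IsRegularInTime {d : ℕ} {Ω : Fin 2 → Set (E d)} (T : ℝ)
    (u ut : ℝ → XX Ω) (ut0 utt : ℝ → ∀ i, L2 (Ω i)) : Prop where
  deriv_u : ∀ i, HasL2TimeDeriv T (fun t => (u t i).1) (fun t => (ut t i).1)
  ut_eq : ∀ i, ∀ᵐ t ∂(volume.restrict (Ioc 0 T)), val (ut t i) = ut0 t i
  deriv_ut : ∀ i, HasL2TimeDeriv T (fun t => ut0 t i) (fun t => utt t i)

/-- The monolithic weak formulation on `(0,T]`, for one value `κ` of the friction parameter: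
`(u_t, v) + (ν ∇u, ∇v) + ∫_Γ κ [u] [v] ds = (f, v)` for all `v ∈ X`. -/
def IsWeakSolution {d : ℕ} {Ω : Fin 2 → Set (E d)} (T : ℝ) (ν : Fin 2 → ℝ → E d → ℝ) (κ : ℝ)
    (f : ∀ i, ℝ → X (Ω i) (interface Ω) →L[ℝ] ℝ)
    (u : ℝ → XX Ω) (ut0 : ℝ → ∀ i, L2 (Ω i)) : Prop :=
  ∀ t ∈ Ioc 0 T, ∀ v : XX Ω,
    (∑ i, inner ℝ (ut0 t i) (val (v i)))
      + (∑ i, ∫ x in Ω i, ν i t x * inner ℝ (grad (u t i) x) (grad (v i) x))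
      + (∫ x in interface Ω,
          κ * (tr (u t 0) x - tr (u t 1) x) * (tr (v 0) x - tr (v 1) x) ∂(surf d))
      = ∑ i, f i t (v i)

/-- `κ_max`, the largest friction parameter of the ensemble. -/
def kmax {J : ℕ} (κ : Fin J → ℝ) : ℝ := ⨆ j, κ j

/-- Ensemble Algorithm A1 with time step `Δt` and `N` steps; `U j n` is the `n`-th iterate of the
`j`-th ensemble member. The index of the other subdomain is `i.rev`. -/
def IsA1Solution {d : ℕ} {Ω : Fin 2 → Set (E d)} {K : Fin 2 → Geometry.SimplicialComplex ℝ (E d)}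
    {l : ℕ} (Δt : ℝ) (N : ℕ) (ν : Fin 2 → ℝ → E d → ℝ) {J : ℕ} (κ : Fin J → ℝ)
    (f : Fin J → ∀ i, ℝ → X (Ω i) (interface Ω) →L[ℝ] ℝ)
    (U : Fin J → ℕ → XXh Ω K l) : Prop :=
  ∀ n < N, ∀ j, ∀ i, ∀ v : Xh (Ω i) (interface Ω) (K i) l,
    inner ℝ (Δt⁻¹ • (val (U j (n + 1) i).1 - val (U j n i).1)) (val v.1)
      + (∫ x in Ω i, ν i ((n + 1 : ℕ) * Δt) x *
          inner ℝ (grad (U j (n + 1) i).1 x) (grad v.1 x))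
      + (∫ x in interface Ω, kmax κ *
          (tr (U j (n + 1) i).1 x - tr (U j n i.rev).1 x) * tr v.1 x ∂(surf d))
      + (∫ x in interface Ω, (κ j - kmax κ) *
          (tr (U j n i).1 x - tr (U j n i.rev).1 x) * tr v.1 x ∂(surf d))
      = f j i ((n + 1 : ℕ) * Δt) v.1

/-- `inf_{v ∈ X_h} { ‖u - v‖² + κ_max Δt ‖u - v‖_Γ² }`. -/
def bestInitial {d : ℕ} {Ω : Fin 2 → Set (E d)} (K : Fin 2 → Geometry.SimplicialComplex ℝ (E d))
    (l : ℕ) (κmaxΔt : ℝ) (u : XX Ω) : ℝ :=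
  ⨅ v : XXh Ω K l, (nrm (u - v.toXX) ^ 2 + κmaxΔt * nrmInterface (u - v.toXX) ^ 2)

/-- `inf_v ‖(u - v)_t‖²_{L²(0,T;L²(Ω))}` over the functions `v ∈ H¹(0,T;X_h)`. -/
def bestDeriv {d : ℕ} {Ω : Fin 2 → Set (E d)} (K : Fin 2 → Geometry.SimplicialComplex ℝ (E d))
    (l : ℕ) (T : ℝ) (ut0 : ℝ → ∀ i, L2 (Ω i)) : ℝ :=
  sInf {r | ∃ (v : ℝ → XXh Ω K l) (v' : ℝ → ∀ i, L2 (Ω i)),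
    (∀ i, HasL2TimeDeriv T (fun t => val (v t i).1) (fun t => v' t i)) ∧
    r = ∫ t in (0 : ℝ)..T, normL2 (fun i => ut0 t i - v' t i) ^ 2}

/-- `inf_{v ∈ X_h} ‖∇(u - v)‖²`. -/
def bestGrad {d : ℕ} {Ω : Fin 2 → Set (E d)} (K : Fin 2 → Geometry.SimplicialComplex ℝ (E d))
    (l : ℕ) (u : XX Ω) : ℝ :=
  ⨅ v : XXh Ω K l, nrmGrad (u - v.toXX) ^ 2

end HeatHeat

end

/-! Let `w^n` be the `L²` projection of the exact solution `u(t^n)` onto `X_h` and let `φ^n = w^n -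
U^n` be the discrete error. Subtract the scheme from the weak formulation at `t^{n+1}` and test with
`φ^{n+1}` on each subdomain. The difference quotient of `u - w` drops out by orthogonality, and
diffusion contributes `ν_min ‖∇φ^{n+1}‖²`.

The heart of the matter is the interface. The implicit part leaves `κ_max ‖φ_i^{n+1}‖_Γ²` on the
left; the lagged part is `(κ_max - κ_j) φ_i^n + κ_j φ_k^n`, tested with `φ_i^{n+1}` on the right.
Since `0 ≤ κ_j ≤ κ_max`, these two weights are nonnegative and add up to `κ_max`, so Young's
inequality consumes exactly half of the implicit term (`energy_step`). Summed over the two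
subdomains, the lagged terms become `κ_max ‖φ^n‖_Γ²`, the quantity produced by the preceding step,
and everything telescopes (`energy_sum`). No smallness of `κ_j - κ_max`, no Gronwall argument and no
restriction on the time step are needed.

What remains is consistency: the truncation error of the difference quotient (`u_tt`), the lag of
one step in the interface values (`∇u_t`), and the projection error. Each is bounded against `‖∇φ‖`
by Friedrichs' inequality, the bound on `ν` or the trace inequality, and is absorbed by diffusion
(`ErrorData.energy`, `ErrorData.consistency`). The projection error at the final time carries no
factor `Δt` and is treated separately, so that the constant does not depend on `T`
(`ErrorData.final_projection_le`).

The finite element input is that the `L²` projection is quasi-optimal for the gradient, uniformly in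
the mesh (`IsFlatPart.exists_isL2Proj_stable`). This follows from an inverse inequality and a
quasi-interpolant of Clément type. The mesh need not resolve `Γ`, so the interpolant is set to zero
at every vertex whose hat function does not vanish on `∂Ω \ Γ`. The error at such a vertex rests on
a Poincaré inequality on balls about arbitrary points of `∂Ω \ Γ`, with one constant even for points
arbitrarily close to `Γ` (`IsFlatPart.exists_local_poincare`).

Convexity makes this possible: `Γ` is a convex piece of a separating hyperplane
(`exists_isFlatPart`), and near each point of `∂Ω \ Γ`, at every scale, a fixed fraction of a ball
leaves `Ω` off `Γ` after a short translation (`IsFlatPart.exists_escape_of_ball`). The Friedrichs,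
trace and Poincaré inequalities are proved for smooth functions by integrating along segments, and
then passed to the limit in the definition of the trace. -/

noncomputable section

namespace HeatHeat

open Module

variable {d : ℕ}

/-! ### Analysis of smooth functions along segments and parallel lines -/

section

/-! ### Integrals of squared norms -/

/-- `∫ ‖f‖² dμ` as an extended nonnegative real. -/
def sqInt {α F : Type*} [MeasurableSpace α] [ENorm F] (μ : Measure α) (f : α → F) : ℝ≥0∞ :=
  ∫⁻ x, ‖f x‖ₑ ^ 2 ∂μ

theorem eLpNorm_two_sq {α F : Type*} [MeasurableSpace α] [NormedAddCommGroup F] (μ : Measure α)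
    (f : α → F) : eLpNorm f 2 μ ^ 2 = sqInt μ f := by
  rw [eLpNorm_eq_lintegral_rpow_enorm_toReal (by norm_num) (by norm_num), sqInt,
    ← ENNReal.rpow_natCast, ← ENNReal.rpow_mul]
  norm_num

theorem sqInt_mono_measure {α F : Type*} [MeasurableSpace α] [ENorm F] {μ ν : Measure α}
    (h : μ ≤ ν) (f : α → F) : sqInt μ f ≤ sqInt ν f :=
  lintegral_mono' h le_rfl

theorem sqInt_mono_set {α F : Type*} [MeasurableSpace α] [ENorm F] {μ : Measure α} {s t : Set α}
    (h : s ⊆ t) (f : α → F) : sqInt (μ.restrict s) f ≤ sqInt (μ.restrict t) f :=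
  sqInt_mono_measure (Measure.restrict_mono h le_rfl) f

theorem enorm_add_sq_le {F : Type*} [NormedAddCommGroup F] (a b : F) :
    ‖a + b‖ₑ ^ 2 ≤ 2 * ‖a‖ₑ ^ 2 + 2 * ‖b‖ₑ ^ 2 := by
  have h := ENNReal.rpow_add_le_mul_rpow_add_rpow ‖a‖ₑ ‖b‖ₑ (p := 2) (by norm_num)
  norm_num at h
  calc ‖a + b‖ₑ ^ 2 ≤ (‖a‖ₑ + ‖b‖ₑ) ^ 2 := by gcongr; exact enorm_add_le a b
    _ ≤ 2 * (‖a‖ₑ ^ 2 + ‖b‖ₑ ^ 2) := h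
    _ = _ := by ring

theorem sqInt_add_le {α F : Type*} [MeasurableSpace α] [NormedAddCommGroup F] {μ : Measure α}
    {f : α → F} (hf : AEStronglyMeasurable f μ) (g : α → F) :
    sqInt μ (fun x => f x + g x) ≤ 2 * sqInt μ f + 2 * sqInt μ g := by
  have hm : AEMeasurable (fun x => 2 * ‖f x‖ₑ ^ 2) μ :=
    ((hf.enorm.pow_const 2).const_mul 2)
  calc sqInt μ (fun x => f x + g x) ≤ ∫⁻ x, (2 * ‖f x‖ₑ ^ 2 + 2 * ‖g x‖ₑ ^ 2) ∂μ :=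
        lintegral_mono fun x => enorm_add_sq_le _ _
    _ = 2 * sqInt μ f + 2 * sqInt μ g := by
        rw [lintegral_add_left' hm, lintegral_const_mul' _ _ (by norm_num),
          lintegral_const_mul' _ _ (by norm_num)]
        rfl

/-- Squeezing between `‖g‖ - ‖f n - g‖` and `‖g‖ + ‖f n - g‖` works in `[0, ∞]` without any
finiteness; this matters on the boundary, where smooth approximants are not known to be square
integrable. -/
theorem tendsto_sqInt {α F : Type*} [MeasurableSpace α] [NormedAddCommGroup F] {μ : Measure α}
    {f : ℕ → α → F} {g : α → F} (hf : ∀ n, AEStronglyMeasurable (f n) μ)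
    (hg : AEStronglyMeasurable g μ)
    (h : Tendsto (fun n => eLpNorm (fun x => f n x - g x) 2 μ) atTop (𝓝 0)) :
    Tendsto (fun n => sqInt μ (f n)) atTop (𝓝 (sqInt μ g)) := by
  simp_rw [← eLpNorm_two_sq]
  refine (ENNReal.continuous_pow 2).continuousAt.tendsto.comp ?_
  refine tendsto_of_tendsto_of_tendsto_of_le_of_le
    (g := fun n => eLpNorm g 2 μ - eLpNorm (fun x => f n x - g x) 2 μ)
    (h := fun n => eLpNorm g 2 μ + eLpNorm (fun x => f n x - g x) 2 μ) ?_ ?_ ?_ ?_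
  · have := ENNReal.Tendsto.sub (tendsto_const_nhds (x := eLpNorm g 2 μ) (f := atTop)) h
      (Or.inr (by simp))
    simpa using this
  · have := (tendsto_const_nhds (x := eLpNorm g 2 μ) (f := atTop)).add h
    simpa using this
  · intro n
    rw [tsub_le_iff_right]
    have h1 := eLpNorm_add_le (hf n) (hg.sub (hf n)) (p := 2) (by norm_num)
    have h2 : eLpNorm (g - f n) 2 μ = eLpNorm (fun x => f n x - g x) 2 μ := by
      rw [eLpNorm_sub_comm]; rfl
    rw [h2, add_sub_cancel] at h1
    exact h1
  · intro n
    have h1 := eLpNorm_add_le hg ((hf n).sub hg) (p := 2) (by norm_num)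
    rw [add_sub_cancel] at h1
    exact h1

/-- The Cauchy–Schwarz inequality for the integral of a function against a finite measure. -/
theorem enorm_integral_sq_le {α F : Type*} [MeasurableSpace α] [NormedAddCommGroup F]
    [NormedSpace ℝ F] (μ : Measure α) {f : α → F} (hf : AEStronglyMeasurable f μ) :
    ‖∫ x, f x ∂μ‖ₑ ^ 2 ≤ μ univ * sqInt μ f := by
  have h1 : ‖∫ x, f x ∂μ‖ₑ ≤ ∫⁻ x, ‖f x‖ₑ ∂μ := enorm_integral_le_lintegral_enorm f
  have h2 := ENNReal.lintegral_mul_le_Lp_mul_Lq μ Real.HolderConjugate.two_two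
    (aemeasurable_const (b := (1 : ℝ≥0∞))) hf.enorm
  simp only [Pi.mul_apply, one_mul, ENNReal.one_rpow, lintegral_const] at h2
  calc ‖∫ x, f x ∂μ‖ₑ ^ 2 ≤ (μ univ ^ (1 / 2 : ℝ) * (∫⁻ x, ‖f x‖ₑ ^ (2 : ℝ) ∂μ) ^ (1 / 2 : ℝ)) ^ 2 := by
        gcongr; exact h1.trans h2
    _ = μ univ * sqInt μ f := by
        rw [mul_pow, ← ENNReal.rpow_natCast, ← ENNReal.rpow_natCast, ← ENNReal.rpow_mul,
          ← ENNReal.rpow_mul, sqInt]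
        norm_num

/-! ### Differences of a smooth function along a segment -/

theorem norm_gradient (φ : E d → ℝ) (x : E d) : ‖gradient φ x‖ = ‖fderiv ℝ φ x‖ := by
  simp [gradient]

/-- The fundamental theorem of calculus and Cauchy–Schwarz. The factor `t - s` later becomes the
width of the domain, or the local scale. -/
theorem enorm_sub_sq_le_of_contDiff {φ : E d → ℝ} (hφ : ContDiff ℝ ∞ φ) (p e : E d) {s t : ℝ}
    (h : s ≤ t) :
    ‖φ (p + t • e) - φ (p + s • e)‖ₑ ^ 2 ≤ ENNReal.ofReal (t - s) * (‖e‖ₑ ^ 2 *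
      ∫⁻ τ in Ioc s t, ‖gradient φ (p + τ • e)‖ₑ ^ 2) := by
  have hline : ∀ τ : ℝ, HasDerivAt (fun τ : ℝ => p + τ • e) e τ := fun τ => by
    simpa using ((hasDerivAt_id τ).smul_const e).const_add p
  have hder : ∀ τ : ℝ, HasDerivAt (fun τ : ℝ => φ (p + τ • e))
      (fderiv ℝ φ (p + τ • e) e) τ := fun τ =>
    (((hφ.differentiable (by simp)) (p + τ • e)).hasFDerivAt).comp_hasDerivAt τ (hline τ)
  have hcont : Continuous fun τ : ℝ => fderiv ℝ φ (p + τ • e) e :=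
    ((hφ.continuous_fderiv (by simp)).comp (by fun_prop)).clm_apply continuous_const
  have hFTC : ∫ τ in s..t, fderiv ℝ φ (p + τ • e) e = φ (p + t • e) - φ (p + s • e) :=
    intervalIntegral.integral_eq_sub_of_hasDerivAt (fun τ _ => hder τ)
      (hcont.intervalIntegrable _ _)
  rw [← hFTC, intervalIntegral.integral_of_le h]
  refine (enorm_integral_sq_le _ hcont.aestronglyMeasurable).trans ?_
  rw [Measure.restrict_apply_univ, Real.volume_Ioc, sqInt,
    ← lintegral_const_mul' (‖e‖ₑ ^ 2) _ (by simp)]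
  refine mul_le_mul' le_rfl (lintegral_mono fun τ => ?_)
  rw [← mul_pow]
  refine pow_le_pow_left' ?_ 2
  have h1 := (fderiv ℝ φ (p + τ • e)).le_opENorm e
  rw [mul_comm]
  have h2 : ‖gradient φ (p + τ • e)‖ₑ = ‖fderiv ℝ φ (p + τ • e)‖ₑ := by
    rw [← ofReal_norm, ← ofReal_norm, norm_gradient]
  rw [h2]
  exact h1

/-! ### Integration along parallel lines -/

theorem finrank_orthogonal_span {e : E d} (he : e ≠ 0) : finrank ℝ (ℝ ∙ e)ᗮ = d - 1 := by
  have h := (ℝ ∙ e).finrank_add_finrank_orthogonal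
  rw [finrank_span_singleton he, finrank_euclideanSpace, Fintype.card_fin] at h
  omega

/-- Fubini for the orthogonal splitting into the line spanned by `e` and its complement; the
parametrisation of the line is isometric because `e` is a unit vector. -/
theorem lintegral_eq_lintegral_lines {e : E d} (he : ‖e‖ = 1) {f : E d → ℝ≥0∞}
    (hf : Measurable f) :
    ∫⁻ x, f x = ∫⁻ p : (ℝ ∙ e)ᗮ, ∫⁻ s : ℝ, f (p + s • e) := by
  have hmp := (ℝ ∙ e).measurePreserving_measurableEquivProd (0 : E d)
  rw [InnerProductSpace.euclideanHausdorffMeasure_eq_volume] at hmp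
  rw [← hmp.symm.lintegral_comp_emb (MeasurableEquiv.measurableEmbedding _),
    Measure.volume_eq_prod, lintegral_prod_symm
      (fun a => f (((ℝ ∙ e).measurableEquivProd (0 : E d)).symm a)) (hf.comp
      ((ℝ ∙ e).measurableEquivProd (0 : E d)).symm.measurable).aemeasurable]
  refine lintegral_congr fun p => ?_
  have hu : MeasurePreserving (LinearIsometryEquiv.toSpanUnitSingleton (𝕜 := ℝ) e he) :=
    LinearIsometryEquiv.measurePreserving _
  rw [← hu.lintegral_comp_emb
    (LinearIsometryEquiv.toSpanUnitSingleton (𝕜 := ℝ) e he).toHomeomorph.measurableEmbedding]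
  refine lintegral_congr fun s => ?_
  simp [add_comm]

theorem euclideanHausdorffMeasure_image_le {Y Z : Type*} [EMetricSpace Y] [EMetricSpace Z]
    [MeasurableSpace Y] [BorelSpace Y] [MeasurableSpace Z] [BorelSpace Z]
    {K : NNReal} {f : Y → Z} {s : Set Y} (h : LipschitzOnWith K f s) (m : ℕ) :
    μHE[m] (f '' s) ≤ (K : ℝ≥0∞) ^ m * μHE[m] s := by
  rw [Measure.euclideanHausdorffMeasure_def, Measure.euclideanHausdorffMeasure_def,
    Measure.smul_apply, Measure.smul_apply]
  have := h.hausdorffMeasure_image_le (d := m) (by positivity)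
  rw [ENNReal.rpow_natCast] at this
  rw [ENNReal.smul_def, ENNReal.smul_def, smul_eq_mul, smul_eq_mul, mul_left_comm]
  gcongr

/-- The orthogonal projection onto the hyperplane `e^⊥`. -/
abbrev projOrth (e : E d) : E d →L[ℝ] (ℝ ∙ e)ᗮ := (ℝ ∙ e)ᗮ.orthogonalProjectionOnto

theorem projOrth_coe_add_smul (e : E d) (p : (ℝ ∙ e)ᗮ) (s : ℝ) :
    projOrth e ((p : E d) + s • e) = p := by
  have h : projOrth e e = 0 := by
    rw [Submodule.orthogonalProjectionOnto_eq_zero_iff]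
    exact Submodule.le_orthogonal_orthogonal _ (Submodule.mem_span_singleton_self e)
  rw [map_add, map_smul, h, smul_zero, add_zero]
  exact Submodule.orthogonalProjectionOnto_mem_subspace_eq_self p

theorem exists_eq_projOrth_add_smul (e z : E d) : ∃ s : ℝ, z = (projOrth e z : E d) + s • e := by
  have h := (ℝ ∙ e).starProjection_add_starProjection_orthogonal z
  have h1 : (ℝ ∙ e).starProjection z ∈ ℝ ∙ e := Submodule.coe_mem _
  obtain ⟨s, hs⟩ := Submodule.mem_span_singleton.1 h1
  refine ⟨s, ?_⟩
  rw [hs, add_comm]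
  exact h.symm

/-- The projection is 1-Lipschitz, and on `e^⊥`, of dimension `d - 1`, the normalised Hausdorff
measure is Lebesgue measure. -/
theorem volume_image_projOrth_le {e : E d} (he : e ≠ 0) (S : Set (E d)) :
    volume (projOrth e '' S) ≤ surf d S := by
  have hl : LipschitzOnWith 1 (projOrth e) S :=
    (LipschitzWith.of_dist_le_mul fun x y => by
      rw [dist_eq_norm, dist_eq_norm, ← map_sub, NNReal.coe_one, one_mul]
      exact Submodule.norm_orthogonalProjectionOnto_apply_le _ _).lipschitzOnWith
  have h := euclideanHausdorffMeasure_image_le hl (d - 1)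
  rw [ENNReal.coe_one, one_pow, one_mul] at h
  rw [← InnerProductSpace.euclideanHausdorffMeasure_eq_volume, finrank_orthogonal_span he]
  exact h

/-- Each line parallel to `e` meets `S` at most once, so the supremum reads off `f` at that point
and is zero if there is none. Writing it as a supremum avoids a measurable selection of the point.
-/
theorem lintegral_iSup_fiber_le {e : E d} (he : e ≠ 0) {S : Set (E d)} (hS : MeasurableSet S)
    (hinj : InjOn (projOrth e) S) (f : E d → ℝ≥0∞) :
    ∫⁻ p : (ℝ ∙ e)ᗮ, (⨆ z ∈ S, ⨆ _ : projOrth e z = p, f z) ≤ ∫⁻ z in S, f z ∂(surf d) := by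
  set g : (ℝ ∙ e)ᗮ → ℝ≥0∞ := fun p => ⨆ z ∈ S, ⨆ _ : projOrth e z = p, f z with hg
  have hmeas : Measurable (projOrth e) := (projOrth e).continuous.measurable
  have hle : (volume : Measure (ℝ ∙ e)ᗮ).restrict (projOrth e '' S) ≤
      ((surf d).restrict S).map (projOrth e) := by
    refine Measure.le_iff.2 fun A hA => ?_
    rw [Measure.restrict_apply hA, Measure.map_apply hmeas hA, Measure.restrict_apply (hmeas hA)]
    refine le_trans (measure_mono ?_) (volume_image_projOrth_le he _)
    rintro _ ⟨hxA, z, hz, rfl⟩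
    exact ⟨z, ⟨hxA, hz⟩, rfl⟩
  have h0 : (projOrth e '' S).indicator g = g := by
    refine indicator_eq_self.2 fun p hp => ?_
    by_contra hcon
    refine hp ?_
    simp only [hg]
    refine ENNReal.iSup_eq_zero.2 fun z => ENNReal.iSup_eq_zero.2 fun hz =>
      ENNReal.iSup_eq_zero.2 fun hzp => ?_
    exact absurd ⟨z, hz, hzp⟩ hcon
  calc ∫⁻ p, g p = ∫⁻ p, (projOrth e '' S).indicator g p := by rw [h0]
    _ ≤ ∫⁻ p in projOrth e '' S, g p := lintegral_indicator_le _ _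
    _ ≤ ∫⁻ p, g p ∂(((surf d).restrict S).map (projOrth e)) := lintegral_mono' hle le_rfl
    -- This direction of the change of variables holds for any `g`, measurable or not.
    _ ≤ ∫⁻ z in S, g (projOrth e z) ∂(surf d) := lintegral_map_le _ _
    _ ≤ ∫⁻ z in S, f z ∂(surf d) := by
        refine setLIntegral_mono' hS fun z hz => ?_
        refine iSup_le fun z' => iSup_le fun hz' => iSup_le fun hzz' => ?_
        rw [hinj hz' hz hzz']

end

section

/-! ### Friedrichs and trace inequalities for smooth functions -/

/-- The segment from a point of the closure to an interior point is interior except possibly at its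
start. Every geometric argument below about rays and chords reduces to this. -/
theorem add_smul_mem_of_convex {Ω : Set (E d)} (hc : Convex ℝ Ω) (ho : IsOpen Ω) {x v : E d}
    {r s : ℝ} (hx : x ∈ closure Ω) (hxs : x + s • v ∈ Ω) (hr : 0 < r) (hrs : r ≤ s) :
    x + r • v ∈ Ω := by
  have hs : 0 < s := hr.trans_le hrs
  have h := hc.combo_closure_interior_mem_interior (x := x) (y := x + s • v) hx
    (by rwa [ho.interior_eq]) (a := 1 - r / s) (b := r / s)
    (by rw [sub_nonneg]; exact (div_le_one hs).2 hrs) (by positivity) (by ring)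
  rw [ho.interior_eq] at h
  convert h using 1
  have : r • v = (r / s) • s • v := by rw [smul_smul, div_mul_cancel₀ _ hs.ne']
  rw [this]
  module

/-- Of two such points on one line, the one further along `v` would lie strictly between a point of
the closure and a point of `Ω`, hence inside the open set `Ω`, and not on its boundary. Both signs
of `v` occur: entering `Ω` along `e`, and leaving it along `e`. -/
theorem injOn_projOrth_entry {Ω : Set (E d)} (hc : Convex ℝ Ω) (ho : IsOpen Ω) {e v : E d}
    (hv : v = e ∨ v = -e) :
    InjOn (projOrth e) {z | z ∈ frontier Ω ∧ ∃ s > (0 : ℝ), z + s • v ∈ Ω} := by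
  have key : ∀ z z' : E d, z ∈ frontier Ω → z' ∈ frontier Ω → (∃ s > (0 : ℝ), z' + s • v ∈ Ω) →
      ∀ c > (0 : ℝ), z' = z + c • v → False := by
    rintro z z' hz hz' ⟨s, hs, hs'⟩ c hc0 rfl
    have h1 : z + (c + s) • v ∈ Ω := by rwa [add_smul, ← add_assoc]
    have h2 := add_smul_mem_of_convex hc ho (frontier_subset_closure hz) h1 hc0 (by linarith)
    rw [ho.frontier_eq] at hz'
    exact hz'.2 h2
  rintro z ⟨hz, hz1⟩ z' ⟨hz', hz1'⟩ heq
  obtain ⟨s, hs⟩ := exists_eq_projOrth_add_smul e z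
  obtain ⟨s', hs'⟩ := exists_eq_projOrth_add_smul e z'
  obtain ⟨c, hcv⟩ : ∃ c : ℝ, z' = z + c • v := by
    rcases hv with rfl | rfl
    · refine ⟨s' - s, ?_⟩
      rw [hs', ← heq]
      conv_rhs => rw [hs]
      module
    · refine ⟨s - s', ?_⟩
      rw [hs', ← heq]
      conv_rhs => rw [hs]
      module
  rcases lt_trichotomy c 0 with h | h | h
  · exact (key z' z hz' hz hz1 (-c) (by linarith) (by rw [hcv]; module)).elim
  · rw [hcv, h, zero_smul, add_zero]
  · exact (key z z' hz hz' hz1' c h hcv).elim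

theorem measurableSet_entry {Ω G : Set (E d)} (ho : IsOpen Ω) (hG : MeasurableSet G) (v : E d) :
    MeasurableSet {z | z ∈ G ∧ ∃ s > (0 : ℝ), z + s • v ∈ Ω} := by
  have h : IsOpen {z : E d | ∃ s > (0 : ℝ), z + s • v ∈ Ω} := by
    have : {z : E d | ∃ s > (0 : ℝ), z + s • v ∈ Ω} =
        ⋃ s > (0 : ℝ), (fun z => z + s • v) ⁻¹' Ω := by
      ext z; simp
    rw [this]
    exact isOpen_biUnion fun s _ => ho.preimage (by fun_prop)
  exact hG.inter h.measurableSet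

theorem lintegral_entry_le {Ω G : Set (E d)} (hc : Convex ℝ Ω) (ho : IsOpen Ω)
    (hG : MeasurableSet G) (hGΩ : G ⊆ frontier Ω) {e v : E d} (he : e ≠ 0) (hv : v = e ∨ v = -e)
    (φ : E d → ℝ) :
    ∫⁻ p : (ℝ ∙ e)ᗮ, (⨆ z ∈ {z | z ∈ G ∧ ∃ s > (0 : ℝ), z + s • v ∈ Ω},
      ⨆ _ : projOrth e z = p, ‖φ z‖ₑ ^ 2) ≤ sqInt ((surf d).restrict G) φ := by
  refine (lintegral_iSup_fiber_le he (measurableSet_entry ho hG v)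
    ((injOn_projOrth_entry hc ho hv).mono ?_) _).trans (sqInt_mono_set (fun z hz => hz.1) φ)
  exact fun z hz => ⟨hGΩ hz.1, hz.2⟩

theorem gradient_continuous_enorm {φ : E d → ℝ} (hφ : ContDiff ℝ ∞ φ) :
    Continuous fun x => ‖gradient φ x‖ₑ ^ 2 :=
  (ENNReal.continuous_pow 2).comp (continuous_gradient hφ).enorm

/-- The parameter `s + t - r` is the endpoint opposite to `r`, so either endpoint is bounded by the
other. Only the open segment has to lie in `V`, because the endpoints may be boundary points. -/
theorem enorm_sq_le_add_line {φ : E d → ℝ} (hφ : ContDiff ℝ ∞ φ) {e : E d} (he : ‖e‖ = 1)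
    (p : E d) {s t r : ℝ} (h : s ≤ t) {V : Set (E d)} (hV : ∀ τ ∈ Ioo s t, p + τ • e ∈ V)
    (hr : r = s ∨ r = t) :
    ‖φ (p + r • e)‖ₑ ^ 2 ≤ 2 * ‖φ (p + (s + t - r) • e)‖ₑ ^ 2 + 2 * (ENNReal.ofReal (t - s) *
      ∫⁻ τ : ℝ, V.indicator (fun x => ‖gradient φ x‖ₑ ^ 2) (p + τ • e)) := by
  have h1 := enorm_sub_sq_le_of_contDiff hφ p e h
  have he' : ‖e‖ₑ = 1 := by rw [← ofReal_norm, he, ENNReal.ofReal_one]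
  have h2 : ∫⁻ τ in Ioc s t, ‖gradient φ (p + τ • e)‖ₑ ^ 2 ≤
      ∫⁻ τ : ℝ, V.indicator (fun x => ‖gradient φ x‖ₑ ^ 2) (p + τ • e) := by
    rw [setLIntegral_congr (Ioo_ae_eq_Ioc (a := s) (b := t)).symm,
      ← lintegral_indicator measurableSet_Ioo]
    refine lintegral_mono fun τ => ?_
    by_cases hτ : τ ∈ Ioo s t
    · rw [indicator_of_mem hτ, indicator_of_mem (hV τ hτ)]
    · rw [indicator_of_notMem hτ]; exact zero_le
  rw [he', one_pow, one_mul] at h1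
  have h3 : ‖φ (p + r • e) - φ (p + (s + t - r) • e)‖ₑ ^ 2 ≤ ENNReal.ofReal (t - s) *
      ∫⁻ τ : ℝ, V.indicator (fun x => ‖gradient φ x‖ₑ ^ 2) (p + τ • e) := by
    refine le_trans ?_ (h1.trans (mul_le_mul' le_rfl h2))
    rcases hr with rfl | rfl
    · rw [add_sub_cancel_left, enorm_sub_rev]
    · rw [add_sub_cancel_right]
  calc ‖φ (p + r • e)‖ₑ ^ 2
      = ‖φ (p + (s + t - r) • e) + (φ (p + r • e) - φ (p + (s + t - r) • e))‖ₑ ^ 2 := by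
        rw [add_sub_cancel]
    _ ≤ _ := (enorm_add_sq_le _ _).trans (by gcongr)

/-- Friedrichs' inequality on a set whose points leave `Ω` through `G` in the direction `e`. -/
theorem sqInt_le_of_exit {φ : E d → ℝ} (hφ : ContDiff ℝ ∞ φ) {Ω G Q V : Set (E d)}
    (hc : Convex ℝ Ω) (ho : IsOpen Ω) (hG : MeasurableSet G) (hGΩ : G ⊆ frontier Ω)
    (hQ : MeasurableSet Q) (hQΩ : Q ⊆ Ω) (hV : MeasurableSet V) {e : E d} (he : ‖e‖ = 1) {L : ℝ}
    (hexit : ∀ y ∈ Q, ∃ s, 0 < s ∧ s ≤ L ∧ y + s • e ∈ G ∧ ∀ r ∈ Icc 0 s, y + r • e ∈ V) :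
    sqInt (volume.restrict Q) φ ≤ ENNReal.ofReal L * (2 * sqInt ((surf d).restrict G) φ) +
      ENNReal.ofReal L * (2 * (ENNReal.ofReal L *
        sqInt (volume.restrict (Ω ∩ V)) (gradient φ))) := by
  have he0 : e ≠ 0 := fun h => by simp [h] at he
  set D : E d → ℝ≥0∞ := (Ω ∩ V).indicator (fun x => ‖gradient φ x‖ₑ ^ 2) with hD
  have hΩV : MeasurableSet (Ω ∩ V) := ho.measurableSet.inter hV
  have hDm : Measurable D := (gradient_continuous_enorm hφ).measurable.indicator hΩV
  -- `g p` is `|φ|²` at the point of `G` where the line over `p` leaves `Ω`. The direction is `-e`,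
  -- which leads from an exit point back into `Ω`.
  set g : (ℝ ∙ e)ᗮ → ℝ≥0∞ := fun p => ⨆ z ∈ {z | z ∈ G ∧ ∃ s > (0 : ℝ), z + s • (-e) ∈ Ω},
      ⨆ _ : projOrth e z = p, ‖φ z‖ₑ ^ 2 with hg
  have hfm : Measurable (Q.indicator fun x => ‖φ x‖ₑ ^ 2) :=
    (((ENNReal.continuous_pow 2).comp hφ.continuous.enorm).measurable).indicator hQ
  have hline : ∀ p : (ℝ ∙ e)ᗮ, ∫⁻ s : ℝ, Q.indicator (fun x => ‖φ x‖ₑ ^ 2) (p + s • e) ≤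
      ENNReal.ofReal L * (2 * g p) +
        ENNReal.ofReal L * (2 * (ENNReal.ofReal L * ∫⁻ s : ℝ, D (p + s • e))) := by
    intro p
    by_cases hne : ∃ s : ℝ, (p : E d) + s • e ∈ Q
    swap
    · push Not at hne
      rw [lintegral_congr (fun s => indicator_of_notMem (hne s) _)]
      simp
    obtain ⟨s₀, hs₀⟩ := hne
    obtain ⟨σ₀, hσ₀, -, hσG, -⟩ := hexit _ hs₀
    have hinside : ∀ s σ : ℝ, (p : E d) + s • e ∈ Q → 0 < σ → (p : E d) + s • e + σ • e ∈ G →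
        ∀ r, s ≤ r → r < s + σ → (p : E d) + r • e ∈ Ω := by
      intro s σ hs hσ hG' r hr hr'
      have h1 : ((p : E d) + s • e + σ • e) + σ • (-e) ∈ Ω := by
        have : ((p : E d) + s • e + σ • e) + σ • (-e) = p + s • e := by module
        rw [this]; exact hQΩ hs
      have h2 := add_smul_mem_of_convex hc ho (frontier_subset_closure (hGΩ hG')) h1
        (r := s + σ - r) (by linarith) (by linarith)
      convert h2 using 1
      module
    set β := s₀ + σ₀ with hβ
    have hβG : (p : E d) + β • e ∈ G := by rw [hβ, add_smul, ← add_assoc]; exact hσG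
    have hβnot : ∀ s σ : ℝ, (p : E d) + s • e ∈ Q → 0 < σ → (p : E d) + s • e + σ • e ∈ G →
        (p : E d) + (s + σ) • e ∉ Ω := by
      intro s σ _ _ hG' hΩ'
      rw [add_smul, ← add_assoc] at hΩ'
      have := hGΩ hG'
      rw [ho.frontier_eq] at this
      exact this.2 hΩ'
    -- All points of `Q` on one line leave `Ω` at the same parameter `β`, because the line meets the
    -- convex set `Ω` in an interval.
    have huniq : ∀ s σ : ℝ, (p : E d) + s • e ∈ Q → 0 < σ → (p : E d) + s • e + σ • e ∈ G →
        s + σ = β := by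
      intro s σ hs hσ hG'
      have hn1 := hβnot s σ hs hσ hG'
      have hn0 := hβnot s₀ σ₀ hs₀ hσ₀ hσG
      rcases lt_trichotomy (s + σ) β with h | h | h
      · by_cases h' : s₀ ≤ s + σ
        · exact (hn1 (hinside s₀ σ₀ hs₀ hσ₀ hσG _ h' h)).elim
        · push Not at h'
          exfalso
          refine hn1 ?_
          have h2 := add_smul_mem_of_convex hc ho (x := (p : E d) + s • e) (v := e)
            (subset_closure (hQΩ hs)) (s := s₀ - s) (r := σ) (by
              have : (p : E d) + s • e + (s₀ - s) • e = p + s₀ • e := by module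
              rw [this]; exact hQΩ hs₀) hσ (by linarith)
          convert h2 using 1
          module
      · exact h
      · by_cases h' : s ≤ β
        · exact (hn0 (hinside s σ hs hσ hG' _ h' h)).elim
        · push Not at h'
          exfalso
          refine hn0 ?_
          have h2 := add_smul_mem_of_convex hc ho (x := (p : E d) + s₀ • e) (v := e)
            (subset_closure (hQΩ hs₀)) (s := s - s₀) (r := σ₀) (by
              have : (p : E d) + s₀ • e + (s - s₀) • e = p + s • e := by module
              rw [this]; exact hQΩ hs) hσ₀ (by linarith)
          convert h2 using 1
          module
    have hgβ : ‖φ ((p : E d) + β • e)‖ₑ ^ 2 ≤ g p := by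
      simp only [hg]
      refine le_iSup₂_of_le ((p : E d) + β • e) ⟨hβG, σ₀, hσ₀, ?_⟩
        (le_iSup_of_le (projOrth_coe_add_smul e p β) le_rfl)
      have : (p : E d) + β • e + σ₀ • (-e) = p + s₀ • e := by rw [hβ]; module
      rw [this]; exact hQΩ hs₀
    -- The bound is independent of `s` and is needed only for `s` in an interval of length `L`
    -- ending at `β`; integrating in `s` therefore costs one factor `L`.
    have hpt : ∀ s : ℝ, Q.indicator (fun x => ‖φ x‖ₑ ^ 2) ((p : E d) + s • e) ≤
        (Icc (β - L) β).indicator (fun _ => 2 * g p +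
          2 * (ENNReal.ofReal L * ∫⁻ s : ℝ, D (p + s • e))) s := by
      intro s
      by_cases hs : (p : E d) + s • e ∈ Q
      swap
      · rw [indicator_of_notMem hs]; exact zero_le
      obtain ⟨σ, hσ, hσL, hσG', hσV⟩ := hexit _ hs
      have hσβ := huniq s σ hs hσ hσG'
      rw [indicator_of_mem hs, indicator_of_mem (by constructor <;> linarith)]
      have h1 := enorm_sq_le_add_line hφ he (p : E d) (s := s) (t := β) (r := s) (by linarith)
        (V := Ω ∩ V) (fun τ hτ => ⟨hinside s σ hs hσ hσG' τ hτ.1.le (by linarith [hτ.2]), by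
          have := hσV (τ - s) ⟨by linarith [hτ.1], by linarith [hτ.2]⟩
          convert this using 1
          module⟩) (Or.inl rfl)
      rw [add_sub_cancel_left] at h1
      refine h1.trans ?_
      gcongr
      linarith
    calc ∫⁻ s : ℝ, Q.indicator (fun x => ‖φ x‖ₑ ^ 2) (p + s • e)
        ≤ ∫⁻ s : ℝ, (Icc (β - L) β).indicator (fun _ => 2 * g p +
          2 * (ENNReal.ofReal L * ∫⁻ s : ℝ, D (p + s • e))) s := lintegral_mono hpt
      _ = (2 * g p + 2 * (ENNReal.ofReal L * ∫⁻ s : ℝ, D (p + s • e))) * ENNReal.ofReal L := by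
          rw [lintegral_indicator_const measurableSet_Icc, Real.volume_Icc]
          congr 2
          ring
      _ = _ := by ring
  have hDline : Measurable fun p : (ℝ ∙ e)ᗮ => ∫⁻ s : ℝ, D (p + s • e) := by
    refine Measurable.lintegral_prod_right' (f := fun q : (ℝ ∙ e)ᗮ × ℝ => D (q.1 + q.2 • e)) ?_
    exact hDm.comp (by fun_prop)
  calc sqInt (volume.restrict Q) φ = ∫⁻ x, Q.indicator (fun x => ‖φ x‖ₑ ^ 2) x := by
        rw [lintegral_indicator hQ]; rfl
    _ = ∫⁻ p : (ℝ ∙ e)ᗮ, ∫⁻ s : ℝ, Q.indicator (fun x => ‖φ x‖ₑ ^ 2) (p + s • e) :=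
        lintegral_eq_lintegral_lines he hfm
    _ ≤ ∫⁻ p : (ℝ ∙ e)ᗮ, (ENNReal.ofReal L * (2 * g p) +
        ENNReal.ofReal L * (2 * (ENNReal.ofReal L * ∫⁻ s : ℝ, D (p + s • e)))) :=
        lintegral_mono hline
    _ = ENNReal.ofReal L * (2 * ∫⁻ p, g p) + ENNReal.ofReal L * (2 * (ENNReal.ofReal L *
        ∫⁻ p : (ℝ ∙ e)ᗮ, ∫⁻ s : ℝ, D (p + s • e))) := by
        -- Additivity uses measurability of the gradient term alone; `g` may fail to be measurable,
        -- and finite constants can be pulled out regardless.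
        rw [lintegral_add_right _ (((hDline.const_mul _).const_mul _).const_mul _),
          lintegral_const_mul' _ _ (by simp), lintegral_const_mul' _ _ (by simp),
          lintegral_const_mul' _ _ (by simp), lintegral_const_mul' _ _ (by simp),
          lintegral_const_mul' _ _ (by simp)]
    _ ≤ _ := by
        rw [← lintegral_eq_lintegral_lines he hDm, hD, lintegral_indicator hΩV]
        gcongr
        · exact lintegral_entry_le hc ho hG hGΩ he0 (Or.inr rfl) φ
        · exact le_rfl

/-- The section of the projection along `e` over the hyperplane `⟪a, x⟫ = b`. -/
def hyperplaneSection (a e : E d) (b : ℝ) (p : (ℝ ∙ e)ᗮ) : E d :=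
  (p : E d) + ((b - inner ℝ a (p : E d)) / inner ℝ a e) • e

/-- Moving `p` by `δ` changes the height along `e` by `⟪a, δ⟫ / ⟪a, e⟫`. If `⟪a, e⟫ = 0`, the
quotients are zero by convention and the bound still holds. -/
theorem lipschitzWith_hyperplaneSection (a e : E d) (b : ℝ) :
    LipschitzWith (1 + ‖a‖₊ * ‖e‖₊ / ‖(inner ℝ a e : ℝ)‖₊) (hyperplaneSection a e b) := by
  refine LipschitzWith.of_dist_le_mul fun p q => ?_
  rw [dist_eq_norm, dist_eq_norm]
  have h : hyperplaneSection a e b p - hyperplaneSection a e b q =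
      ((p - q : (ℝ ∙ e)ᗮ) : E d) - (inner ℝ a ((p - q : (ℝ ∙ e)ᗮ) : E d) / inner ℝ a e) • e := by
    simp only [hyperplaneSection, Submodule.coe_sub, inner_sub_right, sub_div]
    module
  rw [h]
  refine (norm_sub_le _ _).trans ?_
  rw [norm_smul, norm_div, Submodule.coe_norm]
  have h1 := norm_inner_le_norm (𝕜 := ℝ) a ((p - q : (ℝ ∙ e)ᗮ) : E d)
  push_cast
  calc ‖((p - q : (ℝ ∙ e)ᗮ) : E d)‖ +
        ‖(inner ℝ a ((p - q : (ℝ ∙ e)ᗮ) : E d) : ℝ)‖ / ‖(inner ℝ a e : ℝ)‖ * ‖e‖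
      ≤ ‖((p - q : (ℝ ∙ e)ᗮ) : E d)‖ +
        (‖a‖ * ‖((p - q : (ℝ ∙ e)ᗮ) : E d)‖) / ‖(inner ℝ a e : ℝ)‖ * ‖e‖ := by gcongr
    _ = _ := by rw [Submodule.coe_sub]; ring

theorem hyperplaneSection_projOrth {a e : E d} {b : ℝ} (hae : inner ℝ a e ≠ (0 : ℝ)) {z : E d}
    (hz : inner ℝ a z = b) : hyperplaneSection a e b (projOrth e z) = z := by
  obtain ⟨s, hs⟩ := exists_eq_projOrth_add_smul e z
  have h1 : inner ℝ a z = inner ℝ a (projOrth e z : E d) + s * inner ℝ a e := by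
    conv_lhs => rw [hs]
    rw [inner_add_right, inner_smul_right]
  have h2 : (b - inner ℝ a (projOrth e z : E d)) / inner ℝ a e = s := by
    rw [div_eq_iff hae, ← hz, h1]; ring
  rw [hyperplaneSection, h2]
  exact hs.symm

/-- The trace inequality on a piece of a hyperplane, entered from `Ω` in the direction `e`. -/
theorem exists_sqInt_trace_le {Ω G A : Set (E d)} (hc : Convex ℝ Ω) (ho : IsOpen Ω)
    (hG : MeasurableSet G) (hGΩ : G ⊆ frontier Ω) {a e : E d} {b : ℝ} (he : ‖e‖ = 1)
    (hae : inner ℝ a e ≠ (0 : ℝ)) (hA : IsCompact A) (hAH : ∀ z ∈ A, inner ℝ a z = b) {L : ℝ}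
    (hentry : ∀ z ∈ A, ∃ s, 0 < s ∧ s ≤ L ∧ z - s • e ∈ G ∧ ∀ r ∈ Ioo 0 s, z - r • e ∈ Ω) :
    ∃ C : ℝ≥0∞, C ≠ ⊤ ∧ ∀ φ : E d → ℝ, ContDiff ℝ ∞ φ → sqInt ((surf d).restrict A) φ ≤
      C * (2 * sqInt ((surf d).restrict G) φ +
        2 * (ENNReal.ofReal L * sqInt (volume.restrict Ω) (gradient φ))) := by
  have he0 : e ≠ 0 := fun h => by simp [h] at he
  set K : NNReal := 1 + ‖a‖₊ * ‖e‖₊ / ‖(inner ℝ a e : ℝ)‖₊ with hK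
  have hlip := lipschitzWith_hyperplaneSection a e b
  rw [← hK] at hlip
  -- `A` is the image of its projection under a `K`-Lipschitz section, so its surface measure is at
  -- most `K ^ (d - 1)` times the Lebesgue measure of the projection.
  refine ⟨(K : ℝ≥0∞) ^ (d - 1), by finiteness, fun φ hφ => ?_⟩
  set D : E d → ℝ≥0∞ := Ω.indicator (fun x => ‖gradient φ x‖ₑ ^ 2) with hD
  have hDm : Measurable D := (gradient_continuous_enorm hφ).measurable.indicator ho.measurableSet
  set g : (ℝ ∙ e)ᗮ → ℝ≥0∞ := fun p => ⨆ z ∈ {z | z ∈ G ∧ ∃ s > (0 : ℝ), z + s • e ∈ Ω},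
      ⨆ _ : projOrth e z = p, ‖φ z‖ₑ ^ 2 with hg
  have hpm : Measurable (projOrth e) := (projOrth e).continuous.measurable
  have hAm : MeasurableSet A := hA.measurableSet
  have hpA : MeasurableSet (projOrth e '' A) := (hA.image (projOrth e).continuous).measurableSet
  have hle : ((surf d).restrict A).map (projOrth e) ≤
      (K : ℝ≥0∞) ^ (d - 1) • (volume : Measure (ℝ ∙ e)ᗮ).restrict (projOrth e '' A) := by
    refine Measure.le_iff.2 fun B hB => ?_
    rw [Measure.map_apply hpm hB, Measure.restrict_apply (hpm hB), Measure.smul_apply,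
      Measure.restrict_apply hB, smul_eq_mul]
    have hsub : projOrth e ⁻¹' B ∩ A ⊆ hyperplaneSection a e b '' (B ∩ projOrth e '' A) := by
      rintro z ⟨hzB, hzA⟩
      exact ⟨projOrth e z, ⟨hzB, z, hzA, rfl⟩, hyperplaneSection_projOrth hae (hAH z hzA)⟩
    refine (measure_mono hsub).trans ?_
    have := euclideanHausdorffMeasure_image_le
      (hlip.lipschitzOnWith (s := B ∩ projOrth e '' A)) (d - 1)
    rw [← InnerProductSpace.euclideanHausdorffMeasure_eq_volume, finrank_orthogonal_span he0]
    exact this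
  have hFm : Measurable fun p : (ℝ ∙ e)ᗮ => ‖φ (hyperplaneSection a e b p)‖ₑ ^ 2 :=
    ((ENNReal.continuous_pow 2).comp
      (hφ.continuous.comp hlip.continuous).enorm).measurable
  have hDline : Measurable fun p : (ℝ ∙ e)ᗮ => ∫⁻ s : ℝ, D (p + s • e) := by
    refine Measurable.lintegral_prod_right' (f := fun q : (ℝ ∙ e)ᗮ × ℝ => D (q.1 + q.2 • e)) ?_
    exact hDm.comp (by fun_prop)
  have hpt : ∀ p ∈ projOrth e '' A, ‖φ (hyperplaneSection a e b p)‖ₑ ^ 2 ≤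
      2 * g p + 2 * (ENNReal.ofReal L * ∫⁻ s : ℝ, D (p + s • e)) := by
    rintro _ ⟨z, hz, rfl⟩
    rw [hyperplaneSection_projOrth hae (hAH z hz)]
    obtain ⟨σ, hσ, hσL, hσG, hσΩ⟩ := hentry z hz
    obtain ⟨t, ht⟩ := exists_eq_projOrth_add_smul e z
    set p := projOrth e z with hp
    have h1 := enorm_sq_le_add_line hφ he (p : E d) (s := t - σ) (t := t) (r := t) (by linarith)
      (V := Ω) (fun τ hτ => by
        have := hσΩ (t - τ) ⟨by linarith [hτ.2], by linarith [hτ.1]⟩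
        rw [ht] at this
        convert this using 1
        module) (Or.inr rfl)
    rw [add_sub_cancel_right, ← ht] at h1
    refine h1.trans ?_
    have h2 : (p : E d) + (t - σ) • e = z - σ • e := by
      rw [eq_sub_iff_add_eq, ht]
      module
    rw [h2]
    gcongr
    · simp only [hg]
      -- The midpoint of the chord lies in `Ω` and shows that `z - σ • e` is a point of entry.
      refine le_iSup₂_of_le (z - σ • e) ⟨hσG, σ / 2, by positivity, ?_⟩ (le_iSup_of_le ?_ le_rfl)
      · have := hσΩ (σ / 2) ⟨by positivity, by linarith⟩
        convert this using 1
        module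
      · rw [← h2]; exact projOrth_coe_add_smul e p _
    · linarith
  calc sqInt ((surf d).restrict A) φ
      = ∫⁻ z in A, ‖φ (hyperplaneSection a e b (projOrth e z))‖ₑ ^ 2 ∂(surf d) := by
        refine setLIntegral_congr_fun hAm fun z hz => ?_
        simp only [hyperplaneSection_projOrth hae (hAH z hz)]
    _ = ∫⁻ p, ‖φ (hyperplaneSection a e b p)‖ₑ ^ 2 ∂(((surf d).restrict A).map (projOrth e)) := by
        rw [lintegral_map hFm hpm]
    _ ≤ (K : ℝ≥0∞) ^ (d - 1) *
          ∫⁻ p in projOrth e '' A, ‖φ (hyperplaneSection a e b p)‖ₑ ^ 2 := by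
        refine (lintegral_mono' hle le_rfl).trans_eq ?_
        rw [lintegral_smul_measure, smul_eq_mul]
    _ ≤ (K : ℝ≥0∞) ^ (d - 1) * ∫⁻ p, (2 * g p +
          2 * (ENNReal.ofReal L * ∫⁻ s : ℝ, D (p + s • e))) := by
        exact mul_le_mul' le_rfl
          ((setLIntegral_mono' hpA hpt).trans (setLIntegral_le_lintegral _ _))
    _ ≤ _ := by
        rw [lintegral_add_right _ ((hDline.const_mul _).const_mul _),
          lintegral_const_mul' _ _ (by simp), lintegral_const_mul' _ _ (by simp),
          lintegral_const_mul' _ _ (by simp),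
          ← lintegral_eq_lintegral_lines he hDm, hD, lintegral_indicator ho.measurableSet]
        gcongr
        · exact lintegral_entry_le hc ho hG hGΩ he0 (Or.inl rfl) φ
        · exact le_rfl

end

section

/-! ### The Poincaré inequality on a convex set -/

theorem lintegral_comp_add_smul {G : E d → ℝ≥0∞} (hG : Measurable G) (c : E d) {τ : ℝ}
    (hτ : 1 / 2 ≤ τ) : ∫⁻ y, G (c + τ • y) ≤ 2 ^ d * ∫⁻ y, G y := by
  have hτ0 : τ ≠ 0 := by linarith
  have hτp : 0 < τ := by linarith
  have h1 : ∫⁻ y, G (c + τ • y) = ∫⁻ z, G (c + z) ∂((volume : Measure (E d)).map (τ • ·)) := by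
    rw [lintegral_map (f := fun z => G (c + z)) (hG.comp (by fun_prop)) (by fun_prop)]
  rw [h1, Measure.map_addHaar_smul _ hτ0, lintegral_smul_measure, lintegral_add_left_eq_self,
    smul_eq_mul]
  gcongr
  rw [finrank_euclideanSpace, Fintype.card_fin]
  calc ENNReal.ofReal |(τ ^ d)⁻¹| ≤ ENNReal.ofReal (2 ^ d) := by
        refine ENNReal.ofReal_le_ofReal ?_
        rw [abs_of_pos (by positivity), ← inv_pow]
        refine pow_le_pow_left₀ (by positivity) ?_ d
        rw [inv_le_comm₀ hτp (by norm_num)]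
        linarith
    _ = 2 ^ d := by rw [ENNReal.ofReal_pow (by norm_num)]; norm_num

/-- Integrate the gradient along the segment from `x` to `y`. For `τ ≥ 1/2` the point `x + τ (y -
x)` is taken as the new variable in place of `y`, for `τ ≤ 1/2` in place of `x`. The Jacobian of the
substitution then costs at most `2 ^ d`, with no singularity at either end. -/
theorem lintegral_lintegral_sub_le {φ : E d → ℝ} (hφ : ContDiff ℝ ∞ φ) {Q : Set (E d)}
    (hc : Convex ℝ Q) (hQ : MeasurableSet Q) {D : ℝ≥0∞} (hD : ∀ x ∈ Q, ∀ y ∈ Q, ‖y - x‖ₑ ≤ D) :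
    ∫⁻ x in Q, ∫⁻ y in Q, ‖φ y - φ x‖ₑ ^ 2 ≤
      D ^ 2 * (2 ^ d * (volume Q * sqInt (volume.restrict Q) (gradient φ))) := by
  set G : E d → ℝ≥0∞ := Q.indicator (fun x => ‖gradient φ x‖ₑ ^ 2) with hG
  have hGm : Measurable G := (gradient_continuous_enorm hφ).measurable.indicator hQ
  have hGint : ∫⁻ y, G y = sqInt (volume.restrict Q) (gradient φ) := by
    rw [hG, lintegral_indicator hQ]; rfl
  have hm3 : Measurable fun q : E d × E d × ℝ => G (q.1 + q.2.2 • (q.2.1 - q.1)) :=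
    hGm.comp (by fun_prop)
  have h1 : ∫⁻ x in Q, ∫⁻ y in Q, ‖φ y - φ x‖ₑ ^ 2 ≤
      ∫⁻ x in Q, ∫⁻ y in Q, D ^ 2 * ∫⁻ τ in Ioc (0 : ℝ) 1, G (x + τ • (y - x)) := by
    refine setLIntegral_mono' hQ fun x hx => setLIntegral_mono' hQ fun y hy => ?_
    have h := enorm_sub_sq_le_of_contDiff hφ x (y - x) (zero_le_one (α := ℝ))
    rw [one_smul, zero_smul, add_zero, add_sub_cancel, sub_zero, ENNReal.ofReal_one, one_mul] at h
    refine h.trans (mul_le_mul' (pow_le_pow_left' (hD x hx y hy) 2) ?_)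
    refine setLIntegral_mono' measurableSet_Ioc fun τ hτ => ?_
    rw [hG, indicator_of_mem]
    exact hc.add_smul_sub_mem hx hy ⟨hτ.1.le, hτ.2⟩
  have hτ : ∀ τ ∈ Ioc (0 : ℝ) 1, ∫⁻ x in Q, ∫⁻ y in Q, G (x + τ • (y - x)) ≤
      2 ^ d * (volume Q * ∫⁻ y, G y) := by
    intro τ _
    rcases le_total (1 / 2) τ with h | h
    · calc ∫⁻ x in Q, ∫⁻ y in Q, G (x + τ • (y - x)) ≤ ∫⁻ _ in Q, 2 ^ d * ∫⁻ y, G y := by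
            refine lintegral_mono fun x => (setLIntegral_le_lintegral _ _).trans ?_
            have := lintegral_comp_add_smul hGm ((1 - τ) • x) h
            refine le_trans (le_of_eq ?_) this
            refine lintegral_congr fun y => ?_
            congr 1
            module
        _ = _ := by rw [setLIntegral_const]; ring
    · have hm : Measurable fun q : E d × E d => G (q.1 + τ • (q.2 - q.1)) :=
        hGm.comp (by fun_prop)
      rw [lintegral_lintegral_swap hm.aemeasurable]
      calc ∫⁻ y in Q, ∫⁻ x in Q, G (x + τ • (y - x)) ≤ ∫⁻ _ in Q, 2 ^ d * ∫⁻ y, G y := by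
            refine lintegral_mono fun y => (setLIntegral_le_lintegral _ _).trans ?_
            have := lintegral_comp_add_smul hGm (τ • y) (τ := 1 - τ) (by linarith)
            refine le_trans (le_of_eq ?_) this
            refine lintegral_congr fun x => ?_
            congr 1
            module
        _ = _ := by rw [setLIntegral_const]; ring
  have hm2 : ∀ x : E d, Measurable fun q : E d × ℝ => G (x + q.2 • (q.1 - x)) := fun x =>
    hGm.comp (by fun_prop)
  have hm2' : ∀ x : E d, Measurable fun y : E d => ∫⁻ τ in Ioc (0 : ℝ) 1, G (x + τ • (y - x)) :=
    fun x => (hm2 x).lintegral_prod_right'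
  have hm4 : Measurable fun q : E d × ℝ => ∫⁻ y in Q, G (q.1 + q.2 • (y - q.1)) := by
    refine Measurable.lintegral_prod_right'
      (f := fun r : (E d × ℝ) × E d => G (r.1.1 + r.1.2 • (r.2 - r.1.1))) ?_
    exact hGm.comp (by fun_prop)
  calc ∫⁻ x in Q, ∫⁻ y in Q, ‖φ y - φ x‖ₑ ^ 2
      ≤ ∫⁻ x in Q, ∫⁻ y in Q, D ^ 2 * ∫⁻ τ in Ioc (0 : ℝ) 1, G (x + τ • (y - x)) := h1
    _ = ∫⁻ x in Q, D ^ 2 * ∫⁻ τ in Ioc (0 : ℝ) 1, ∫⁻ y in Q, G (x + τ • (y - x)) := by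
        refine lintegral_congr fun x => ?_
        rw [lintegral_const_mul _ (hm2' x), lintegral_lintegral_swap (hm2 x).aemeasurable]
    _ = D ^ 2 * ∫⁻ τ in Ioc (0 : ℝ) 1, ∫⁻ x in Q, ∫⁻ y in Q, G (x + τ • (y - x)) := by
        rw [lintegral_const_mul _ hm4.lintegral_prod_right',
          lintegral_lintegral_swap hm4.aemeasurable]
    _ ≤ D ^ 2 * ∫⁻ _ in Ioc (0 : ℝ) 1, 2 ^ d * (volume Q * ∫⁻ y, G y) :=
        mul_le_mul' le_rfl (setLIntegral_mono' measurableSet_Ioc hτ)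
    _ = _ := by rw [setLIntegral_const, Real.volume_Ioc, hGint]; simp

/-- `f x` minus the mean is the mean over `y` of `f x - f y`; Cauchy–Schwarz reduces its square to
the double integral. -/
theorem sqInt_sub_average_le {α : Type*} [MeasurableSpace α] (μ : Measure α) [IsFiniteMeasure μ]
    {f : α → ℝ} (hf : MemLp f 2 μ) {B : ℝ≥0∞}
    (hB : ∫⁻ x, ∫⁻ y, ‖f y - f x‖ₑ ^ 2 ∂μ ∂μ ≤ μ univ * B) :
    sqInt μ (fun x => f x - ⨍ y, f y ∂μ) ≤ B := by
  rcases eq_or_ne (μ univ) 0 with h0 | h0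
  · rw [Measure.measure_univ_eq_zero] at h0
    simp [sqInt, h0]
  have htop : μ univ ≠ ⊤ := measure_ne_top _ _
  have hint : Integrable f μ := hf.integrable (by norm_num)
  have hreal : μ.real univ ≠ 0 := (ENNReal.toReal_pos h0 htop).ne'
  have hpt : ∀ x, ‖f x - ⨍ y, f y ∂μ‖ₑ ^ 2 ≤ (μ univ)⁻¹ * ∫⁻ y, ‖f y - f x‖ₑ ^ 2 ∂μ := by
    intro x
    have h1 : f x - ⨍ y, f y ∂μ = -((μ.real univ)⁻¹ * ∫ y, (f y - f x) ∂μ) := by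
      rw [average_eq, integral_sub hint (integrable_const _), integral_const, smul_eq_mul,
        smul_eq_mul]
      field_simp
      ring
    have h2 : ‖(μ.real univ)⁻¹‖ₑ = (μ univ)⁻¹ := by
      rw [Real.enorm_eq_ofReal (by positivity), Measure.real, ENNReal.ofReal_inv_of_pos
        (ENNReal.toReal_pos h0 htop), ENNReal.ofReal_toReal htop]
    rw [h1, enorm_neg, enorm_mul, mul_pow, h2]
    calc (μ univ)⁻¹ ^ 2 * ‖∫ y, (f y - f x) ∂μ‖ₑ ^ 2
        ≤ (μ univ)⁻¹ ^ 2 * (μ univ * ∫⁻ y, ‖f y - f x‖ₑ ^ 2 ∂μ) := by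
          gcongr
          exact enorm_integral_sq_le μ (hf.1.sub aestronglyMeasurable_const)
      _ = (μ univ)⁻¹ * ((μ univ)⁻¹ * μ univ) * ∫⁻ y, ‖f y - f x‖ₑ ^ 2 ∂μ := by ring
      _ = _ := by rw [ENNReal.inv_mul_cancel h0 htop, mul_one]
  calc sqInt μ (fun x => f x - ⨍ y, f y ∂μ)
      ≤ ∫⁻ x, (μ univ)⁻¹ * ∫⁻ y, ‖f y - f x‖ₑ ^ 2 ∂μ ∂μ := lintegral_mono hpt
    _ = (μ univ)⁻¹ * ∫⁻ x, ∫⁻ y, ‖f y - f x‖ₑ ^ 2 ∂μ ∂μ :=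
        lintegral_const_mul' _ _ (ENNReal.inv_ne_top.2 h0)
    _ ≤ (μ univ)⁻¹ * (μ univ * B) := by gcongr
    _ = B := by rw [← mul_assoc, ENNReal.inv_mul_cancel h0 htop, one_mul]

theorem tendsto_average_of_eLpNorm {α : Type*} [MeasurableSpace α] (μ : Measure α)
    [IsFiniteMeasure μ] {f : ℕ → α → ℝ} {g : α → ℝ} (hf : ∀ n, MemLp (f n) 2 μ)
    (hg : MemLp g 2 μ) (h : Tendsto (fun n => eLpNorm (fun x => f n x - g x) 2 μ) atTop (𝓝 0)) :
    Tendsto (fun n => ⨍ x, f n x ∂μ) atTop (𝓝 (⨍ x, g x ∂μ)) := by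
  simp_rw [average_eq]
  refine Tendsto.const_smul ?_ _
  refine tendsto_integral_of_L1' _ hg.1
    (Eventually.of_forall fun n => (hf n).integrable (by norm_num)) ?_
  have hle : ∀ n, eLpNorm (f n - g) 1 μ ≤
      eLpNorm (fun x => f n x - g x) 2 μ * μ univ ^ (1 / (1 : ℝ≥0∞).toReal - 1 / (2 : ℝ≥0∞).toReal) :=
    fun n => eLpNorm_le_eLpNorm_mul_rpow_measure_univ (by norm_num) ((hf n).1.sub hg.1)
  refine tendsto_of_tendsto_of_tendsto_of_le_of_le tendsto_const_nhds ?_ (fun n => zero_le) hle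
  have := ENNReal.Tendsto.mul_const h
    (b := μ univ ^ (1 / (1 : ℝ≥0∞).toReal - 1 / (2 : ℝ≥0∞).toReal))
    (Or.inr (ENNReal.rpow_ne_top_of_nonneg (by norm_num) (measure_ne_top _ _)))
  simpa using this

/-! ### Passage to Sobolev functions -/

theorem tendsto_eLpNorm_mono_measure {α F : Type*} [MeasurableSpace α] [NormedAddCommGroup F]
    {μ ν : Measure α} (hle : μ ≤ ν) {f : ℕ → α → F}
    (h : Tendsto (fun n => eLpNorm (f n) 2 ν) atTop (𝓝 0)) :
    Tendsto (fun n => eLpNorm (f n) 2 μ) atTop (𝓝 0) :=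
  tendsto_of_tendsto_of_tendsto_of_le_of_le tendsto_const_nhds h (fun _ => zero_le)
    (fun _ => eLpNorm_mono_measure _ hle)

/-- One sequence serves all subdomains and all boundary pieces simultaneously, so an inequality
between several such integrals passes to the limit. -/
theorem IsTrace.exists_seq {Ω : Set (E d)} {v : L2 Ω} {g : L2Vec Ω} {w : L2Bdry Ω}
    (h : IsTrace Ω v g w) : ∃ φ : ℕ → E d → ℝ, (∀ n, ContDiff ℝ ∞ (φ n)) ∧
      (∀ Q ⊆ Ω, Tendsto (fun n => sqInt (volume.restrict Q) (φ n)) atTop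
        (𝓝 (sqInt (volume.restrict Q) v))) ∧
      (∀ Q ⊆ Ω, Tendsto (fun n => sqInt (volume.restrict Q) (gradient (φ n))) atTop
        (𝓝 (sqInt (volume.restrict Q) g))) ∧
      ∀ G ⊆ frontier Ω, Tendsto (fun n => sqInt ((surf d).restrict G) (φ n)) atTop
        (𝓝 (sqInt ((surf d).restrict G) w)) := by
  obtain ⟨φ, hφ, h1, h2, h3⟩ := h
  refine ⟨φ, hφ, fun Q hQ => ?_, fun Q hQ => ?_, fun G hG => ?_⟩
  · have hle : volume.restrict Q ≤ volume.restrict Ω := Measure.restrict_mono hQ le_rfl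
    exact tendsto_sqInt (fun n => (hφ n).continuous.aestronglyMeasurable)
      ((Lp.aestronglyMeasurable v).mono_measure hle) (tendsto_eLpNorm_mono_measure hle h1)
  · have hle : volume.restrict Q ≤ volume.restrict Ω := Measure.restrict_mono hQ le_rfl
    exact tendsto_sqInt (fun n => (continuous_gradient (hφ n)).aestronglyMeasurable)
      ((Lp.aestronglyMeasurable g).mono_measure hle) (tendsto_eLpNorm_mono_measure hle h2)
  · have hle : (surf d).restrict G ≤ (surf d).restrict (frontier Ω) :=
      Measure.restrict_mono hG le_rfl
    exact tendsto_sqInt (fun n => (hφ n).continuous.aestronglyMeasurable)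
      ((Lp.aestronglyMeasurable w).mono_measure hle) (tendsto_eLpNorm_mono_measure hle h3)

theorem sqInt_eq_zero_of_ae {α F : Type*} [MeasurableSpace α] [NormedAddCommGroup F]
    {μ : Measure α} {f : α → F} (h : ∀ᵐ x ∂μ, f x = 0) : sqInt μ f = 0 := by
  rw [sqInt, lintegral_congr_ae (g := fun _ => 0) (h.mono fun x hx => by simp [hx])]
  simp

theorem sqInt_zero_of_ae_restrict {Ω G : Set (E d)} {w : L2Bdry Ω} (hG : MeasurableSet G)
    (hGΩ : G ⊆ frontier Ω)
    (h0 : ∀ᵐ x ∂((surf d).restrict (frontier Ω)), x ∈ G → w x = 0) :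
    sqInt ((surf d).restrict G) w = 0 := by
  refine sqInt_eq_zero_of_ae ?_
  have h1 := ae_mono (Measure.restrict_mono hGΩ le_rfl) h0
  filter_upwards [h1, ae_restrict_mem hG] with x hx hxG
  exact hx hxG

/-- Friedrichs' inequality for Sobolev functions whose trace vanishes on `G`. -/
theorem IsTrace.sqInt_le_of_exit {Ω : Set (E d)} {v : L2 Ω} {g : L2Vec Ω} {w : L2Bdry Ω}
    (h : IsTrace Ω v g w) {G Q V : Set (E d)}
    (hc : Convex ℝ Ω) (ho : IsOpen Ω) (hG : MeasurableSet G) (hGΩ : G ⊆ frontier Ω)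
    (h0 : ∀ᵐ x ∂((surf d).restrict (frontier Ω)), x ∈ G → w x = 0)
    (hQ : MeasurableSet Q) (hQΩ : Q ⊆ Ω) (hV : MeasurableSet V) {e : E d} (he : ‖e‖ = 1) {L : ℝ}
    (hexit : ∀ y ∈ Q, ∃ s, 0 < s ∧ s ≤ L ∧ y + s • e ∈ G ∧ ∀ r ∈ Icc 0 s, y + r • e ∈ V) :
    sqInt (volume.restrict Q) v ≤
      ENNReal.ofReal L * (2 * (ENNReal.ofReal L * sqInt (volume.restrict (Ω ∩ V)) g)) := by
  obtain ⟨φ, hφ, h1, h2, h3⟩ := h.exists_seq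
  have hw := sqInt_zero_of_ae_restrict hG hGΩ h0
  have hlim := (ENNReal.Tendsto.const_mul (a := ENNReal.ofReal L) (ENNReal.Tendsto.const_mul
    (a := 2) (h3 G hGΩ) (Or.inr (by simp))) (Or.inr (by simp))).add
    (ENNReal.Tendsto.const_mul (a := ENNReal.ofReal L) (ENNReal.Tendsto.const_mul
    (a := 2) (ENNReal.Tendsto.const_mul (a := ENNReal.ofReal L) (h2 (Ω ∩ V) inter_subset_left)
      (Or.inr (by simp))) (Or.inr (by simp))) (Or.inr (by simp)))
  rw [hw, mul_zero, mul_zero, zero_add] at hlim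
  exact le_of_tendsto_of_tendsto' (h1 Q hQΩ) hlim fun n =>
    HeatHeat.sqInt_le_of_exit (hφ n) hc ho hG hGΩ hQ hQΩ hV he hexit

/-- Poincaré's inequality for Sobolev functions on a convex set. -/
theorem IsTrace.sqInt_sub_average_le {Ω : Set (E d)} {v : L2 Ω} {g : L2Vec Ω} {w : L2Bdry Ω}
    (h : IsTrace Ω v g w) {Q : Set (E d)} (hQΩ : Q ⊆ Ω) (hc : Convex ℝ Q) (hQ : MeasurableSet Q)
    (hfin : Bornology.IsBounded Q) {D : ℝ≥0∞} (hDtop : D ≠ ⊤)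
    (hD : ∀ x ∈ Q, ∀ y ∈ Q, ‖y - x‖ₑ ≤ D) :
    sqInt (volume.restrict Q) (fun x => v x - ⨍ y in Q, v y) ≤
      D ^ 2 * (2 ^ d * sqInt (volume.restrict Q) g) := by
  obtain ⟨φ, hφ, h1, h2, -⟩ := h
  have hle : volume.restrict Q ≤ volume.restrict Ω := Measure.restrict_mono hQΩ le_rfl
  replace h1 := tendsto_eLpNorm_mono_measure hle h1
  replace h2 := tendsto_eLpNorm_mono_measure hle h2
  have : IsFiniteMeasure (volume.restrict Q) := ⟨by
    rw [Measure.restrict_apply_univ]; exact hfin.measure_lt_top⟩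
  have hv : MemLp v 2 (volume.restrict Q) := (Lp.memLp v).mono_measure hle
  have hφm : ∀ n, MemLp (φ n) 2 (volume.restrict Q) := fun n => by
    obtain ⟨C, hC⟩ := (hfin.isCompact_closure.image (hφ n).continuous).isBounded.exists_norm_le
    refine MemLp.of_bound (hφ n).continuous.aestronglyMeasurable C ?_
    filter_upwards [ae_restrict_mem hQ] with x hx
    exact hC _ ⟨x, subset_closure hx, rfl⟩
  have hav := tendsto_average_of_eLpNorm (volume.restrict Q) hφm hv h1
  have hlim1 : Tendsto (fun n => sqInt (volume.restrict Q) (fun x => φ n x - ⨍ y in Q, φ n y))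
      atTop (𝓝 (sqInt (volume.restrict Q) (fun x => v x - ⨍ y in Q, v y))) := by
    refine tendsto_sqInt (fun n => ((hφm n).1.sub aestronglyMeasurable_const))
      (hv.1.sub aestronglyMeasurable_const) ?_
    refine tendsto_eLpNorm_add (a := fun n x => φ n x - v x)
      (a' := fun n _ => (⨍ y in Q, v y) - ⨍ y in Q, φ n y) (fun n => (hφm n).1.sub hv.1)
      (fun n => aestronglyMeasurable_const) h1 ?_
      (fun n => Eventually.of_forall fun x => by simp only []; ring)
    have hz : Tendsto (fun n => ‖(⨍ y in Q, v y) - ⨍ y in Q, φ n y‖ₑ) atTop (𝓝 0) := by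
      have := (tendsto_const_nhds (x := ⨍ y in Q, v y)).sub hav
      rw [sub_self] at this
      simpa using this.enorm
    have := ENNReal.Tendsto.mul_const hz
      (b := (volume.restrict Q) univ ^ (1 / (2 : ℝ≥0∞).toReal))
      (Or.inr (ENNReal.rpow_ne_top_of_nonneg (by norm_num) (measure_ne_top _ _)))
    rw [zero_mul] at this
    refine this.congr fun n => ?_
    rw [eLpNorm_const' _ (by norm_num) (by norm_num)]
  have hlim2 : Tendsto (fun n => D ^ 2 * (2 ^ d * sqInt (volume.restrict Q) (gradient (φ n))))
      atTop (𝓝 (D ^ 2 * (2 ^ d * sqInt (volume.restrict Q) g))) := by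
    refine ENNReal.Tendsto.const_mul (ENNReal.Tendsto.const_mul ?_ (Or.inr (by finiteness)))
      (Or.inr (by finiteness))
    exact tendsto_sqInt (fun n => (continuous_gradient (hφ n)).aestronglyMeasurable)
      ((Lp.aestronglyMeasurable g).mono_measure hle) h2
  refine le_of_tendsto_of_tendsto' hlim1 hlim2 fun n => ?_
  refine HeatHeat.sqInt_sub_average_le _ (hφm n) ?_
  refine (lintegral_lintegral_sub_le (hφ n) hc hQ hD).trans (le_of_eq ?_)
  rw [Measure.restrict_apply_univ]
  ring

end

/-! ### Friedrichs, trace and Poincaré inequalities on a convex domain, uniformly up to the edge of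
`Γ` -/

section

/-! ### Convex domains with a flat part `Γ` of the boundary -/

/-- Take the least parameter at which the ray is outside the open set `Ω`; it exists by compactness
and is positive. All earlier points are in `Ω`, so this one is in the closure. -/
theorem exists_mem_frontier_of_exit {Ω : Set (E d)} (ho : IsOpen Ω) {y e : E d} {L : ℝ}
    (hL : 0 ≤ L) (hy : y ∈ Ω) (hyL : y + L • e ∉ Ω) :
    ∃ s, 0 < s ∧ s ≤ L ∧ y + s • e ∈ frontier Ω := by
  have hcont : Continuous fun s : ℝ => y + s • e := by fun_prop
  have hcl : IsClosed {s : ℝ | y + s • e ∉ Ω} := (ho.preimage hcont).isClosed_compl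
  obtain ⟨s, ⟨⟨hs0, hsL⟩, hsΩ⟩, hmin⟩ := (isCompact_Icc.inter_right hcl).exists_isLeast
    (⟨L, ⟨hL, le_rfl⟩, hyL⟩ : (Icc 0 L ∩ {s : ℝ | y + s • e ∉ Ω}).Nonempty)
  have hspos : 0 < s := by
    rcases hs0.eq_or_lt with h | h
    · exact absurd (by simpa [← h] using hy) hsΩ
    · exact h
  refine ⟨s, hspos, hsL, ?_⟩
  rw [ho.frontier_eq]
  refine ⟨?_, hsΩ⟩
  have h1 : s ∈ closure (Ico 0 s) := by
    rw [closure_Ico hspos.ne]; exact ⟨hspos.le, le_rfl⟩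
  refine hcont.closure_preimage_subset Ω (closure_mono (fun r hr => ?_) h1)
  by_contra hcon
  exact absurd (hmin ⟨⟨hr.1, hr.2.le.trans hsL⟩, hcon⟩) (not_le.2 hr.2)

/-- `Γ` is a closed convex part of the boundary of the bounded convex domain `Ω`, contained in the
supporting hyperplane `⟪a, x⟫ = b`. -/
structure IsFlatPart (Ω Γ : Set (E d)) (a : E d) (b : ℝ) : Prop where
  convex : Convex ℝ Ω
  isOpen : IsOpen Ω
  isBounded : Bornology.IsBounded Ω
  nonempty : Ω.Nonempty
  convex_flat : Convex ℝ Γ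
  isClosed_flat : IsClosed Γ
  subset : Γ ⊆ frontier Ω
  norm_eq : ‖a‖ = 1
  inner_lt : ∀ x ∈ Ω, inner ℝ a x < b
  inner_eq : ∀ x ∈ Γ, inner ℝ a x = b

/-- The triple `(v, g, w)` is a Sobolev function with its gradient and trace, the trace being zero
off `Γ`. -/
def VanishesOff (Ω Γ : Set (E d)) (v : L2 Ω) (g : L2Vec Ω) (w : L2Bdry Ω) : Prop :=
  IsTrace Ω v g w ∧ ∀ᵐ x ∂((surf d).restrict (frontier Ω)), x ∉ Γ → w x = 0

variable {Ω Γ : Set (E d)} {a : E d} {b : ℝ}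

theorem IsFlatPart.inner_le (h : IsFlatPart Ω Γ a b) {x : E d} (hx : x ∈ closure Ω) :
    inner ℝ a x ≤ b := by
  have : closure Ω ⊆ {x | inner ℝ a x ≤ b} :=
    closure_minimal (fun x hx => (h.inner_lt x hx).le)
      (isClosed_le (by fun_prop) continuous_const)
  exact this hx

theorem IsFlatPart.measurableSet_diff (h : IsFlatPart Ω Γ a b) :
    MeasurableSet (frontier Ω \ Γ) :=
  isClosed_frontier.measurableSet.diff h.isClosed_flat.measurableSet

theorem norm_sub_le_diam {Ω : Set (E d)} (hb : Bornology.IsBounded Ω) {x y : E d}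
    (hx : x ∈ closure Ω) (hy : y ∈ closure Ω) : ‖x - y‖ ≤ Metric.diam Ω := by
  rw [← dist_eq_norm, ← Metric.diam_closure]
  exact Metric.dist_le_diam_of_mem hb.closure hx hy

/-- Friedrichs' inequality. -/
theorem IsFlatPart.sqInt_le (h : IsFlatPart Ω Γ a b) {v : L2 Ω} {g : L2Vec Ω} {w : L2Bdry Ω}
    (hv : VanishesOff Ω Γ v g w) :
    sqInt (volume.restrict Ω) v ≤
      ENNReal.ofReal (2 * (Metric.diam Ω + 1) ^ 2) * sqInt (volume.restrict Ω) g := by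
  have hd : 0 ≤ Metric.diam Ω := Metric.diam_nonneg
  -- Along `-a` the value `⟪a, ·⟫` falls further below `b`, so the ray cannot leave through `Γ`. The
  -- extra `1` places its end at a distance larger than the diameter, hence outside `Ω`.
  have h1 := hv.1.sqInt_le_of_exit (G := frontier Ω \ Γ) (Q := Ω) (V := univ) h.convex h.isOpen
    h.measurableSet_diff sdiff_subset (hv.2.mono fun x hx hx' => hx hx'.2) h.isOpen.measurableSet
    Subset.rfl MeasurableSet.univ (e := -a) (by rw [norm_neg, h.norm_eq])
    (L := Metric.diam Ω + 1) (fun y hy => by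
      obtain ⟨s, hs, hsL, hsf⟩ := exists_mem_frontier_of_exit h.isOpen (e := -a)
        (L := Metric.diam Ω + 1) (by positivity) hy (fun hcon => by
          have := norm_sub_le_diam h.isBounded (subset_closure hcon) (subset_closure hy)
          rw [add_sub_cancel_left, norm_smul, norm_neg, h.norm_eq, mul_one, Real.norm_eq_abs] at this
          linarith [le_abs_self (Metric.diam Ω + 1)])
      refine ⟨s, hs, hsL, ⟨hsf, fun hΓ => ?_⟩, fun _ _ => mem_univ _⟩
      have h2 := h.inner_eq _ hΓ
      rw [inner_add_right, inner_smul_right, inner_neg_right, real_inner_self_eq_norm_sq,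
        h.norm_eq] at h2
      linarith [h.inner_lt y hy])
  rw [inter_univ] at h1
  refine h1.trans (le_of_eq ?_)
  rw [ENNReal.ofReal_mul (by norm_num), ENNReal.ofReal_pow (by positivity)]
  norm_num
  ring

/-- Let `e` point from an interior point `o` to `z₀`. From a point of `Γ` near `z₀`, the ray along
`-e` runs inside `Ω` and leaves it strictly below the hyperplane of `Γ`, that is, at a boundary
point where the trace vanishes. Since `Ω` is open, one direction serves a whole neighbourhood of
`z₀`; compactness of `Γ` then gives the global inequality. -/
theorem exists_trace_le_of_mem (h : IsFlatPart Ω Γ a b) {z₀ : E d} (hz₀ : z₀ ∈ Γ) :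
    ∃ r > 0, ∃ C : ℝ≥0∞, C ≠ ⊤ ∧ ∀ (v : L2 Ω) (g : L2Vec Ω) (w : L2Bdry Ω),
      VanishesOff Ω Γ v g w → sqInt ((surf d).restrict (Γ ∩ Metric.closedBall z₀ r)) w ≤
        C * sqInt (volume.restrict Ω) g := by
  obtain ⟨o, hoΩ⟩ := h.nonempty
  have hΓc : ∀ z ∈ Γ, z ∈ closure Ω := fun z hz => frontier_subset_closure (h.subset hz)
  have hao : inner ℝ a o < b := h.inner_lt o hoΩ
  have haz : inner ℝ a z₀ = b := h.inner_eq z₀ hz₀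
  have hne : z₀ - o ≠ 0 := fun h0 => by
    rw [sub_eq_zero] at h0
    rw [h0] at haz
    linarith
  have hnp : 0 < ‖z₀ - o‖ := norm_pos_iff.2 hne
  set e : E d := ‖z₀ - o‖⁻¹ • (z₀ - o) with he
  have hen : ‖e‖ = 1 := norm_smul_inv_norm hne
  have hae : 0 < (inner ℝ a e : ℝ) := by
    rw [he, inner_smul_right, inner_sub_right]
    have : 0 < inner ℝ a z₀ - inner ℝ a o := by linarith
    positivity
  have hopen : IsOpen {z : E d | z - ‖z₀ - o‖ • e ∈ Ω} := h.isOpen.preimage (by fun_prop)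
  have hz₀mem : z₀ ∈ {z : E d | z - ‖z₀ - o‖ • e ∈ Ω} := by
    simp only [mem_ofPred_eq, he, smul_smul, mul_inv_cancel₀ hnp.ne', one_smul, sub_sub_cancel]
    exact hoΩ
  obtain ⟨r, hr, hball⟩ := Metric.nhds_basis_closedBall.mem_iff.1 (hopen.mem_nhds hz₀mem)
  set A := Γ ∩ Metric.closedBall z₀ r with hA
  have hAc : IsCompact A := (isCompact_closedBall z₀ r).inter_left h.isClosed_flat
  have hAf : A ⊆ frontier Ω := fun z hz => h.subset hz.1
  obtain ⟨C, hC, hCle⟩ := exists_sqInt_trace_le h.convex h.isOpen h.measurableSet_diff sdiff_subset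
    (a := a) (b := b) hen hae.ne' hAc (fun z hz => h.inner_eq z hz.1) (L := Metric.diam Ω) (by
      intro z hz
      set s₁ := ‖z₀ - o‖ with hs₁
      have hzΩ : z - s₁ • e ∈ Ω := hball hz.2
      obtain ⟨s₂, hs₂, -, hs₂f⟩ := exists_mem_frontier_of_exit h.isOpen (e := -e)
        (L := Metric.diam Ω + 1) (by positivity) hzΩ (fun hcon => by
          have := norm_sub_le_diam h.isBounded (subset_closure hcon) (subset_closure hzΩ)
          rw [add_sub_cancel_left, norm_smul, norm_neg, hen, mul_one, Real.norm_eq_abs] at this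
          linarith [le_abs_self (Metric.diam Ω + 1)])
      have heq : z - s₁ • e + s₂ • (-e) = z - (s₁ + s₂) • e := by module
      rw [heq] at hs₂f
      refine ⟨s₁ + s₂, by positivity, ?_, ⟨hs₂f, fun hcon => ?_⟩, fun τ hτ => ?_⟩
      · have := norm_sub_le_diam h.isBounded (hΓc z hz.1) (frontier_subset_closure hs₂f)
        rw [sub_sub_cancel, norm_smul, hen, mul_one, Real.norm_eq_abs] at this
        exact (le_abs_self _).trans this
      · have h2 := h.inner_eq _ hcon
        rw [inner_sub_right, inner_smul_right, h.inner_eq z hz.1] at h2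
        have : 0 < (s₁ + s₂) * inner ℝ a e := by positivity
        linarith
      -- The point `z - s₁ • e` of `Ω` splits the chord into two segments, each joining a boundary
      -- point to an interior point.
      · rcases le_total τ s₁ with hle | hle
        · have := add_smul_mem_of_convex h.convex h.isOpen (hΓc z hz.1) (v := -e) (s := s₁)
            (by convert hzΩ using 1; module) hτ.1 hle
          convert this using 1
          module
        · have := add_smul_mem_of_convex h.convex h.isOpen (frontier_subset_closure hs₂f) (v := e)
            (s := s₂) (r := s₁ + s₂ - τ) (by convert hzΩ using 1; module) (by linarith [hτ.2])
            (by linarith)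
          convert this using 1
          module)
  refine ⟨r, hr, C * (2 * ENNReal.ofReal (Metric.diam Ω)), by finiteness, fun v g w hv => ?_⟩
  obtain ⟨φ, hφ, -, h2, h3⟩ := hv.1.exists_seq
  have hw := sqInt_zero_of_ae_restrict h.measurableSet_diff sdiff_subset
    (hv.2.mono fun x hx hx' => hx hx'.2)
  have hlim := ENNReal.Tendsto.const_mul (a := C) ((ENNReal.Tendsto.const_mul (a := 2)
    (h3 (frontier Ω \ Γ) sdiff_subset) (Or.inr (by simp))).add (ENNReal.Tendsto.const_mul (a := 2)
    (ENNReal.Tendsto.const_mul (a := ENNReal.ofReal (Metric.diam Ω)) (h2 Ω Subset.rfl)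
      (Or.inr (by simp))) (Or.inr (by simp)))) (Or.inr hC)
  rw [hw, mul_zero, zero_add] at hlim
  refine (le_of_tendsto_of_tendsto' (h3 A hAf) hlim fun n => hCle _ (hφ n)).trans (le_of_eq ?_)
  ring

/-- The trace inequality on `Γ`. -/
theorem IsFlatPart.exists_trace_le (h : IsFlatPart Ω Γ a b) :
    ∃ C : ℝ≥0∞, C ≠ ⊤ ∧ ∀ (v : L2 Ω) (g : L2Vec Ω) (w : L2Bdry Ω),
      VanishesOff Ω Γ v g w → sqInt ((surf d).restrict Γ) w ≤ C * sqInt (volume.restrict Ω) g := by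
  have hcomp : IsCompact Γ := (h.isBounded.closure.isCompact_closure).of_isClosed_subset
    h.isClosed_flat (fun z hz => subset_closure (frontier_subset_closure (h.subset hz)))
  refine hcomp.induction_on (p := fun S => ∃ C : ℝ≥0∞, C ≠ ⊤ ∧
    ∀ (v : L2 Ω) (g : L2Vec Ω) (w : L2Bdry Ω), VanishesOff Ω Γ v g w →
      sqInt ((surf d).restrict S) w ≤ C * sqInt (volume.restrict Ω) g) ?_ ?_ ?_ ?_
  · exact ⟨0, by simp, fun v g w _ => by simp [sqInt]⟩
  · rintro s t hst ⟨C, hC, h1⟩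
    exact ⟨C, hC, fun v g w hv => (sqInt_mono_set hst _).trans (h1 v g w hv)⟩
  · rintro s t ⟨C, hC, h1⟩ ⟨C', hC', h1'⟩
    refine ⟨C + C', by finiteness, fun v g w hv => ?_⟩
    refine (lintegral_union_le _ s t).trans ?_
    rw [add_mul]
    exact add_le_add (h1 v g w hv) (h1' v g w hv)
  · intro z hz
    obtain ⟨r, hr, C, hC, h1⟩ := exists_trace_le_of_mem h hz
    exact ⟨Γ ∩ Metric.closedBall z r, inter_mem self_mem_nhdsWithin
      (mem_nhdsWithin_of_mem_nhds (Metric.closedBall_mem_nhds z hr)), C, hC, h1⟩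

/-- Either `Γ` is a null set, or it has an interior point relative to its hyperplane. -/
theorem IsFlatPart.null_or_ball (h : IsFlatPart Ω Γ a b) : surf d Γ = 0 ∨
    ∃ γ ∈ Γ, ∃ ρ > 0, ∀ z, ‖z - γ‖ < ρ → inner ℝ a z = b → z ∈ Γ := by
  have ha0 : a ≠ 0 := fun h0 => by simpa [h0] using h.norm_eq
  set ι : (ℝ ∙ a)ᗮ → E d := fun p => (p : E d) + b • a with hι
  have hiso : Isometry ι := Isometry.of_dist_eq fun x y => by rw [hι, dist_add_right]; rfl
  have hinner : ∀ p : (ℝ ∙ a)ᗮ, inner ℝ a (p : E d) = 0 := fun p =>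
    Submodule.mem_orthogonal_singleton_iff_inner_right.1 p.2
  have hsec : ∀ z, inner ℝ a z = b → ι (projOrth a z) = z := by
    intro z hz
    obtain ⟨s, hs⟩ := exists_eq_projOrth_add_smul a z
    have : s = b := by
      rw [← hz]
      conv_rhs => rw [hs]
      rw [inner_add_right, hinner, inner_smul_right, real_inner_self_eq_norm_sq, h.norm_eq]
      ring
    rw [this] at hs
    exact hs.symm
  set ΓW : Set (ℝ ∙ a)ᗮ := ι ⁻¹' Γ with hΓW
  have hconv : Convex ℝ ΓW := by
    intro p hp q hq s t hs ht hst
    have := h.convex_flat hp hq hs ht hst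
    simp only [hΓW, hι, mem_preimage] at this ⊢
    convert this using 1
    push_cast
    have : b • a = s • b • a + t • b • a := by rw [← add_smul, hst, one_smul]
    conv_lhs => rw [this]
    module
  have himg : ι '' ΓW = Γ := by
    refine Subset.antisymm (image_preimage_subset _ _) fun z hz => ?_
    exact ⟨projOrth a z, by rw [hΓW, mem_preimage, hsec z (h.inner_eq z hz)]; exact hz,
      hsec z (h.inner_eq z hz)⟩
  rcases (interior ΓW).eq_empty_or_nonempty with he | ⟨p, hp⟩
  · left
    -- A convex set with empty interior is contained in its frontier, which is a null set.
    have h1 : volume ΓW = 0 := by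
      refine measure_mono_null (fun p hp => ?_) (hconv.addHaar_frontier volume)
      rw [frontier, he, sdiff_empty]
      exact subset_closure hp
    rw [← himg, surf, hiso.euclideanHausdorffMeasure_image, ← finrank_orthogonal_span ha0,
      InnerProductSpace.euclideanHausdorffMeasure_eq_volume, h1]
  · right
    obtain ⟨ρ, hρ, hball⟩ := Metric.mem_nhds_iff.1 (mem_interior_iff_mem_nhds.1 hp)
    refine ⟨ι p, hball (Metric.mem_ball_self hρ), ρ, hρ, fun z hz hzb => ?_⟩
    have h1 : projOrth a z ∈ Metric.ball p ρ := by
      rw [Metric.mem_ball, ← hiso.dist_eq, hsec z hzb, dist_eq_norm]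
      exact hz
    have h2 := hball h1
    rwa [hΓW, mem_preimage, hsec z hzb] at h2

end

section

/-! ### Local Friedrichs inequality near boundary points off `Γ` -/

variable {Ω Γ : Set (E d)} {a : E d} {b : ℝ}

/-- `x` is a proper convex combination of `x - t • (o - x)` and the interior point `o`; if the
former were in the closure, `x` would be interior. -/
theorem reflect_notMem_closure (hc : Convex ℝ Ω) (ho : IsOpen Ω) {x o : E d} (hx : x ∉ Ω)
    (hoΩ : o ∈ Ω) {t : ℝ} (ht : 0 < t) : x - t • (o - x) ∉ closure Ω := by
  intro hcon
  have h := hc.combo_closure_interior_mem_interior hcon (by rwa [ho.interior_eq])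
    (a := 1 / (1 + t)) (b := t / (1 + t)) (by positivity) (by positivity) (by field_simp)
  rw [ho.interior_eq] at h
  refine hx ?_
  convert h using 1
  have h1 : x = (1 / (1 + t)) • ((1 + t) • x) := by
    rw [smul_smul, one_div, inv_mul_cancel₀ (by positivity), one_smul]
  conv_lhs => rw [h1]
  have h2 : (t / (1 + t)) • o = (1 / (1 + t)) • t • o := by rw [smul_smul]; congr 1; ring
  rw [h2, ← smul_add]
  congr 1
  module

theorem dilate_mem (hc : Convex ℝ Ω) (ho : IsOpen Ω) {x o : E d} (hx : x ∈ closure Ω)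
    (hoΩ : o ∈ Ω) {t : ℝ} (ht : 0 < t) (ht1 : t ≤ 1) : x + t • (o - x) ∈ Ω :=
  add_smul_mem_of_convex hc ho hx (s := 1) (by rw [one_smul, add_sub_cancel]; exact hoΩ) ht ht1

theorem IsFlatPart.nontrivial (h : IsFlatPart Ω Γ a b) : Nontrivial (E d) :=
  ⟨a, 0, fun h0 => by simpa [h0] using h.norm_eq⟩

theorem volume_ball_eq [Nontrivial (E d)] (x : E d) {r : ℝ} (hr : 0 ≤ r) :
    volume (Metric.ball x r) = ENNReal.ofReal (r ^ d) * volume (Metric.ball (0 : E d) 1) := by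
  rw [Measure.addHaar_ball _ _ hr, finrank_euclideanSpace, Fintype.card_fin]

/-- Project `z` from an interior point `o` onto the hyperplane. The image `z + s • (z - o)` is close
to `γ`, hence in `Γ`, and `z` lies strictly between it and `o`. -/
theorem IsFlatPart.exists_half_ball (h : IsFlatPart Ω Γ a b) {γ : E d} {ρ : ℝ} (hγ : γ ∈ Γ)
    (hρ : 0 < ρ) (hball : ∀ z, ‖z - γ‖ < ρ → inner ℝ a z = b → z ∈ Γ) :
    ∃ ρ' > 0, ρ' ≤ ρ ∧ ∀ z, ‖z - γ‖ < ρ' → inner ℝ a z < b → z ∈ Ω := by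
  obtain ⟨o, ho⟩ := h.nonempty
  set η := b - inner ℝ a o with hη
  have hη0 : 0 < η := by have := h.inner_lt o ho; linarith
  set K := 2 / η * (η / 2 + ‖γ - o‖) with hK
  have hK0 : 0 ≤ K := by positivity
  -- The bound `η / 2` keeps `z` at height at least `η / 2` above `o`, which controls `s`. The image
  -- is then within `(1 + K) ‖z - γ‖` of `γ`, and the second bound makes this less than `ρ`.
  refine ⟨min (η / 2) (ρ / (2 * (1 + K))), by positivity, ?_, fun z hz hzb => ?_⟩
  · refine (min_le_right _ _).trans (div_le_self hρ.le (by linarith))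
  have hz1 : ‖z - γ‖ < η / 2 := hz.trans_le (min_le_left _ _)
  have hz2 : ‖z - γ‖ * (1 + K) < ρ := by
    have := hz.trans_le (min_le_right _ _)
    rw [lt_div_iff₀ (by positivity)] at this
    nlinarith [norm_nonneg (z - γ)]
  have hzγ : b - inner ℝ a z ≤ ‖z - γ‖ := by
    have h1 := real_inner_le_norm a (γ - z)
    rw [inner_sub_right, h.inner_eq γ hγ, h.norm_eq, one_mul, norm_sub_rev] at h1
    exact h1
  set m := inner ℝ a z - inner ℝ a o with hm
  have hm0 : η / 2 < m := by rw [hm]; linarith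
  have hmp : 0 < m := by linarith
  set s := (b - inner ℝ a z) / m with hs
  have hs0 : 0 < s := div_pos (by linarith) hmp
  have hsle : s ≤ 2 / η * ‖z - γ‖ := by
    rw [hs, div_le_iff₀ hmp]
    calc b - inner ℝ a z ≤ ‖z - γ‖ := hzγ
      _ = 2 / η * ‖z - γ‖ * (η / 2) := by field_simp
      _ ≤ 2 / η * ‖z - γ‖ * m := by gcongr
  have hq : z + s • (z - o) ∈ Γ := by
    refine hball _ ?_ ?_
    · have h1 : z + s • (z - o) - γ = (z - γ) + s • ((z - γ) + (γ - o)) := by module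
      rw [h1]
      calc ‖(z - γ) + s • ((z - γ) + (γ - o))‖
          ≤ ‖z - γ‖ + s * (‖z - γ‖ + ‖γ - o‖) := by
            refine (norm_add_le _ _).trans ?_
            rw [norm_smul, Real.norm_of_nonneg hs0.le]
            gcongr
            exact norm_add_le _ _
        _ ≤ ‖z - γ‖ + 2 / η * ‖z - γ‖ * (η / 2 + ‖γ - o‖) := by gcongr
        _ = ‖z - γ‖ * (1 + K) := by rw [hK]; ring
        _ < ρ := hz2
    · rw [inner_add_right, inner_smul_right, inner_sub_right, ← hm, hs]
      field_simp
      ring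
  have h1 := dilate_mem h.convex h.isOpen (frontier_subset_closure (h.subset hq)) ho
    (t := s / (1 + s)) (by positivity) ((div_le_one (by positivity)).2 (by linarith))
  convert h1 using 1
  have h2 : o - (z + s • (z - o)) = (1 + s) • (o - z) := by module
  rw [h2, smul_smul, div_mul_cancel₀ _ (by positivity)]
  module

/-- Near every boundary point off `Γ` there is, at every scale, a substantial set of points which
leave `Ω` off `Γ` after a translation of the order of the scale. -/
theorem IsFlatPart.exists_escape_of_ball (h : IsFlatPart Ω Γ a b) {γ : E d} {ρ : ℝ} (hγ : γ ∈ Γ)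
    (hρ : 0 < ρ) (hball : ∀ z, ‖z - γ‖ < ρ → inner ℝ a z = b → z ∈ Γ)
    (hhalf : ∀ z, ‖z - γ‖ < ρ → inner ℝ a z < b → z ∈ Ω) :
    ∃ R c : ℝ, 0 < R ∧ 0 < c ∧ ∀ x ∈ frontier Ω, x ∉ Γ → ∀ t ∈ Ioc (0 : ℝ) 1,
      ∃ (Q : Set (E d)) (ζ : E d), MeasurableSet Q ∧ Q ⊆ Ω ∩ Metric.closedBall x (R * t) ∧
        ‖ζ‖ ≤ R * t ∧ ENNReal.ofReal (c * t ^ d) * volume (Metric.ball (0 : E d) 1) ≤ volume Q ∧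
        ∀ y ∈ Q, y + ζ ∉ Ω ∧ ∀ r ∈ Icc (0 : ℝ) 1, y + r • ζ ∉ Γ := by
  obtain ⟨M, hM⟩ := h.isBounded.closure.exists_norm_le
  -- `o₁` lies in `Ω` just below the interior point `γ` of `Γ`, and `o₂` is its mirror image beyond
  -- the hyperplane. Balls of radius `δ = ρ / 4` about either point stay on their side of the
  -- hyperplane.
  set o₁ : E d := γ - (ρ / 2) • a with ho₁
  set o₂ : E d := γ + (ρ / 2) • a with ho₂
  set δ : ℝ := ρ / 4 with hδ
  have hδ0 : 0 < δ := by positivity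
  have hM0 : 0 ≤ M := by
    obtain ⟨o, ho⟩ := h.nonempty
    exact (norm_nonneg _).trans (hM o (subset_closure ho))
  refine ⟨2 * (M + ‖γ‖ + 2 * ρ), δ ^ d / 2, by positivity, by positivity, ?_⟩
  rintro x hxf hxΓ t ⟨ht, ht1⟩
  have hxc : x ∈ closure Ω := frontier_subset_closure hxf
  have hxΩ : x ∉ Ω := by rw [h.isOpen.frontier_eq] at hxf; exact hxf.2
  have hxb := h.inner_le hxc
  have hxM : ‖x‖ ≤ M := hM x hxc
  have haa : inner ℝ a a = (1 : ℝ) := by rw [real_inner_self_eq_norm_sq, h.norm_eq]; norm_num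
  have haγ : inner ℝ a γ = b := h.inner_eq γ hγ
  have hin : ∀ u : E d, |inner ℝ a u| ≤ ‖u‖ := fun u => by
    have := abs_real_inner_le_norm a u
    rwa [h.norm_eq, one_mul] at this
  have hρa : ∀ s : ℝ, ‖s • a‖ = |s| := fun s => by
    rw [norm_smul, h.norm_eq, mul_one, Real.norm_eq_abs]
  have hmid : ∀ o : E d, ∀ s : ℝ, |s| ≤ ρ / 2 → ‖o - (γ + s • a)‖ < δ → ‖o - γ‖ < ρ := by
    intro o s hs ho
    have h1 : o - γ = (o - (γ + s • a)) + s • a := by module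
    rw [h1]
    refine (norm_add_le _ _).trans_lt ?_
    rw [hρa]
    linarith
  have hval : ∀ o : E d, ∀ s : ℝ, inner ℝ a o = b + s + inner ℝ a (o - (γ + s • a)) := by
    intro o s
    rw [inner_sub_right, inner_add_right, inner_smul_right, haa, haγ]
    ring
  have hnear₁ : ∀ o, ‖o - o₁‖ < δ → o ∈ Ω := by
    intro o ho
    have h1 : o₁ = γ + (-(ρ / 2)) • a := by rw [ho₁]; module
    rw [h1] at ho
    refine hhalf o (hmid o _ (by rw [abs_neg, abs_of_pos (by positivity)]) ho) ?_
    rw [hval o (-(ρ / 2))]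
    linarith [(abs_le.1 (hin (o - (γ + (-(ρ / 2)) • a)))).2]
  have hnear₂ : ∀ o, ‖o - o₂‖ < δ → b < inner ℝ a o := by
    intro o ho
    rw [hval o (ρ / 2)]
    linarith [(abs_le.1 (hin (o - (γ + (ρ / 2) • a)))).1]
  -- Suppose the reflection through `x` of a point `o` near `γ` were in `Γ`. Then `o` is not above
  -- the hyperplane, since `x` is not. If `o` is on it, then `o ∈ Γ` and convexity of `Γ` forces `x
  -- ∈ Γ`; if it is below, then `o ∈ Ω` and the reflection is outside the closure of `Ω`.
  have hoff : ∀ o, ‖o - γ‖ < ρ → x - t • (o - x) ∉ Γ := by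
    intro o ho hcon
    have h1 := h.inner_eq _ hcon
    rw [inner_sub_right, inner_smul_right, inner_sub_right] at h1
    have h2 : inner ℝ a o ≤ b := by
      by_contra hlt
      push Not at hlt
      nlinarith
    rcases h2.eq_or_lt with h3 | h3
    · have hoΓ := hball o ho h3
      refine hxΓ ?_
      have := h.convex_flat hcon hoΓ (show (0 : ℝ) ≤ 1 / (1 + t) by positivity)
        (show (0 : ℝ) ≤ t / (1 + t) by positivity) (by field_simp)
      convert this using 1
      have h4 : (t / (1 + t)) • o = (1 / (1 + t)) • t • o := by rw [smul_smul]; congr 1; ring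
      have h5 : x = (1 / (1 + t)) • ((1 + t) • x) := by
        rw [smul_smul, one_div, inv_mul_cancel₀ (by positivity), one_smul]
      rw [h4, ← smul_add]
      conv_lhs => rw [h5]
      congr 1
      module
    · exact reflect_notMem_closure h.convex h.isOpen hxΩ (hhalf o ho h3) ht
        (frontier_subset_closure (h.subset hcon))
  have := h.nontrivial
  -- `c₁` is the image of `o₁` under the contraction towards `x`, so a ball around it lies in `Ω`.
  -- `c₂` is the scaled reflection of `o₂` through `x`: it lies below the hyperplane, but possibly
  -- outside `Ω`.
  set c₁ := x + t • (o₁ - x) with hc₁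
  set c₂ := x - t • (o₂ - x) with hc₂
  have hB₁ : ∀ y, ‖y - c₁‖ < t * δ → ∃ o, ‖o - o₁‖ < δ ∧ y = x + t • (o - x) := by
    intro y hy
    refine ⟨o₁ + t⁻¹ • (y - c₁), ?_, ?_⟩
    · rw [add_sub_cancel_left, norm_smul, norm_inv, Real.norm_of_nonneg ht.le,
        inv_mul_lt_iff₀ ht]
      exact hy
    · have h1 : t • (o₁ + t⁻¹ • (y - c₁) - x) = t • (o₁ - x) + (t * t⁻¹) • (y - c₁) := by module
      rw [h1, mul_inv_cancel₀ ht.ne', one_smul, hc₁]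
      module
  have hB₂ : ∀ y, ‖y - c₂‖ < t * δ → ∃ o, ‖o - o₂‖ < δ ∧ y = x - t • (o - x) := by
    intro y hy
    refine ⟨o₂ - t⁻¹ • (y - c₂), ?_, ?_⟩
    · rw [sub_sub_cancel_left, norm_neg, norm_smul, norm_inv, Real.norm_of_nonneg ht.le,
        inv_mul_lt_iff₀ ht]
      exact hy
    · have h1 : t • (o₂ - t⁻¹ • (y - c₂) - x) = t • (o₂ - x) - (t * t⁻¹) • (y - c₂) := by module
      rw [h1, mul_inv_cancel₀ ht.ne', one_smul, hc₂]
      module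
  have hdist : ∀ o : E d, ‖o - γ‖ < ρ → t * ‖o - x‖ ≤ 2 * (M + ‖γ‖ + 2 * ρ) * t := by
    intro o ho
    have h1 : o - x = (o - γ) + (γ - x) := by module
    have h2 : ‖o - x‖ ≤ ρ + (‖γ‖ + M) := by
      rw [h1]
      exact (norm_add_le _ _).trans (add_le_add ho.le ((norm_sub_le _ _).trans (by linarith)))
    have h3 : ‖o - x‖ ≤ 2 * (M + ‖γ‖ + 2 * ρ) := by linarith [norm_nonneg γ]
    rw [mul_comm]
    gcongr
  set B := Metric.ball c₂ (t * δ) with hB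
  have hΩm := h.isOpen.measurableSet
  have hvolB : ENNReal.ofReal (δ ^ d / 2 * t ^ d) * volume (Metric.ball (0 : E d) 1) =
      volume B / 2 := by
    rw [hB, volume_ball_eq c₂ (by positivity), mul_pow, ENNReal.div_eq_inv_mul,
      ← mul_assoc]
    congr 1
    have : δ ^ d / 2 * t ^ d = 2⁻¹ * (t ^ d * δ ^ d) := by ring
    rw [this, ENNReal.ofReal_mul (by norm_num), ENNReal.ofReal_inv_of_pos (by norm_num)]
    norm_num
  have hsplit : volume (B ∩ Ω) + volume (B \ Ω) = volume B := measure_inter_add_sdiff B hΩm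
  rw [hvolB]
  -- If half of the ball `B` about `c₂` is outside `Ω`, points near `c₁` are moved into that half by
  -- `c₂ - c₁`; both ends are strictly below the hyperplane, so the path avoids `Γ`. Otherwise the
  -- half of `B` inside `Ω` is itself moved upwards by `t ρ a`, to scaled reflections of points near
  -- `o₁`, which are outside `Ω`; the path consists of scaled reflections of points near `γ` and
  -- avoids `Γ` by `hoff`.
  by_cases hbig : volume B / 2 ≤ volume (B \ Ω)
  · set ζ := c₂ - c₁ with hζ
    have hQB₁ : ∀ y, y + ζ ∈ B \ Ω → ‖y - c₁‖ < t * δ := by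
      intro y hy
      have h1 := hy.1
      rw [hB, Metric.mem_ball, dist_eq_norm] at h1
      have h2 : y + ζ - c₂ = y - c₁ := by rw [hζ]; module
      rwa [h2] at h1
    refine ⟨(fun y => y + ζ) ⁻¹' (B \ Ω), ζ,
      (Metric.isOpen_ball.measurableSet.diff hΩm).preimage (by fun_prop), fun y hy => ?_, ?_, ?_,
      fun y hy => ⟨hy.2, fun r hr => ?_⟩⟩
    · obtain ⟨o, ho, rfl⟩ := hB₁ y (hQB₁ y hy)
      refine ⟨dilate_mem h.convex h.isOpen hxc (hnear₁ o ho) ht ht1, ?_⟩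
      rw [mem_closedBall_iff_norm, add_sub_cancel_left, norm_smul, Real.norm_of_nonneg ht.le]
      refine hdist o (hmid o (-(ρ / 2)) (by rw [abs_neg, abs_of_pos (by positivity)]) ?_)
      rw [neg_smul, ← sub_eq_add_neg]
      exact ho
    · have h1 : ζ = -((2 * t) • (γ - x)) := by rw [hζ, hc₁, hc₂, ho₁, ho₂]; module
      rw [h1, norm_neg, norm_smul, Real.norm_of_nonneg (by positivity)]
      have h2 : ‖γ - x‖ ≤ M + ‖γ‖ + 2 * ρ := (norm_sub_le _ _).trans (by linarith)
      nlinarith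
    · rw [measure_preimage_add_right]
      exact hbig
    · intro hcon
      have h1 := h.inner_eq _ hcon
      obtain ⟨o, ho, hyo⟩ := hB₁ y (hQB₁ y hy)
      have hyΩ : inner ℝ a y < b := by
        rw [hyo]
        exact h.inner_lt _ (dilate_mem h.convex h.isOpen hxc (hnear₁ o ho) ht ht1)
      obtain ⟨o', ho', hyo'⟩ := hB₂ (y + ζ) (by
        have := hy.1
        rwa [hB, Metric.mem_ball, dist_eq_norm] at this)
      have hyζ : inner ℝ a (y + ζ) < b := by
        rw [hyo', inner_sub_right, inner_smul_right, inner_sub_right]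
        have := hnear₂ o' ho'
        nlinarith
      rw [inner_add_right, inner_smul_right] at h1
      rw [inner_add_right] at hyζ
      rcases hr.1.eq_or_lt with h0 | h0
      · rw [← h0] at h1
        linarith
      · have h2 := mul_pos h0 (sub_pos.2 hyζ)
        have h3 := mul_nonneg (sub_nonneg.2 hr.2) (sub_pos.2 hyΩ).le
        nlinarith
  · have hbig' : volume B / 2 ≤ volume (B ∩ Ω) := by
      by_contra hcon
      push Not at hcon hbig
      have := ENNReal.add_lt_add hcon hbig
      rw [ENNReal.add_halves, hsplit] at this
      exact lt_irrefl _ this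
    have hmem : ∀ y ∈ B ∩ Ω, ∃ o, ‖o - o₂‖ < δ ∧ y = x - t • (o - x) := fun y hy =>
      hB₂ y (by have := hy.1; rwa [hB, Metric.mem_ball, dist_eq_norm] at this)
    have hshift : ∀ o : E d, ∀ r : ℝ,
        x - t • (o - x) + r • (t * ρ) • a = x - t • ((o - (r * ρ) • a) - x) := by
      intro o r; module
    refine ⟨B ∩ Ω, (t * ρ) • a, Metric.isOpen_ball.measurableSet.inter hΩm, fun y hy => ?_, ?_,
      hbig', fun y hy => ⟨?_, fun r hr => ?_⟩⟩
    · obtain ⟨o, ho, rfl⟩ := hmem y hy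
      refine ⟨hy.2, ?_⟩
      rw [mem_closedBall_iff_norm, sub_sub_cancel_left, norm_neg, norm_smul,
        Real.norm_of_nonneg ht.le]
      exact hdist o (hmid o (ρ / 2) (by rw [abs_of_pos (by positivity)]) ho)
    · rw [hρa, abs_of_pos (by positivity)]
      nlinarith [norm_nonneg γ, mul_pos ht hρ]
    · obtain ⟨o, ho, rfl⟩ := hmem y hy
      have h1 := hshift o 1
      rw [one_smul] at h1
      rw [h1]
      refine fun hcon => reflect_notMem_closure h.convex h.isOpen hxΩ (hnear₁ _ ?_) ht
        (subset_closure hcon)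
      have h2 : o - (1 * ρ) • a - o₁ = o - o₂ := by rw [ho₁, ho₂]; module
      rwa [h2]
    · obtain ⟨o, ho, rfl⟩ := hmem y hy
      rw [hshift]
      refine hoff _ (hmid _ (ρ / 2 - r * ρ) ?_ ?_)
      · rw [abs_le]
        constructor <;> nlinarith [hr.1, hr.2]
      · have h2 : o - (r * ρ) • a - (γ + (ρ / 2 - r * ρ) • a) = o - o₂ := by rw [ho₂]; module
        rwa [h2]

/-- The version of `IsFlatPart.exists_escape_of_ball` for functions vanishing on the whole
boundary. -/
theorem IsFlatPart.exists_escape (h : IsFlatPart Ω Γ a b) :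
    ∃ R c : ℝ, 0 < R ∧ 0 < c ∧ ∀ x ∈ frontier Ω, ∀ t ∈ Ioc (0 : ℝ) 1,
      ∃ (Q : Set (E d)) (ζ : E d), MeasurableSet Q ∧ Q ⊆ Ω ∩ Metric.closedBall x (R * t) ∧
        ‖ζ‖ ≤ R * t ∧ ENNReal.ofReal (c * t ^ d) * volume (Metric.ball (0 : E d) 1) ≤ volume Q ∧
        ∀ y ∈ Q, y + ζ ∉ Ω := by
  obtain ⟨M, hM⟩ := h.isBounded.closure.exists_norm_le
  obtain ⟨o, ho⟩ := h.nonempty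
  obtain ⟨δ, hδ, hball⟩ := Metric.isOpen_iff.1 h.isOpen o ho
  have hoM : ‖o‖ ≤ M := hM o (subset_closure ho)
  have hM0 : 0 ≤ M := (norm_nonneg _).trans hoM
  refine ⟨4 * M + δ, δ ^ d, by positivity, by positivity, ?_⟩
  rintro x hxf t ⟨ht, ht1⟩
  have hxc : x ∈ closure Ω := frontier_subset_closure hxf
  have hxΩ : x ∉ Ω := by rw [h.isOpen.frontier_eq] at hxf; exact hxf.2
  have hxM : ‖x‖ ≤ M := hM x hxc
  have hox : ‖o - x‖ ≤ 2 * M := (norm_sub_le _ _).trans (by linarith)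
  have hrep : ∀ y ∈ Metric.ball (x + t • (o - x)) (t * δ), ∃ u : E d, ‖u‖ < δ ∧
      y = x + t • (o + u - x) := by
    intro y hy
    refine ⟨t⁻¹ • (y - (x + t • (o - x))), ?_, ?_⟩
    · rw [norm_smul, norm_inv, Real.norm_of_nonneg ht.le, inv_mul_lt_iff₀ ht, ← dist_eq_norm]
      exact hy
    · have h1 : t • (o + t⁻¹ • (y - (x + t • (o - x))) - x) =
          t • (o - x) + (t * t⁻¹) • (y - (x + t • (o - x))) := by module
      rw [h1, mul_inv_cancel₀ ht.ne', one_smul]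
      module
  -- The translation sends `x + t (o + u - x)` to `x - t ((o - u) - x)`, the scaled reflection
  -- through `x` of the point `o - u` of `Ω`.
  refine ⟨Metric.ball (x + t • (o - x)) (t * δ), -((2 * t) • (o - x)),
    Metric.isOpen_ball.measurableSet, fun y hy => ?_, ?_, ?_, fun y hy => ?_⟩
  · obtain ⟨u, hu, rfl⟩ := hrep y hy
    refine ⟨dilate_mem h.convex h.isOpen hxc (hball (by simpa using hu)) ht ht1, ?_⟩
    rw [mem_closedBall_iff_norm, add_sub_cancel_left, norm_smul, Real.norm_of_nonneg ht.le]
    have h1 : ‖o + u - x‖ ≤ ‖o - x‖ + ‖u‖ := by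
      rw [add_sub_right_comm]; exact norm_add_le _ _
    nlinarith
  · rw [norm_neg, norm_smul, Real.norm_of_nonneg (by positivity)]
    nlinarith
  · have := h.nontrivial
    rw [volume_ball_eq (x + t • (o - x)) (by positivity), mul_pow, mul_comm (t ^ d)]
  · obtain ⟨u, hu, rfl⟩ := hrep y hy
    have h1 : x + t • (o + u - x) + -((2 * t) • (o - x)) = x - t • ((o - u) - x) := by module
    rw [h1]
    refine fun hcon => reflect_notMem_closure h.convex h.isOpen hxΩ (hball ?_) ht
      (subset_closure hcon)
    simpa using hu

end

section

/-! ### Local Friedrichs and Poincaré inequalities -/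

variable {Ω Γ : Set (E d)} {a : E d} {b : ℝ}

/-- The segment from `y` to `y + ζ` crosses the boundary, necessarily in `G`. A path of length at
most `r` starting within `r` of `x` stays within `2 * r`, so only the gradient in that ball enters.
-/
theorem sqInt_le_of_translate (h : IsFlatPart Ω Γ a b) {v : L2 Ω} {g : L2Vec Ω} {w : L2Bdry Ω}
    (hv : IsTrace Ω v g w) {G : Set (E d)} (hG : MeasurableSet G) (hGΩ : G ⊆ frontier Ω)
    (h0 : ∀ᵐ x ∂((surf d).restrict (frontier Ω)), x ∈ G → w x = 0) {Q : Set (E d)} {ζ x : E d}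
    {r : ℝ} (hQ : MeasurableSet Q) (hQΩ : Q ⊆ Ω ∩ Metric.closedBall x r) (hζ : ‖ζ‖ ≤ r)
    (hout : ∀ y ∈ Q, y + ζ ∉ Ω)
    (hG' : ∀ y ∈ Q, ∀ s ∈ Icc (0 : ℝ) 1, y + s • ζ ∈ frontier Ω → y + s • ζ ∈ G) :
    sqInt (volume.restrict Q) v ≤ ENNReal.ofReal (2 * r ^ 2) *
      sqInt (volume.restrict (Ω ∩ Metric.closedBall x (2 * r))) g := by
  rcases Q.eq_empty_or_nonempty with rfl | ⟨y₀, hy₀⟩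
  · simp [sqInt]
  have hζ0 : ζ ≠ 0 := fun hz => by
    have := hout y₀ hy₀
    rw [hz, add_zero] at this
    exact this (hQΩ hy₀).1
  have hζn : 0 < ‖ζ‖ := norm_pos_iff.2 hζ0
  have h1 := hv.sqInt_le_of_exit h.convex h.isOpen hG hGΩ h0 hQ (fun y hy => (hQΩ hy).1)
    (V := Metric.closedBall x (2 * r)) Metric.isClosed_closedBall.measurableSet
    (e := ‖ζ‖⁻¹ • ζ) (norm_smul_inv_norm hζ0) (L := r) (fun y hy => by
      obtain ⟨s, hs, hs1, hsf⟩ := exists_mem_frontier_of_exit h.isOpen (e := ζ) zero_le_one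
        (hQΩ hy).1 (by rw [one_smul]; exact hout y hy)
      have hsm : (s * ‖ζ‖) • ‖ζ‖⁻¹ • ζ = s • ζ := by
        rw [smul_smul, mul_assoc, mul_inv_cancel₀ hζn.ne', mul_one]
      have hsr : s * ‖ζ‖ ≤ r := (mul_le_of_le_one_left hζn.le hs1).trans hζ
      refine ⟨s * ‖ζ‖, by positivity, hsr, ?_, fun τ hτ => ?_⟩
      · rw [hsm]
        exact hG' y hy s ⟨hs.le, hs1⟩ hsf
      · rw [mem_closedBall_iff_norm]
        have h2 := (hQΩ hy).2
        rw [mem_closedBall_iff_norm] at h2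
        have h3 : ‖τ • ‖ζ‖⁻¹ • ζ‖ = τ := by
          rw [norm_smul, norm_smul, norm_inv, norm_norm, inv_mul_cancel₀ hζn.ne', mul_one,
            Real.norm_of_nonneg hτ.1]
        rw [add_sub_right_comm]
        refine (norm_add_le _ _).trans ?_
        rw [h3]
        linarith [hτ.2])
  refine h1.trans (le_of_eq ?_)
  rw [ENNReal.ofReal_mul (by norm_num), ENNReal.ofReal_pow (by linarith [norm_nonneg ζ])]
  norm_num
  ring

/-- Friedrichs' inequality on a substantial part of every ball around a boundary point off `Γ`. -/
theorem IsFlatPart.exists_local_friedrichs (h : IsFlatPart Ω Γ a b) :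
    ∃ R c : ℝ, 0 < R ∧ 0 < c ∧ ∀ x ∈ frontier Ω, x ∉ Γ → ∀ t ∈ Ioc (0 : ℝ) 1,
      ∃ Q : Set (E d), MeasurableSet Q ∧ Q ⊆ Ω ∩ Metric.closedBall x (R * t) ∧
        ENNReal.ofReal (c * t ^ d) * volume (Metric.ball (0 : E d) 1) ≤ volume Q ∧
        ∀ (v : L2 Ω) (g : L2Vec Ω) (w : L2Bdry Ω), VanishesOff Ω Γ v g w →
          sqInt (volume.restrict Q) v ≤ ENNReal.ofReal (2 * (R * t) ^ 2) *
            sqInt (volume.restrict (Ω ∩ Metric.closedBall x (2 * (R * t)))) g := by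
  -- If `Γ` is a null set, the trace vanishes almost everywhere on the whole boundary and any exit
  -- will do. Otherwise the exits have to avoid `Γ`.
  rcases h.null_or_ball with hnull | ⟨γ, hγ, ρ, hρ, hball⟩
  · obtain ⟨R, c, hR, hc, hesc⟩ := h.exists_escape
    refine ⟨R, c, hR, hc, fun x hx _ t ht => ?_⟩
    obtain ⟨Q, ζ, hQ, hQΩ, hζ, hvol, hout⟩ := hesc x hx t ht
    refine ⟨Q, hQ, hQΩ, hvol, fun v g w hv => ?_⟩
    have hnull' : ∀ᵐ x ∂((surf d).restrict (frontier Ω)), x ∉ Γ := by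
      refine measure_mono_null (t := Γ) (fun x hx => by simpa using hx) ?_
      exact le_antisymm ((Measure.restrict_apply_le _ _).trans hnull.le) zero_le
    refine sqInt_le_of_translate h hv.1 isClosed_frontier.measurableSet Subset.rfl ?_ hQ hQΩ hζ hout
      (fun y _ s _ hf => hf)
    filter_upwards [hv.2, hnull'] with x hx hx' _
    exact hx hx'
  · obtain ⟨ρ', hρ', hle, hhalf⟩ := h.exists_half_ball hγ hρ hball
    obtain ⟨R, c, hR, hc, hesc⟩ := h.exists_escape_of_ball hγ hρ'
      (fun z hz => hball z (hz.trans_le hle)) hhalf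
    refine ⟨R, c, hR, hc, fun x hx hxΓ t ht => ?_⟩
    obtain ⟨Q, ζ, hQ, hQΩ, hζ, hvol, hout⟩ := hesc x hx hxΓ t ht
    refine ⟨Q, hQ, hQΩ, hvol, fun v g w hv => ?_⟩
    exact sqInt_le_of_translate h hv.1 h.measurableSet_diff sdiff_subset
      (hv.2.mono fun x hx hx' => hx hx'.2) hQ hQΩ hζ (fun y hy => (hout y hy).1)
      (fun y hy s hs hf => ⟨hf, (hout y hy).2 s hs⟩)

theorem sqInt_const {α : Type*} [MeasurableSpace α] (μ : Measure α) (c : ℝ) :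
    sqInt μ (fun _ => c) = ‖c‖ₑ ^ 2 * μ univ := by
  rw [sqInt, lintegral_const]

theorem sqInt_sub_average_ball_le (hc : Convex ℝ Ω) (ho : IsOpen Ω) {v : L2 Ω} {g : L2Vec Ω}
    {w : L2Bdry Ω} (hv : IsTrace Ω v g w) (x : E d) {r : ℝ} (hr : 0 ≤ r) :
    sqInt (volume.restrict (Ω ∩ Metric.closedBall x r))
      (fun y => v y - ⨍ z in Ω ∩ Metric.closedBall x r, v z) ≤
      ENNReal.ofReal ((2 * r) ^ 2 * 2 ^ d) *
        sqInt (volume.restrict (Ω ∩ Metric.closedBall x r)) g := by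
  have h1 := hv.sqInt_sub_average_le (Q := Ω ∩ Metric.closedBall x r) inter_subset_left
    (hc.inter (convex_closedBall x r)) (ho.measurableSet.inter Metric.isClosed_closedBall.measurableSet)
    (Metric.isBounded_closedBall.subset inter_subset_right) (D := ENNReal.ofReal (2 * r)) ENNReal.ofReal_ne_top
    (fun y hy z hz => by
      rw [← ofReal_norm]
      refine ENNReal.ofReal_le_ofReal ?_
      rw [← dist_eq_norm]
      refine (dist_triangle_right z y x).trans ?_
      have := hy.2
      have := hz.2
      rw [Metric.mem_closedBall] at *
      linarith)
  refine h1.trans (le_of_eq ?_)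
  rw [ENNReal.ofReal_mul (p := (2 * r) ^ 2) (by positivity),
    ENNReal.ofReal_pow (p := 2 * r) (by positivity) 2,
    ENNReal.ofReal_pow (by norm_num), ENNReal.ofReal_ofNat, mul_assoc]

/-- Poincaré's inequality on balls around boundary points off `Γ`. -/
theorem IsFlatPart.exists_local_poincare (h : IsFlatPart Ω Γ a b) :
    ∃ (M : ℝ) (C : ℝ≥0∞), 2 ≤ M ∧ C ≠ ⊤ ∧ ∀ x ∈ frontier Ω, x ∉ Γ →
      ∀ r ∈ Ioc (0 : ℝ) (Metric.diam Ω),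
      ∀ (v : L2 Ω) (g : L2Vec Ω) (w : L2Bdry Ω), VanishesOff Ω Γ v g w →
          sqInt (volume.restrict (Ω ∩ Metric.closedBall x (M * r))) v ≤
            C * ENNReal.ofReal (r ^ 2) *
              sqInt (volume.restrict (Ω ∩ Metric.closedBall x (M * r))) g := by
  obtain ⟨R, c, hR, hc, hloc⟩ := h.exists_local_friedrichs
  set D := Metric.diam Ω with hD
  have hD0 : 0 ≤ D := Metric.diam_nonneg
  rcases hD0.eq_or_lt with hD0 | hD0
  · refine ⟨2, 0, le_rfl, by simp, fun x _ _ r hr => ?_⟩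
    exact absurd (hr.1.trans_le hr.2) (by rw [← hD0]; exact lt_irrefl _)
  have := h.nontrivial
  -- The local Friedrichs inequality is used at scale `t = r / D`; `M ≥ 2 * R / D` puts its doubled
  -- ball inside the ball of radius `M * r`. The bound `M ≥ 2` is for later, so that this ball
  -- contains elements with a vertex within `r` of `x`.
  set M := max 2 (2 * R / D) with hM
  have hM2 : 2 ≤ M := le_max_left _ _
  have hM0 : 0 < M := by linarith
  have hMR : 2 * R / D ≤ M := le_max_right _ _
  set K : ℝ := (M * D) ^ d / c with hK
  refine ⟨M, ENNReal.ofReal (2 * ((2 * M) ^ 2 * 2 ^ d) + 2 * (K * (2 * ((2 * M) ^ 2 * 2 ^ d) +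
    2 * (2 * M ^ 2)))), hM2, by simp, fun x hx hxΓ r hr v g w hv => ?_⟩
  obtain ⟨hr0, hrD⟩ := hr
  obtain ⟨Q, hQ, hQΩ, hvol, hF⟩ := hloc x hx hxΓ (r / D)
    ⟨by positivity, (div_le_one hD0).2 hrD⟩
  have hRr : 2 * (R * (r / D)) ≤ M * r := by
    calc 2 * (R * (r / D)) = 2 * R / D * r := by ring
      _ ≤ M * r := by gcongr
  have hRr' : R * (r / D) ≤ M * r := by
    have : 0 < R * (r / D) := by positivity
    linarith
  set P := Ω ∩ Metric.closedBall x (M * r) with hP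
  set G := sqInt (volume.restrict P) g with hG
  set m := ⨍ z in P, v z with hm
  have hS : sqInt (volume.restrict P) (fun y => v y - m) ≤
      ENNReal.ofReal ((2 * (M * r)) ^ 2 * 2 ^ d) * G :=
    sqInt_sub_average_ball_le h.convex h.isOpen hv.1 x (by positivity)
  have hQP : Q ⊆ P := fun y hy =>
    ⟨(hQΩ hy).1, Metric.closedBall_subset_closedBall hRr' (hQΩ hy).2⟩
  have hFQ : sqInt (volume.restrict Q) v ≤ ENNReal.ofReal (2 * (M * r) ^ 2) * G := by
    refine (hF v g w hv).trans ?_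
    gcongr
    exact sqInt_mono_set (inter_subset_inter_right _ (Metric.closedBall_subset_closedBall hRr)) _
  have hvP : volume P ≤ ENNReal.ofReal K * volume Q := by
    calc volume P ≤ volume (Metric.closedBall x (M * r)) := measure_mono inter_subset_right
      _ = ENNReal.ofReal ((M * r) ^ d) * volume (Metric.ball (0 : E d) 1) := by
        rw [Measure.addHaar_closedBall_eq_addHaar_ball, volume_ball_eq x (by positivity)]
      _ = ENNReal.ofReal K * (ENNReal.ofReal (c * (r / D) ^ d) *
            volume (Metric.ball (0 : E d) 1)) := by
        rw [← mul_assoc, ← ENNReal.ofReal_mul (by positivity)]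
        congr 2
        rw [hK]
        have h1 : (M * r) ^ d = (M * D) ^ d * (r / D) ^ d := by
          rw [← mul_pow]; congr 1; field_simp
        rw [h1]
        field_simp
      _ ≤ _ := by gcongr
  have hmeas : ∀ {S : Set (E d)}, S ⊆ P → AEStronglyMeasurable (fun y => v y - m)
      (volume.restrict S) := fun hS =>
    ((Lp.aestronglyMeasurable v).mono_measure
      (Measure.restrict_mono (hS.trans inter_subset_left) le_rfl)).sub aestronglyMeasurable_const
  -- The mean is controlled on `Q` by writing `m = v - (v - m)`: `v` is small there by Friedrichs,
  -- `v - m` by Poincaré on `P`. As `Q` fills a fixed fraction of `P`, this controls `m` on all of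
  -- `P`.
  have hmQ : ‖m‖ₑ ^ 2 * volume Q ≤ 2 * (ENNReal.ofReal ((2 * (M * r)) ^ 2 * 2 ^ d) * G) +
      2 * (ENNReal.ofReal (2 * (M * r) ^ 2) * G) := by
    have h1 := sqInt_add_le (μ := volume.restrict Q) (f := fun y => -(v y - m)) (hmeas hQP).neg v
    have h2 : (fun y => -(v y - m) + v y) = fun _ => m := by ext y; ring
    rw [h2, sqInt_const, Measure.restrict_apply_univ] at h1
    refine h1.trans ?_
    gcongr
    refine le_trans ?_ ((sqInt_mono_set hQP _).trans hS)
    simp only [sqInt, enorm_neg]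
    exact le_rfl
  have hvm : sqInt (volume.restrict P) v ≤ 2 * sqInt (volume.restrict P) (fun y => v y - m) +
      2 * (‖m‖ₑ ^ 2 * volume P) := by
    have h1 := sqInt_add_le (μ := volume.restrict P) (hmeas Subset.rfl) (fun _ => m)
    rw [sqInt_const, Measure.restrict_apply_univ] at h1
    refine le_trans (le_of_eq ?_) h1
    congr 1
    ext y
    ring
  calc sqInt (volume.restrict P) v
      ≤ 2 * sqInt (volume.restrict P) (fun y => v y - m) + 2 * (‖m‖ₑ ^ 2 * volume P) := hvm
    _ ≤ 2 * (ENNReal.ofReal ((2 * (M * r)) ^ 2 * 2 ^ d) * G) +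
        2 * (ENNReal.ofReal K * (‖m‖ₑ ^ 2 * volume Q)) := by
        refine add_le_add (mul_le_mul' le_rfl hS) (mul_le_mul' le_rfl ?_)
        calc ‖m‖ₑ ^ 2 * volume P ≤ ‖m‖ₑ ^ 2 * (ENNReal.ofReal K * volume Q) := by gcongr
          _ = _ := by ring
    _ ≤ 2 * (ENNReal.ofReal ((2 * (M * r)) ^ 2 * 2 ^ d) * G) +
        2 * (ENNReal.ofReal K * (2 * (ENNReal.ofReal ((2 * (M * r)) ^ 2 * 2 ^ d) * G) +
          2 * (ENNReal.ofReal (2 * (M * r) ^ 2) * G))) := by gcongr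
    _ = ENNReal.ofReal (2 * ((2 * M) ^ 2 * 2 ^ d) + 2 * (K * (2 * ((2 * M) ^ 2 * 2 ^ d) +
          2 * (2 * M ^ 2)))) * ENNReal.ofReal (r ^ 2) * G := by
        have hK0 : 0 ≤ K := by positivity
        have hK0 : 0 ≤ K := by positivity
        have h2 : ENNReal.ofReal (2 * ((2 * M) ^ 2 * 2 ^ d) + 2 * (K * (2 * ((2 * M) ^ 2 * 2 ^ d) +
            2 * (2 * M ^ 2)))) * ENNReal.ofReal (r ^ 2) =
            2 * ENNReal.ofReal ((2 * (M * r)) ^ 2 * 2 ^ d) + 2 * (ENNReal.ofReal K *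
            (2 * ENNReal.ofReal ((2 * (M * r)) ^ 2 * 2 ^ d) +
              2 * ENNReal.ofReal (2 * (M * r) ^ 2))) := by
          have h3 : ∀ x : ℝ, 2 * ENNReal.ofReal x = ENNReal.ofReal (2 * x) := fun x => by
            rw [ENNReal.ofReal_mul (by norm_num), ENNReal.ofReal_ofNat]
          rw [h3, h3, ← ENNReal.ofReal_add (by positivity) (by positivity),
            ← ENNReal.ofReal_mul hK0, h3, ← ENNReal.ofReal_add (by positivity) (by positivity),
            ← ENNReal.ofReal_mul (by positivity)]
          congr 1
          ring
        rw [h2]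
        ring

end

/-! ### Triangulations, finite element functions and stability of the `L²` projection -/

section

/-! ### Simplices and barycentric coordinates -/

/-- `s` is the set of vertices of a nondegenerate simplex of full dimension. -/
def IsSimplex (s : Finset (E d)) : Prop :=
  AffineIndependent ℝ ((↑) : s → E d) ∧ s.card = d + 1

theorem IsSimplex.affineSpan_eq_top {s : Finset (E d)} (hs : IsSimplex s) :
    affineSpan ℝ (s : Set (E d)) = ⊤ := by
  have h := hs.1.affineSpan_eq_top_iff_card_eq_finrank_add_one.2
    (by rw [Fintype.card_coe, hs.2, finrank_euclideanSpace_fin])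
  rwa [Subtype.range_coe] at h

/-- The affine basis formed by the vertices of a simplex. -/
def IsSimplex.basis {s : Finset (E d)} (hs : IsSimplex s) : AffineBasis s ℝ (E d) where
  toFun := (↑)
  ind' := hs.1
  tot' := by
    have h := hs.affineSpan_eq_top
    rwa [← Subtype.range_coe (s := (s : Set (E d)))] at h

theorem IsSimplex.range_basis {s : Finset (E d)} (hs : IsSimplex s) :
    range hs.basis = (s : Set (E d)) := Subtype.range_coe

open Classical in
/-- The barycentric coordinate of the simplex `s` for the vertex `p`, or `0` if `p` is not a
vertex of `s`. -/
def bary (s : Finset (E d)) (p : E d) : E d →ᵃ[ℝ] ℝ :=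
  if h : p ∈ s ∧ IsSimplex s then h.2.basis.coord ⟨p, h.1⟩ else AffineMap.const ℝ (E d) 0

variable {s t : Finset (E d)}

theorem bary_eq (hs : IsSimplex s) (p : s) : bary s (p : E d) = hs.basis.coord p := by
  rw [bary, dif_pos ⟨p.2, hs⟩]

theorem bary_of_notMem {p : E d} (hp : p ∉ s) (x : E d) : bary s p x = 0 := by
  rw [bary, dif_neg (fun h => hp h.1)]; rfl

theorem bary_self (hs : IsSimplex s) {p : E d} (hp : p ∈ s) : bary s p p = 1 := by
  rw [show bary s p = _ from bary_eq hs ⟨p, hp⟩]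
  exact hs.basis.coord_apply_eq ⟨p, hp⟩

theorem bary_ne (hs : IsSimplex s) {p q : E d} (hp : p ∈ s) (hq : q ∈ s) (h : p ≠ q) :
    bary s p q = 0 := by
  rw [show bary s p = _ from bary_eq hs ⟨p, hp⟩]
  exact hs.basis.coord_apply_ne (j := ⟨q, hq⟩) (fun hc => h (congrArg Subtype.val hc))

theorem sum_bary (hs : IsSimplex s) (x : E d) : ∑ p ∈ s, bary s p x = 1 := by
  rw [← Finset.sum_coe_sort, ← hs.basis.sum_coord_apply_eq_one x]
  exact Finset.sum_congr rfl fun p _ => by rw [bary_eq hs]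

theorem mem_convexHull_iff_bary (hs : IsSimplex s) {x : E d} :
    x ∈ convexHull ℝ (s : Set (E d)) ↔ ∀ p ∈ s, 0 ≤ bary s p x := by
  rw [← hs.range_basis, hs.basis.convexHull_eq_nonneg_coord]
  exact ⟨fun h p hp => by rw [show bary s p = _ from bary_eq hs ⟨p, hp⟩]; exact h _,
    fun h p => by rw [← bary_eq hs]; exact h _ p.2⟩

theorem mem_interior_convexHull_iff_bary (hs : IsSimplex s) {x : E d} :
    x ∈ interior (convexHull ℝ (s : Set (E d))) ↔ ∀ p ∈ s, 0 < bary s p x := by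
  rw [← hs.range_basis, hs.basis.interior_convexHull]
  exact ⟨fun h p hp => by rw [show bary s p = _ from bary_eq hs ⟨p, hp⟩]; exact h _,
    fun h p => by rw [← bary_eq hs]; exact h _ p.2⟩

theorem isCompact_convexHull_finset (s : Finset (E d)) :
    IsCompact (convexHull ℝ (s : Set (E d))) :=
  s.finite_toSet.isCompact_convexHull ℝ

theorem bary_le_one (hs : IsSimplex s) {x : E d} (hx : x ∈ convexHull ℝ (s : Set (E d)))
    (p : E d) : bary s p x ≤ 1 := by
  by_cases hp : p ∈ s
  · rw [← sum_bary hs x]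
    exact Finset.single_le_sum (f := fun p => bary s p x)
      (fun q hq => mem_convexHull_iff_bary hs |>.1 hx q hq) hp
  · rw [bary_of_notMem hp]; exact zero_le_one

theorem bary_nonneg (hs : IsSimplex s) {x : E d} (hx : x ∈ convexHull ℝ (s : Set (E d)))
    (p : E d) : 0 ≤ bary s p x := by
  by_cases hp : p ∈ s
  · exact mem_convexHull_iff_bary hs |>.1 hx p hp
  · rw [bary_of_notMem hp]

/-- Two affine maps which agree at the vertices agree on the simplex. -/
theorem AffineMap.eqOn_convexHull {f g : E d →ᵃ[ℝ] ℝ} {S : Set (E d)} (h : EqOn f g S) :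
    EqOn f g (convexHull ℝ S) := by
  have hc : Convex ℝ {x | f x = g x} := by
    intro x hx y hy a b _ _ hab
    simp only [mem_ofPred_eq] at hx hy ⊢
    rw [Convex.combo_affine_apply hab, Convex.combo_affine_apply hab, hx, hy]
  exact convexHull_min h hc

/-- The affine function with values `c p` at the vertices `p` of the simplex `s`. -/
def affineInterp (s : Finset (E d)) (c : E d → ℝ) : E d →ᵃ[ℝ] ℝ := ∑ p ∈ s, c p • bary s p

theorem affineInterp_apply (s : Finset (E d)) (c : E d → ℝ) (x : E d) :
    affineInterp s c x = ∑ p ∈ s, c p * bary s p x := by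
  suffices h : ∀ A : Finset (E d), (∑ p ∈ A, c p • bary s p) x = ∑ p ∈ A, c p * bary s p x from
    h s
  intro A
  induction A using Finset.cons_induction with
  | empty => rfl
  | cons a A ha ih => rw [Finset.sum_cons, Finset.sum_cons, ← ih]; rfl

theorem affineInterp_vertex (hs : IsSimplex s) (c : E d → ℝ) {q : E d} (hq : q ∈ s) :
    affineInterp s c q = c q := by
  rw [affineInterp_apply, Finset.sum_eq_single q, bary_self hs hq, mul_one]
  · intro p hp hpq
    rw [bary_ne hs hp hq hpq, mul_zero]
  · exact fun h => absurd hq h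

/-! ### Bounded pieces of hyperplanes -/

/-- `A` is the Lipschitz image of its bounded orthogonal projection onto `n^⊥`. -/
theorem surf_lt_top_of_hyperplane {A : Set (E d)} (hA : Bornology.IsBounded A) {n : E d}
    (hn : n ≠ 0) {b : ℝ} (hAn : ∀ x ∈ A, inner ℝ n x = b) : surf d A < ⊤ := by
  have hnn : inner ℝ n n ≠ (0 : ℝ) := by simpa using hn
  have hlip := lipschitzWith_hyperplaneSection n n b
  have hsub : A ⊆ hyperplaneSection n n b '' (projOrth n '' A) := fun z hz =>
    ⟨projOrth n z, ⟨z, hz, rfl⟩, hyperplaneSection_projOrth hnn (hAn z hz)⟩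
  refine (measure_mono hsub).trans_lt ((euclideanHausdorffMeasure_image_le
      (hlip.lipschitzOnWith (s := projOrth n '' A)) (d - 1)).trans_lt ?_)
  have hb : Bornology.IsBounded (projOrth n '' A) :=
    (projOrth n).lipschitz.isBounded_image hA
  have : μHE[d - 1] (projOrth n '' A) < ⊤ := by
    have := hb.measure_lt_top (μ := (volume : Measure (ℝ ∙ n)ᗮ))
    rwa [← InnerProductSpace.euclideanHausdorffMeasure_eq_volume, finrank_orthogonal_span hn]
      at this
  exact ENNReal.mul_lt_top (by finiteness) this

/-! ### Triangulations -/

/-- The elements of a triangulation: its simplices of full dimension. -/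
def elements (K : Geometry.SimplicialComplex ℝ (E d)) : Set (Finset (E d)) :=
  {s | s ∈ K.faces ∧ s.card = d + 1}

variable {K : Geometry.SimplicialComplex ℝ (E d)} {Ω : Set (E d)}

theorem isSimplex_of_mem (hs : s ∈ elements K) : IsSimplex s := ⟨K.indep hs.1, hs.2⟩

theorem IsTriangulation.finite_elements (hK : IsTriangulation K Ω) : (elements K).Finite :=
  hK.1.subset fun _ h => h.1

theorem IsTriangulation.convexHull_subset (hK : IsTriangulation K Ω) (hs : s ∈ elements K) :
    convexHull ℝ (s : Set (E d)) ⊆ closure Ω := by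
  rw [← hK.2]; exact Geometry.SimplicialComplex.convexHull_subset_space hs.1

theorem IsTriangulation.interior_subset (hK : IsTriangulation K Ω) (hc : Convex ℝ Ω)
    (ho : IsOpen Ω) (hne : Ω.Nonempty) (hs : s ∈ elements K) :
    interior (convexHull ℝ (s : Set (E d))) ⊆ Ω := by
  have h := interior_mono (hK.convexHull_subset hs)
  rwa [hc.interior_closure_eq_interior_of_nonempty_interior (by rwa [ho.interior_eq]),
    ho.interior_eq] at h

theorem volume_convexHull_of_card_ne (hs : s ∈ K.faces) (hcard : s.card ≠ d + 1) :
    volume (convexHull ℝ (s : Set (E d))) = 0 := by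
  refine measure_mono_null (convexHull_subset_affineSpan _)
    (Measure.addHaar_affineSubspace _ _ fun htop => hcard ?_)
  have hi := K.indep hs
  have h := hi.affineSpan_eq_top_iff_card_eq_finrank_add_one.1
    (by rw [← htop]; congr 1; exact Subtype.range_coe)
  rwa [Fintype.card_coe, finrank_euclideanSpace_fin] at h

/-- The elements cover the closure of the domain. -/
theorem IsTriangulation.exists_mem (hK : IsTriangulation K Ω) (ho : IsOpen Ω) {x : E d}
    (hx : x ∈ closure Ω) : ∃ s ∈ elements K, x ∈ convexHull ℝ (s : Set (E d)) := by
  by_contra hcon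
  push Not at hcon
  set U : Set (E d) := ⋃ s ∈ elements K, convexHull ℝ (s : Set (E d)) with hU
  have hUc : IsClosed U :=
    hK.finite_elements.isClosed_biUnion fun s _ => (isCompact_convexHull_finset s).isClosed
  have hxU : x ∈ Uᶜ := by
    simp only [hU, mem_compl_iff, mem_iUnion, not_exists]
    exact hcon
  -- Simplices outside `elements K` are not assumed to be faces of elements. An uncovered point
  -- would nevertheless leave a nonempty open part of `Ω`, of positive measure, covered by finitely
  -- many lower-dimensional simplices, which are null.
  have hne : (Uᶜ ∩ Ω).Nonempty := mem_closure_iff.1 hx _ hUc.isOpen_compl hxU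
  have hpos := (hUc.isOpen_compl.inter ho).measure_pos volume hne
  refine hpos.ne' ?_
  have hsub : Uᶜ ∩ Ω ⊆ ⋃ s ∈ {s ∈ K.faces | s.card ≠ d + 1}, convexHull ℝ (s : Set (E d)) := by
    rintro y ⟨hyU, hyΩ⟩
    have hy := subset_closure hyΩ
    rw [← hK.2, Geometry.SimplicialComplex.mem_space_iff] at hy
    obtain ⟨s, hs, hys⟩ := hy
    refine mem_biUnion (x := s) ⟨hs, fun hcard => hyU ?_⟩ hys
    exact mem_biUnion (x := s) ⟨hs, hcard⟩ hys
  refine measure_mono_null hsub ((measure_biUnion_null_iff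
    (hK.1.subset (sep_subset _ _)).countable).2 fun s hs => volume_convexHull_of_card_ne hs.1 hs.2)

/-- The two simplices meet in the hull of their common vertices. The barycentric coordinate of a
vertex of `s` that is not in `t` vanishes on that hull but is positive in the interior of `s`. -/
theorem interior_inter_convexHull_eq_empty (hs : s ∈ elements K) (ht : t ∈ elements K)
    (hst : s ≠ t) :
    interior (convexHull ℝ (s : Set (E d))) ∩ convexHull ℝ (t : Set (E d)) = ∅ := by
  rw [eq_empty_iff_forall_notMem]
  rintro x ⟨hxs, hxt⟩
  have hx := K.inter_subset_convexHull hs.1 ht.1 ⟨interior_subset hxs, hxt⟩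
  obtain ⟨p, hps, hpt⟩ : ∃ p ∈ s, p ∉ t := by
    by_contra hcon
    push Not at hcon
    exact hst (Finset.eq_of_subset_of_card_le hcon (by rw [hs.2, ht.2]))
  have h0 : EqOn (bary s p) (AffineMap.const ℝ (E d) (0 : ℝ)) (s ∩ t : Set (E d)) := by
    rintro q ⟨hqs, hqt⟩
    exact bary_ne (isSimplex_of_mem hs) hps hqs (fun h => hpt (h ▸ hqt))
  have h1 := AffineMap.eqOn_convexHull h0 hx
  have h2 := (mem_interior_convexHull_iff_bary (isSimplex_of_mem hs)).1 hxs p hps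
  rw [h1] at h2
  exact lt_irrefl _ h2

/-- Both interpolants take the values `c` at the common vertices, whose hull contains the
intersection. Hence `pwAffine` does not depend on the element chosen for a point. -/
theorem affineInterp_eq_of_mem (hs : s ∈ elements K) (ht : t ∈ elements K) (c : E d → ℝ)
    {x : E d} (hxs : x ∈ convexHull ℝ (s : Set (E d))) (hxt : x ∈ convexHull ℝ (t : Set (E d))) :
    affineInterp s c x = affineInterp t c x := by
  refine AffineMap.eqOn_convexHull (S := (s ∩ t : Set (E d))) ?_
    (K.inter_subset_convexHull hs.1 ht.1 ⟨hxs, hxt⟩)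
  rintro q ⟨hqs, hqt⟩
  rw [affineInterp_vertex (isSimplex_of_mem hs) c hqs,
    affineInterp_vertex (isSimplex_of_mem ht) c hqt]

theorem ae_mem_interior (hK : IsTriangulation K Ω) (ho : IsOpen Ω) :
    ∀ᵐ x ∂(volume.restrict Ω), ∃ s ∈ elements K,
      x ∈ interior (convexHull ℝ (s : Set (E d))) := by
  have h0 : ∀ᵐ x ∂(volume.restrict Ω),
      ∀ s ∈ elements K, x ∉ frontier (convexHull ℝ (s : Set (E d))) := by
    rw [ae_ball_iff hK.finite_elements.countable]
    intro s _
    refine ae_restrict_of_ae (measure_eq_zero_iff_ae_notMem.1 ?_)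
    exact (convex_convexHull ℝ _).addHaar_frontier volume
  filter_upwards [h0, ae_restrict_mem ho.measurableSet] with x hx hxΩ
  obtain ⟨s, hs, hxs⟩ := hK.exists_mem ho (subset_closure hxΩ)
  refine ⟨s, hs, ?_⟩
  by_contra hcon
  exact hx s hs ⟨subset_closure hxs, hcon⟩

/-- A boundary point belongs to an element but not to its interior, so one of its barycentric
coordinates vanishes; finitely many bounded pieces of hyperplanes cover the boundary. Finite surface
measure is what turns uniform convergence on `∂Ω` into convergence in `L²(∂Ω)`. -/
theorem surf_frontier_lt_top (hd : 1 ≤ d) (hK : IsTriangulation K Ω) (hc : Convex ℝ Ω)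
    (ho : IsOpen Ω) (hne : Ω.Nonempty) : surf d (frontier Ω) < ⊤ := by
  have hsub : frontier Ω ⊆ ⋃ s ∈ elements K, ⋃ p ∈ s,
      {x ∈ convexHull ℝ (s : Set (E d)) | bary s p x = 0} := by
    intro x hx
    obtain ⟨s, hs, hxs⟩ := hK.exists_mem ho (frontier_subset_closure hx)
    have hni : x ∉ interior (convexHull ℝ (s : Set (E d))) := fun h => by
      have := hK.interior_subset hc ho hne hs h
      rw [ho.frontier_eq] at hx
      exact hx.2 this
    rw [mem_interior_convexHull_iff_bary (isSimplex_of_mem hs)] at hni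
    push Not at hni
    obtain ⟨p, hp, hpx⟩ := hni
    exact mem_biUnion hs (mem_biUnion (show p ∈ s from hp)
      ⟨hxs, le_antisymm hpx (bary_nonneg (isSimplex_of_mem hs) hxs p)⟩)
  refine (measure_mono hsub).trans_lt ?_
  refine measure_biUnion_lt_top hK.finite_elements fun s hs =>
    measure_biUnion_lt_top s.finite_toSet fun p hp => ?_
  set n : E d := (InnerProductSpace.toDual ℝ (E d)).symm
    (LinearMap.toContinuousLinearMap (bary s p).linear) with hn
  have hnx : ∀ x, inner ℝ n x = (bary s p).linear x := fun x => by
    rw [hn, InnerProductSpace.toDual_symm_apply]; rfl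
  have hsx := isSimplex_of_mem hs
  -- A second vertex exists because `d ≥ 1`; the coordinate is `1` at `p` and `0` at `q`, so its
  -- gradient `n` is not zero.
  obtain ⟨q, hq, hqp⟩ : ∃ q ∈ s, q ≠ p := by
    by_contra hcon
    push Not at hcon
    have : s.card ≤ 1 := Finset.card_le_one.2 fun a ha b hb => by rw [hcon a ha, hcon b hb]
    have := hs.2
    omega
  have hdec : ∀ x, bary s p x = inner ℝ n x + bary s p 0 := fun x => by
    rw [hnx]
    exact congrFun (bary s p).decomp x
  refine surf_lt_top_of_hyperplane (n := n) (b := -bary s p 0)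
    ((isCompact_convexHull_finset s).isBounded.subset (sep_subset _ _)) (fun h0 => ?_)
    (fun x hx => by have := hdec x; rw [hx.2] at this; linarith)
  have h1 := hdec p
  have h2 := hdec q
  rw [h0, inner_zero_left, bary_self hsx hp] at h1
  rw [h0, inner_zero_left, bary_ne hsx hp hq hqp.symm] at h2
  linarith

end

section

/-! ### Lipschitz functions are Sobolev functions -/

theorem eLpNorm_two_eq_sqInt {α F : Type*} [MeasurableSpace α] [NormedAddCommGroup F]
    (μ : Measure α) (f : α → F) : eLpNorm f 2 μ = sqInt μ f ^ (1 / 2 : ℝ) := by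
  rw [← eLpNorm_two_sq, ← ENNReal.rpow_natCast, ← ENNReal.rpow_mul]
  norm_num

theorem tendsto_integral_smul_of_eLpNorm {α F : Type*} [MeasurableSpace α] [NormedAddCommGroup F]
    [NormedSpace ℝ F] {μ : Measure α} {a : ℕ → α → ℝ} {a₀ : α → ℝ} {b : α → F}
    (ha : ∀ n, MemLp (a n) 2 μ) (ha₀ : MemLp a₀ 2 μ) (hb : MemLp b 2 μ)
    (h : Tendsto (fun n => eLpNorm (fun x => a n x - a₀ x) 2 μ) atTop (𝓝 0)) :
    Tendsto (fun n => ∫ x, a n x • b x ∂μ) atTop (𝓝 (∫ x, a₀ x • b x ∂μ)) := by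
  refine tendsto_integral_of_L1 _ (memLp_one_iff_integrable.1 (hb.smul ha₀ (r := 1))).1
    (Eventually.of_forall fun n => memLp_one_iff_integrable.1 (hb.smul (ha n) (r := 1))) ?_
  have h0 : Tendsto (fun n => eLpNorm (fun x => a n x - a₀ x) 2 μ * eLpNorm b 2 μ) atTop
      (𝓝 0) := by
    have := ENNReal.Tendsto.mul_const (b := eLpNorm b 2 μ) h (Or.inr hb.eLpNorm_ne_top)
    rwa [zero_mul] at this
  refine tendsto_of_tendsto_of_tendsto_of_le_of_le tendsto_const_nhds h0
    (fun n => zero_le) (fun n => ?_)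
  have := eLpNorm_smul_le_mul_eLpNorm (p := 2) (q := 2) (r := 1) hb.1
    (φ := fun x => a n x - a₀ x) ((ha n).sub ha₀).1
  refine le_trans (le_of_eq ?_) this
  rw [eLpNorm_one_eq_lintegral_enorm]
  refine lintegral_congr fun x => ?_
  simp only [Pi.smul_apply', sub_smul]

theorem tendsto_integral_smul_of_eLpNorm' {α F : Type*} [MeasurableSpace α] [NormedAddCommGroup F]
    [NormedSpace ℝ F] {μ : Measure α} {a : α → ℝ} {b : ℕ → α → F} {b₀ : α → F}
    (ha : MemLp a 2 μ) (hb : ∀ n, MemLp (b n) 2 μ) (hb₀ : MemLp b₀ 2 μ)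
    (h : Tendsto (fun n => eLpNorm (fun x => b n x - b₀ x) 2 μ) atTop (𝓝 0)) :
    Tendsto (fun n => ∫ x, a x • b n x ∂μ) atTop (𝓝 (∫ x, a x • b₀ x ∂μ)) := by
  refine tendsto_integral_of_L1 _ (memLp_one_iff_integrable.1 (hb₀.smul ha (r := 1))).1
    (Eventually.of_forall fun n => memLp_one_iff_integrable.1 ((hb n).smul ha (r := 1))) ?_
  have h0 : Tendsto (fun n => eLpNorm a 2 μ * eLpNorm (fun x => b n x - b₀ x) 2 μ) atTop
      (𝓝 0) := by
    have := ENNReal.Tendsto.const_mul (a := eLpNorm a 2 μ) h (Or.inr ha.eLpNorm_ne_top)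
    rwa [mul_zero] at this
  refine tendsto_of_tendsto_of_tendsto_of_le_of_le tendsto_const_nhds h0
    (fun n => zero_le) (fun n => ?_)
  have := eLpNorm_smul_le_mul_eLpNorm (p := 2) (q := 2) (r := 1) (f := fun x => b n x - b₀ x)
    ((hb n).sub hb₀).1 ha.1
  refine le_trans (le_of_eq ?_) this
  rw [eLpNorm_one_eq_lintegral_enorm]
  refine lintegral_congr fun x => ?_
  simp only [Pi.smul_apply', smul_sub]

theorem integral_smul_gradient_eq_neg {φ ψ : E d → ℝ} (hφ : ContDiff ℝ ∞ φ) (hψ : ContDiff ℝ ∞ ψ)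
    (hc : HasCompactSupport ψ) :
    ∫ x, φ x • gradient ψ x = -∫ x, ψ x • gradient φ x := by
  have hgψ : HasCompactSupport (gradient ψ) :=
    (hc.fderiv (𝕜 := ℝ)).comp_left (g := (InnerProductSpace.toDual ℝ (E d)).symm) (map_zero _)
  have h1 : Integrable (fun x => φ x • gradient ψ x) :=
    (hφ.continuous.smul (continuous_gradient hψ)).integrable_of_hasCompactSupport hgψ.smul_left
  have h2 : Integrable (fun x => ψ x • gradient φ x) :=
    (hψ.continuous.smul (continuous_gradient hφ)).integrable_of_hasCompactSupport hc.smul_right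
  refine ext_inner_left ℝ fun z => ?_
  rw [inner_neg_right, ← integral_inner h1, ← integral_inner h2]
  have hin : ∀ {χ : E d → ℝ} (x : E d), inner ℝ z (gradient χ x) = fderiv ℝ χ x z := by
    intro χ x
    rw [real_inner_comm, gradient, InnerProductSpace.toDual_symm_apply]
  simp_rw [inner_smul_right, hin]
  have h1' := h1.const_inner (𝕜 := ℝ) z
  have h2' := h2.const_inner (𝕜 := ℝ) z
  simp_rw [inner_smul_right, hin] at h1' h2'
  have h := integral_mul_fderiv_eq_neg_fderiv_mul_of_integrable (μ := volume) (f := φ) (g := ψ)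
    (v := z) (by simpa only [mul_comm] using h2') h1'
    ((hφ.continuous.mul hψ.continuous).integrable_of_hasCompactSupport hc.mul_left)
    (fun x _ => (hφ.differentiable (by simp)) x) (fun x _ => (hψ.differentiable (by simp)) x)
  simpa only [mul_comm] using h

theorem memLp_restrict_of_continuous {F : Type*} [NormedAddCommGroup F]
    [SecondCountableTopology F] {Ω : Set (E d)} (hb : Bornology.IsBounded Ω) {f : E d → F}
    (hf : Continuous f) : MemLp f 2 (volume.restrict Ω) := by
  have : IsFiniteMeasure (volume.restrict (closure Ω)) := ⟨by
    rw [Measure.restrict_apply_univ]; exact hb.closure.measure_lt_top⟩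
  obtain ⟨C, hC⟩ := hb.isCompact_closure.exists_bound_of_continuousOn hf.continuousOn
  exact (MemLp.of_bound hf.aestronglyMeasurable C
    ((ae_restrict_mem isClosed_closure.measurableSet).mono fun x hx => hC x hx)).mono_measure
      (Measure.restrict_mono subset_closure le_rfl)

/-- Integration by parts holds for the smooth approximants and passes to the `L²` limits. So for
functions on a bounded `Ω` only the trace approximation has to be constructed. -/
theorem IsTrace.isWeakGradient {Ω : Set (E d)} {v : L2 Ω} {g : L2Vec Ω} {w : L2Bdry Ω}
    (hb : Bornology.IsBounded Ω) (h : IsTrace Ω v g w) : IsWeakGradient Ω v g := by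
  obtain ⟨φ, hφ, h1, h2, -⟩ := h
  intro ψ hψ hc hs
  have hgψ : HasCompactSupport (gradient ψ) :=
    (hc.fderiv (𝕜 := ℝ)).comp_left (g := (InnerProductSpace.toDual ℝ (E d)).symm) (map_zero _)
  have hψ2 : MemLp ψ 2 (volume.restrict Ω) := hψ.continuous.memLp_of_hasCompactSupport hc
  have hgψ2 : MemLp (gradient ψ) 2 (volume.restrict Ω) :=
    (continuous_gradient hψ).memLp_of_hasCompactSupport hgψ
  have hφ2 : ∀ n, MemLp (φ n) 2 (volume.restrict Ω) := fun n =>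
    memLp_restrict_of_continuous hb (hφ n).continuous
  have hφg2 : ∀ n, MemLp (gradient (φ n)) 2 (volume.restrict Ω) := fun n =>
    memLp_restrict_of_continuous hb (continuous_gradient (hφ n))
  have t1 := tendsto_integral_smul_of_eLpNorm hφ2 (Lp.memLp v) hgψ2 h1
  have t2 := tendsto_integral_smul_of_eLpNorm' hψ2 hφg2 (Lp.memLp g) h2
  refine tendsto_nhds_unique t1 (t2.neg.congr fun n => ?_)
  have hψ0 : ∀ x ∉ Ω, ψ x = 0 := fun x hx => image_eq_zero_of_notMem_tsupport fun h => hx (hs h)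
  have hgψ0 : ∀ x ∉ Ω, gradient ψ x = 0 := fun x hx => by
    have : fderiv ℝ ψ x = 0 := image_eq_zero_of_notMem_tsupport
      fun h => hx (hs (tsupport_fderiv_subset ℝ h))
    rw [gradient, this, map_zero]
  rw [setIntegral_eq_integral_of_forall_compl_eq_zero (fun x hx => by rw [hψ0 x hx, zero_smul]),
    setIntegral_eq_integral_of_forall_compl_eq_zero (fun x hx => by rw [hgψ0 x hx, smul_zero]),
    integral_smul_gradient_eq_neg (hφ n) hψ hc]

theorem gradient_eq_of_eventuallyEq_affine {f : E d → ℝ} {A : E d →ᵃ[ℝ] ℝ} {c : ℝ} {x : E d}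
    (h : ∀ᶠ y in 𝓝 x, f y = A y - c) :
    gradient f x = (InnerProductSpace.toDual ℝ (E d)).symm
      (LinearMap.toContinuousLinearMap A.linear) := by
  have h1 : HasFDerivAt (fun y => A y - c) (LinearMap.toContinuousLinearMap A.linear) x := by
    have h2 : (fun y => A y - c) =
        fun y => LinearMap.toContinuousLinearMap A.linear y + (A 0 - c) := by
      funext y
      have := congrFun A.decomp y
      simp only [Pi.add_apply] at this
      rw [this, LinearMap.coe_toContinuousLinearMap']
      ring
    rw [h2]
    exact (ContinuousLinearMap.hasFDerivAt _).add_const _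
  rw [gradient, (h1.congr_of_eventuallyEq h).fderiv]

theorem norm_gradient_le_of_lipschitzWith {f : E d → ℝ} {K : NNReal} (hf : LipschitzWith K f)
    (x : E d) : ‖gradient f x‖ ≤ K := by
  rw [gradient, LinearIsometryEquiv.norm_map]
  exact norm_fderiv_le_of_lipschitz ℝ hf

theorem measurable_gradient (f : E d → ℝ) : Measurable (gradient f) :=
  (InnerProductSpace.toDual ℝ (E d)).symm.continuous.measurable.comp (measurable_fderiv ℝ f)

open scoped Convolution in
/-- Lipschitz functions are approximated by smooth functions, together with their gradient at
the points around which they are affine. -/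
theorem exists_smooth_approx {f : E d → ℝ} {K : NNReal} (hf : LipschitzWith K f) :
    ∃ φ : ℕ → E d → ℝ, (∀ n, ContDiff ℝ ∞ (φ n)) ∧ (∀ n, LipschitzWith K (φ n)) ∧
      (∀ n x, ‖φ n x - f x‖ ≤ K * (1 / ((n : ℝ) + 1))) ∧
      ∀ x, ∀ A : E d →ᵃ[ℝ] ℝ, f =ᶠ[𝓝 x] A →
        ∀ᶠ n in atTop, gradient (φ n) x = gradient f x := by
  have hpos : ∀ n : ℕ, (0 : ℝ) < 1 / ((n : ℝ) + 1) := fun n => by positivity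
  let ρ : ℕ → ContDiffBump (0 : E d) := fun n =>
    ⟨1 / ((n : ℝ) + 1) / 2, 1 / ((n : ℝ) + 1), half_pos (hpos n), half_lt_self (hpos n)⟩
  have hρout : ∀ n, (ρ n).rOut = 1 / ((n : ℝ) + 1) := fun n => rfl
  let φ : ℕ → E d → ℝ := fun n => (ρ n).normed volume ⋆[ContinuousLinearMap.lsmul ℝ ℝ] f
  have hφ : ∀ n x, φ n x = ∫ t, (ρ n).normed volume t * f (x - t) := fun n x => rfl
  have hint : ∀ n (g : E d → ℝ), Continuous g →
      Integrable fun t => (ρ n).normed volume t * g t := fun n g hg =>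
    ((ρ n).continuous_normed.mul hg).integrable_of_hasCompactSupport
      (ρ n).hasCompactSupport_normed.mul_right
  have hfx : ∀ x, Continuous fun t => f (x - t) := fun x => hf.continuous.comp (by fun_prop)
  refine ⟨φ, fun n => ?_, fun n => ?_, fun n x => ?_, fun x A hA => ?_⟩
  · exact (ρ n).hasCompactSupport_normed.contDiff_convolution_left _ (ρ n).contDiff_normed
      hf.continuous.locallyIntegrable
  · refine LipschitzWith.of_dist_le_mul fun x y => ?_
    rw [Real.dist_eq, hφ, hφ, ← integral_sub (hint n _ (hfx x)) (hint n _ (hfx y)),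
      ← Real.norm_eq_abs]
    refine (norm_integral_le_of_norm_le (g := fun t => (ρ n).normed volume t * (K * dist x y))
      (hint n _ continuous_const) (Eventually.of_forall fun t => ?_)).trans_eq ?_
    · rw [← mul_sub, norm_mul, Real.norm_of_nonneg ((ρ n).nonneg_normed t)]
      refine mul_le_mul_of_nonneg_left ?_ ((ρ n).nonneg_normed t)
      have := hf.dist_le_mul (x - t) (y - t)
      rwa [dist_sub_right, Real.dist_eq] at this
    · rw [integral_mul_const, (ρ n).integral_normed, one_mul]
  · rw [← dist_eq_norm]
    refine (ρ n).dist_normed_convolution_le hf.continuous.aestronglyMeasurable fun y hy => ?_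
    refine (hf.dist_le_mul y x).trans ?_
    exact mul_le_mul_of_nonneg_left (Metric.mem_ball.1 hy).le K.2
  · obtain ⟨r, hr, hrA⟩ := Metric.eventually_nhds_iff_ball.1 hA
    have h1 : ∀ᶠ n : ℕ in atTop, 1 / ((n : ℝ) + 1) < r / 2 :=
      tendsto_one_div_add_atTop_nhds_zero_nat.eventually_lt_const (half_pos hr)
    filter_upwards [h1] with n hn
    -- Averaging an affine function changes it by a constant only, so the gradient is reproduced
    -- exactly; symmetry of the bump plays no part.
    have h2 : ∀ᶠ y in 𝓝 x, φ n y = A y - ∫ t, (ρ n).normed volume t * A.linear t := by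
      filter_upwards [Metric.ball_mem_nhds x (half_pos hr)] with y hy
      have hlin : Continuous fun t => A.linear t := A.linear.continuous_of_finiteDimensional
      have h3 : ∀ t, (ρ n).normed volume t * f (y - t) =
          (ρ n).normed volume t * A y - (ρ n).normed volume t * A.linear t := by
        intro t
        by_cases ht : t ∈ Metric.ball (0 : E d) (ρ n).rOut
        · have hmem : y - t ∈ Metric.ball x r := by
            rw [Metric.mem_ball, dist_eq_norm] at hy ⊢
            rw [mem_ball_zero_iff, hρout] at ht
            calc ‖y - t - x‖ = ‖(y - x) - t‖ := by congr 1; abel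
              _ ≤ ‖y - x‖ + ‖t‖ := norm_sub_le _ _
              _ < r := by linarith
          rw [hrA _ hmem, ← mul_sub]
          have h4 := congrFun A.decomp (y - t)
          have h5 := congrFun A.decomp y
          simp only [Pi.add_apply, map_sub] at h4 h5
          rw [h4, h5]
          ring
        · rw [← (ρ n).support_normed_eq (μ := volume), Function.notMem_support] at ht
          rw [ht]; ring
      rw [hφ]
      simp_rw [h3]
      rw [integral_sub (hint n _ continuous_const) (hint n _ hlin), integral_mul_const,
        (ρ n).integral_normed, one_mul]
    rw [gradient_eq_of_eventuallyEq_affine h2,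
      gradient_eq_of_eventuallyEq_affine (c := 0) (hA.mono fun y hy => by rw [hy, sub_zero])]

/-- Mollifications converge uniformly, which settles the function and its trace since both measures
are finite. Their gradients are bounded by `K` and eventually equal to that of `f` wherever `f` is
locally affine, so dominated convergence settles the gradients. -/
theorem exists_isTrace_of_lipschitzWith {Ω : Set (E d)}
    (hb : Bornology.IsBounded Ω) (hs : surf d (frontier Ω) < ⊤) {f : E d → ℝ} {K : NNReal}
    (hf : LipschitzWith K f)
    (ha : ∀ᵐ x ∂(volume.restrict Ω), ∃ A : E d →ᵃ[ℝ] ℝ, f =ᶠ[𝓝 x] A) :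
    ∃ (v : L2 Ω) (g : L2Vec Ω) (w : L2Bdry Ω), IsTrace Ω v g w ∧
      v =ᵐ[volume.restrict Ω] f ∧ w =ᵐ[(surf d).restrict (frontier Ω)] f := by
  have i1 : IsFiniteMeasure (volume.restrict Ω) := ⟨by
    rw [Measure.restrict_apply_univ]; exact hb.measure_lt_top⟩
  have i2 : IsFiniteMeasure ((surf d).restrict (frontier Ω)) := ⟨by
    rwa [Measure.restrict_apply_univ]⟩
  have hv : MemLp f 2 (volume.restrict Ω) := memLp_restrict_of_continuous hb hf.continuous
  have hg : MemLp (gradient f) 2 (volume.restrict Ω) :=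
    MemLp.of_bound (measurable_gradient f).aestronglyMeasurable K
      (Eventually.of_forall (norm_gradient_le_of_lipschitzWith hf))
  have hw : MemLp f 2 ((surf d).restrict (frontier Ω)) := by
    obtain ⟨C, hC⟩ := (hb.isCompact_closure.of_isClosed_subset isClosed_frontier
      frontier_subset_closure).exists_bound_of_continuousOn hf.continuous.continuousOn
    exact MemLp.of_bound hf.continuous.aestronglyMeasurable C
      ((ae_restrict_mem isClosed_frontier.measurableSet).mono fun x hx => hC x hx)
  obtain ⟨φ, hφ, hφK, hφf, hφg⟩ := exists_smooth_approx hf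
  have hunif : ∀ μ : Measure (E d), IsFiniteMeasure μ →
      Tendsto (fun n => eLpNorm (fun x => φ n x - f x) 2 μ) atTop (𝓝 0) := by
    intro μ hμ
    have h1 : Tendsto (fun n : ℕ => μ univ ^ (2 : ℝ≥0∞).toReal⁻¹ *
        ENNReal.ofReal (K * (1 / ((n : ℝ) + 1)))) atTop (𝓝 0) := by
      have h2 : Tendsto (fun n : ℕ => ENNReal.ofReal (K * (1 / ((n : ℝ) + 1)))) atTop (𝓝 0) := by
        have := (tendsto_one_div_add_atTop_nhds_zero_nat (𝕜 := ℝ)).const_mul (K : ℝ)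
        rw [mul_zero] at this
        simpa using ENNReal.tendsto_ofReal this
      have := ENNReal.Tendsto.const_mul (a := μ univ ^ (2 : ℝ≥0∞).toReal⁻¹) h2
        (Or.inr (by finiteness))
      rwa [mul_zero] at this
    exact tendsto_of_tendsto_of_tendsto_of_le_of_le tendsto_const_nhds h1 (fun n => zero_le)
      fun n => eLpNorm_le_of_ae_bound (Eventually.of_forall (hφf n))
  refine ⟨hv.toLp f, hg.toLp _, hw.toLp f, ⟨φ, hφ, ?_, ?_, ?_⟩, hv.coeFn_toLp, hw.coeFn_toLp⟩
  · refine (hunif _ i1).congr fun n => eLpNorm_congr_ae ?_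
    filter_upwards [hv.coeFn_toLp] with x hx
    rw [hx]
  · have h1 : Tendsto (fun n => sqInt (volume.restrict Ω)
        (fun x => gradient (φ n) x - gradient f x)) atTop (𝓝 0) := by
      have h2 := tendsto_lintegral_of_dominated_convergence (μ := volume.restrict Ω)
        (F := fun n x => ‖gradient (φ n) x - gradient f x‖ₑ ^ 2) (f := fun _ => 0)
        (fun _ => ENNReal.ofReal (2 * K) ^ 2)
        (fun n => (((measurable_gradient _).sub (measurable_gradient _)).enorm).pow_const 2)
        (fun n => Eventually.of_forall fun x => ?_) ?_ ?_
      · simpa [sqInt] using h2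
      · refine pow_le_pow_left' ?_ 2
        rw [← ofReal_norm]
        refine ENNReal.ofReal_le_ofReal ((norm_sub_le _ _).trans ?_)
        linarith [norm_gradient_le_of_lipschitzWith (hφK n) x,
          norm_gradient_le_of_lipschitzWith hf x]
      · rw [lintegral_const]; finiteness
      · filter_upwards [ha] with x ⟨A, hA⟩
        refine tendsto_const_nhds.congr' ?_
        filter_upwards [hφg x A hA] with n hn
        simp [hn]
    have h3 : Tendsto (fun n => eLpNorm (fun x => gradient (φ n) x - gradient f x) 2
        (volume.restrict Ω)) atTop (𝓝 0) := by
      simp_rw [eLpNorm_two_eq_sqInt]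
      have := (ENNReal.continuous_rpow_const (y := 1 / 2)).tendsto 0 |>.comp h1
      rwa [ENNReal.zero_rpow_of_pos (by norm_num)] at this
    refine h3.congr fun n => eLpNorm_congr_ae ?_
    filter_upwards [hg.coeFn_toLp] with x hx
    rw [hx]
  · refine (hunif _ i2).congr fun n => eLpNorm_congr_ae ?_
    filter_upwards [hw.coeFn_toLp] with x hx
    rw [hx]

end

section

/-! ### Continuous piecewise affine functions -/

/-- A function on a convex set which is Lipschitz on each set of a finite closed cover is
Lipschitz. -/
theorem lipschitzOnWith_of_finite_cover {ι : Type*} {I : Set ι} (hI : I.Finite)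
    {A : ι → Set (E d)} (hA : ∀ i ∈ I, IsClosed (A i)) {S : Set (E d)} (hS : Convex ℝ S)
    (hcov : ∀ x ∈ S, ∃ i ∈ I, x ∈ A i) {f : E d → ℝ} {g : ι → E d → ℝ} {K : NNReal}
    (hg : ∀ i ∈ I, LipschitzWith K (g i)) (hfg : ∀ i ∈ I, ∀ x ∈ A i, f x = g i x) :
    LipschitzOnWith K f S := by
  refine LipschitzOnWith.of_dist_le_mul fun x hx y hy => ?_
  set γ : ℝ → E d := fun t => x + t • (y - x) with hγ
  have hγc : Continuous γ := by fun_prop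
  have hγS : ∀ t ∈ Icc (0 : ℝ) 1, γ t ∈ S := fun t ht => hS.add_smul_sub_mem hx hy ht
  have hγd : ∀ s t, dist (γ s) (γ t) = |s - t| * dist x y := fun s t => by
    rw [dist_eq_norm, dist_eq_norm' x y, ← Real.norm_eq_abs, ← norm_smul]
    congr 1; simp only [hγ]; module
  set P : Set ℝ := {t | |f (γ t) - f x| ≤ K * (t * dist x y)} with hP
  have hclosed : IsClosed (P ∩ Icc 0 1) := by
    have heq : P ∩ Icc 0 1 = ⋃ i ∈ I,
        ((γ ⁻¹' (A i) ∩ {t | |g i (γ t) - f x| ≤ K * (t * dist x y)}) ∩ Icc 0 1) := by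
      ext t
      simp only [mem_iUnion, exists_prop]
      constructor
      · rintro ⟨h1, h2⟩
        obtain ⟨i, hi, hti⟩ := hcov _ (hγS t h2)
        refine ⟨i, hi, ⟨hti, ?_⟩, h2⟩
        rw [mem_ofPred_eq, ← hfg i hi _ hti]; exact h1
      · rintro ⟨i, hi, ⟨hti, h1⟩, h2⟩
        refine ⟨?_, h2⟩
        rw [hP, mem_ofPred_eq, hfg i hi _ hti]; exact h1
    rw [heq]
    refine hI.isClosed_biUnion fun i hi => (((hA i hi).preimage hγc).inter ?_).inter isClosed_Icc
    exact isClosed_le ((((hg i hi).continuous.comp hγc).sub continuous_const).abs) (by fun_prop)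
  -- Continuous induction along the segment. Points just after `t` fall frequently into one of the
  -- finitely many sets, which is closed and so contains `γ t` as well; the Lipschitz bound on that
  -- set carries the estimate beyond `t`.
  have hsub := hclosed.Icc_subset_of_forall_exists_gt (a := 0) (b := 1)
    (by simp [hP, hγ]) (fun t ht z hz => by
      obtain ⟨i, hi, hfreq⟩ : ∃ i ∈ I, ∃ᶠ r in 𝓝[>] t, γ r ∈ A i := by
        by_contra hcon
        push Not at hcon
        have h1 := (eventually_all_finite hI).2 hcon
        have h2 : ∀ᶠ r in 𝓝[>] t, r ∈ Ioc t 1 := Ioc_mem_nhdsGT ht.2.2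
        obtain ⟨r, hr1, hr2⟩ := (h1.and h2).exists
        obtain ⟨i, hi, hri⟩ := hcov _ (hγS r ⟨ht.2.1.trans hr2.1.le, hr2.2⟩)
        exact hr1 i hi hri
      have hti : γ t ∈ A i := (hA i hi).mem_of_frequently_of_tendsto hfreq
        (hγc.continuousAt.tendsto.mono_left nhdsWithin_le_nhds)
      have h2 : ∀ᶠ r in 𝓝[>] t, r ∈ Ioc t z := Ioc_mem_nhdsGT hz
      obtain ⟨r, hr1, hr2⟩ := (hfreq.and_eventually h2).exists
      refine ⟨r, ?_, hr2⟩
      have h3 := (hg i hi).dist_le_mul (γ r) (γ t)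
      rw [hγd, Real.dist_eq, abs_of_pos (sub_pos.2 hr2.1), ← hfg i hi _ hr1,
        ← hfg i hi _ hti] at h3
      have h4 := ht.1
      rw [hP, mem_ofPred_eq] at h4 ⊢
      calc |f (γ r) - f x| ≤ |f (γ r) - f (γ t)| + |f (γ t) - f x| := abs_sub_le _ _ _
        _ ≤ K * ((r - t) * dist x y) + K * (t * dist x y) := add_le_add h3 h4
        _ = K * (r * dist x y) := by ring)
  have h1 := hsub (right_mem_Icc.2 zero_le_one)
  simp only [hP, hγ, mem_ofPred_eq, one_smul, one_mul, add_sub_cancel] at h1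
  rwa [dist_comm, Real.dist_eq]

theorem exists_mvPolynomial_of_affine (A : E d →ᵃ[ℝ] ℝ) :
    ∃ p : MvPolynomial (Fin d) ℝ, p.totalDegree ≤ 1 ∧
      ∀ x : E d, A x = MvPolynomial.eval (fun i => x i) p := by
  refine ⟨MvPolynomial.C (A 0) + ∑ i, MvPolynomial.C (A.linear (EuclideanSpace.single i 1)) *
    MvPolynomial.X i, ?_, fun x => ?_⟩
  · refine (MvPolynomial.totalDegree_add _ _).trans (max_le (by simp) ?_)
    refine MvPolynomial.totalDegree_finsetSum_le fun i _ => ?_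
    refine (MvPolynomial.totalDegree_mul _ _).trans ?_
    simp
  · have h1 := congrFun A.decomp x
    simp only [Pi.add_apply] at h1
    have h2 : x = ∑ i, x i • EuclideanSpace.single i (1 : ℝ) := by
      ext j
      simp [Finset.sum_apply, Pi.single_apply]
    rw [h1]
    conv_lhs => rw [h2, map_sum]
    simp only [map_smul, smul_eq_mul, map_add, MvPolynomial.eval_C, map_sum, map_mul,
      MvPolynomial.eval_X]
    rw [add_comm]
    congr 1
    exact Finset.sum_congr rfl fun i _ => mul_comm _ _

open Classical in
/-- The continuous piecewise affine function with values `c p` at the vertices `p` of the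
triangulation. -/
def pwAffine (K : Geometry.SimplicialComplex ℝ (E d)) (c : E d → ℝ) (x : E d) : ℝ :=
  if h : ∃ s ∈ elements K, x ∈ convexHull ℝ (s : Set (E d)) then affineInterp h.choose c x else 0

variable {K : Geometry.SimplicialComplex ℝ (E d)} {Ω Γ : Set (E d)}

theorem pwAffine_eq (c : E d → ℝ) {s : Finset (E d)} (hs : s ∈ elements K) {x : E d}
    (hx : x ∈ convexHull ℝ (s : Set (E d))) : pwAffine K c x = affineInterp s c x := by
  have h : ∃ s ∈ elements K, x ∈ convexHull ℝ (s : Set (E d)) := ⟨s, hs, hx⟩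
  rw [pwAffine, dif_pos h]
  exact affineInterp_eq_of_mem h.choose_spec.1 hs c h.choose_spec.2 hx

theorem exists_lipschitzOnWith_pwAffine (hK : IsTriangulation K Ω) (hc : Convex ℝ Ω)
    (ho : IsOpen Ω) (c : E d → ℝ) :
    ∃ L : NNReal, LipschitzOnWith L (pwAffine K c) (closure Ω) := by
  have h1 : ∀ s : Finset (E d), ∃ L : NNReal, LipschitzWith L (affineInterp s c) :=
    fun s => (affineInterp s c).lipschitzWith_of_finiteDimensional
  choose L hL using h1
  refine ⟨hK.finite_elements.toFinset.sup L, lipschitzOnWith_of_finite_cover hK.finite_elements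
    (A := fun s => convexHull ℝ (s : Set (E d))) (g := fun s => affineInterp s c)
    (fun s _ => (isCompact_convexHull_finset s).isClosed) hc.closure
    (fun x hx => hK.exists_mem ho hx) (fun s hs => (hL s).weaken ?_)
    (fun s hs x hx => pwAffine_eq c hs hx)⟩
  exact Finset.le_sup (f := L) (hK.finite_elements.mem_toFinset.2 hs)

/-- Piecewise affine functions vanishing on `∂Ω \ Γ` belong to the finite element space. -/
theorem exists_mem_Xh (hd : 1 ≤ d) (hK : IsTriangulation K Ω) (hc : Convex ℝ Ω) (ho : IsOpen Ω)
    (hb : Bornology.IsBounded Ω) (hne : Ω.Nonempty) {l : ℕ} (hl : 1 ≤ l) (c : E d → ℝ)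
    (h0 : ∀ x ∈ frontier Ω, x ∉ Γ → pwAffine K c x = 0) :
    ∃ v : X Ω Γ, v ∈ Xh Ω Γ K l ∧ val v =ᵐ[volume.restrict Ω] pwAffine K c := by
  obtain ⟨L, hL⟩ := exists_lipschitzOnWith_pwAffine hK hc ho c
  -- Mollification needs a Lipschitz function on the whole space.
  obtain ⟨f, hf, hfe⟩ := hL.extend_real
  obtain ⟨v, g, w, htr, hvf, hwf⟩ := exists_isTrace_of_lipschitzWith hb
    (surf_frontier_lt_top hd hK hc ho hne) hf (by
      filter_upwards [ae_mem_interior hK ho] with x ⟨s, hs, hx⟩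
      refine ⟨affineInterp s c, ?_⟩
      filter_upwards [isOpen_interior.mem_nhds hx] with y hy
      rw [← hfe (hK.convexHull_subset hs (interior_subset hy)),
        pwAffine_eq c hs (interior_subset hy)])
  have hvf' : v =ᵐ[volume.restrict Ω] pwAffine K c := by
    filter_upwards [hvf, ae_restrict_mem ho.measurableSet] with x hx hxΩ
    rw [hx, hfe (subset_closure hxΩ)]
  have hmem : ((v, g, w) : L2 Ω × L2Vec Ω × L2Bdry Ω) ∈ X Ω Γ := by
    refine ⟨htr.isWeakGradient hb, htr, ?_⟩
    filter_upwards [hwf, ae_restrict_mem isClosed_frontier.measurableSet] with x hx hxf hxΓ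
    rw [hx, ← hfe (frontier_subset_closure hxf), h0 x hxf hxΓ]
  refine ⟨⟨_, hmem⟩, ⟨pwAffine K c, ⟨hL.continuousOn, fun s hs hcard => ?_⟩, hvf'⟩, hvf'⟩
  obtain ⟨p, hp, hpe⟩ := exists_mvPolynomial_of_affine (affineInterp s c)
  exact ⟨p, hp.trans hl, fun x hx => by rw [pwAffine_eq c ⟨hs, hcard⟩ hx, hpe]⟩

end

section

/-! ### Polynomials and the inverse inequality -/

theorem setLIntegral_ball_comp_affine (x : E d) {h : ℝ} (hh : 0 < h) (r : ℝ) {F : E d → ℝ≥0∞}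
    (hF : Measurable F) : ∫⁻ y in Metric.ball x (h * r), F y =
      ENNReal.ofReal (h ^ d) * ∫⁻ z in Metric.ball 0 r, F (x + h • z) := by
  have hm : Measurable fun z : E d => x + h • z := by fun_prop
  have hmap : (volume : Measure (E d)).map (fun z => x + h • z) =
      ENNReal.ofReal ((h ^ d)⁻¹) • volume := by
    have h1 : (fun z : E d => x + h • z) = (fun z => x + z) ∘ fun z => h • z := rfl
    rw [h1, ← Measure.map_map (by fun_prop) (by fun_prop), Measure.map_addHaar_smul _ hh.ne',
      Measure.map_smul, map_add_left_eq_self, finrank_euclideanSpace_fin,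
      abs_of_pos (by positivity)]
  have hpre : (fun z : E d => x + h • z) ⁻¹' Metric.ball x (h * r) = Metric.ball 0 r := by
    ext z
    simp only [mem_preimage, Metric.mem_ball, dist_eq_norm, add_sub_cancel_left, norm_smul,
      Real.norm_of_nonneg hh.le, sub_zero]
    exact mul_lt_mul_iff_right₀ hh
  have h2 : ∫⁻ z in Metric.ball 0 r, F (x + h • z) =
      ∫⁻ y in Metric.ball x (h * r), F y ∂((volume : Measure (E d)).map (fun z => x + h • z)) := by
    rw [setLIntegral_map Metric.isOpen_ball.measurableSet hF hm, hpre]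
  rw [h2, hmap, Measure.restrict_smul, lintegral_smul_measure, smul_eq_mul, ← mul_assoc,
    ← ENNReal.ofReal_mul (by positivity), mul_inv_cancel₀ (by positivity), ENNReal.ofReal_one,
    one_mul]

/-- Evaluation of polynomials, as a linear map. -/
def polyEval (d : ℕ) : MvPolynomial (Fin d) ℝ →ₗ[ℝ] (E d → ℝ) where
  toFun p x := MvPolynomial.eval (fun i => x i) p
  map_add' p q := by funext x; simp
  map_smul' c p := by funext x; simp

/-- The polynomial functions of total degree at most `l`. -/
def polyFun (d l : ℕ) : Submodule ℝ (E d → ℝ) :=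
  (MvPolynomial.restrictTotalDegree (Fin d) ℝ l).map (polyEval d)

instance (d l : ℕ) : Module.Finite ℝ (polyFun d l) :=
  Module.Finite.map (MvPolynomial.restrictTotalDegree (Fin d) ℝ l) (polyEval d)

theorem mem_polyFun {l : ℕ} {q : E d → ℝ} : q ∈ polyFun d l ↔
    ∃ p : MvPolynomial (Fin d) ℝ, p.totalDegree ≤ l ∧
      ∀ x : E d, q x = MvPolynomial.eval (fun i => x i) p := by
  constructor
  · rintro ⟨p, hp, rfl⟩
    exact ⟨p, (MvPolynomial.mem_restrictTotalDegree _ _ _).1 hp, fun x => rfl⟩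
  · rintro ⟨p, hp, h⟩
    exact ⟨p, (MvPolynomial.mem_restrictTotalDegree _ _ _).2 hp, funext fun x => (h x).symm⟩

theorem contDiff_of_mem_polyFun {l : ℕ} {q : E d → ℝ} (hq : q ∈ polyFun d l) :
    ContDiff ℝ ∞ q := by
  obtain ⟨p, -, h⟩ := mem_polyFun.1 hq
  have h1 : q = fun x : E d => ∑ m ∈ p.support, p.coeff m * ∏ i, x i ^ m i := by
    funext x; rw [h, MvPolynomial.eval_eq']
  rw [h1]
  refine ContDiff.sum fun m _ => contDiff_const.mul (contDiff_prod fun i _ => ?_)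
  have : ContDiff ℝ ∞ fun x : E d => x i := by fun_prop
  exact this.pow _

theorem const_mem_polyFun (l : ℕ) (c : ℝ) : (fun _ : E d => c) ∈ polyFun d l :=
  mem_polyFun.2 ⟨MvPolynomial.C c, by simp, fun x => by simp⟩

theorem comp_affine_mem_polyFun {l : ℕ} {q : E d → ℝ} (hq : q ∈ polyFun d l) (x : E d) (h : ℝ) :
    (fun y => q (x + h • y)) ∈ polyFun d l := by
  obtain ⟨p, hp, hpe⟩ := mem_polyFun.1 hq
  refine mem_polyFun.2 ⟨∑ m ∈ p.support, MvPolynomial.C (p.coeff m) *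
    ∏ i, (MvPolynomial.C (x i) + MvPolynomial.C h * MvPolynomial.X i) ^ m i, ?_, fun y => ?_⟩
  · refine MvPolynomial.totalDegree_finsetSum_le fun m hm => ?_
    refine (MvPolynomial.totalDegree_mul _ _).trans ?_
    rw [MvPolynomial.totalDegree_C, zero_add]
    refine (MvPolynomial.totalDegree_finsetProd _ _).trans ?_
    have h1 : ∀ i ∈ Finset.univ, ((MvPolynomial.C (x i) + MvPolynomial.C h *
        MvPolynomial.X i : MvPolynomial (Fin d) ℝ) ^ m i).totalDegree ≤ m i := fun i _ => by
      refine (MvPolynomial.totalDegree_pow _ _).trans ?_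
      have h2 : (MvPolynomial.C (x i) + MvPolynomial.C h *
        MvPolynomial.X i : MvPolynomial (Fin d) ℝ).totalDegree ≤ 1 := by
        refine (MvPolynomial.totalDegree_add _ _).trans (max_le (by simp) ?_)
        refine (MvPolynomial.totalDegree_mul _ _).trans ?_
        simp
      calc _ ≤ m i * 1 := Nat.mul_le_mul_left _ h2
        _ = m i := mul_one _
    refine (Finset.sum_le_sum h1).trans (le_trans ?_ hp)
    have h3 := MvPolynomial.le_totalDegree hm
    rwa [Finsupp.sum_fintype _ _ (fun _ => rfl)] at h3
  · rw [hpe, MvPolynomial.eval_eq', map_sum]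
    refine Finset.sum_congr rfl fun m _ => ?_
    simp [map_prod]

theorem eq_zero_of_mem_polyFun {l : ℕ} {q : E d → ℝ} (hq : q ∈ polyFun d l) {r : ℝ} (hr : 0 < r)
    (h : ∀ x ∈ Metric.ball (0 : E d) r, q x = 0) : q = 0 := by
  obtain ⟨p, -, hpe⟩ := mem_polyFun.1 hq
  have hp : p = 0 := by
    obtain ⟨ε, hε, hsub⟩ : ∃ ε > 0, ∀ y : Fin d → ℝ, (∀ i, y i ∈ Ioo (-ε) ε) →
        WithLp.toLp 2 y ∈ Metric.ball (0 : E d) r := by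
      have hc : Continuous fun y : Fin d → ℝ => (WithLp.toLp 2 y : E d) := by fun_prop
      have h0 : (fun y : Fin d → ℝ => (WithLp.toLp 2 y : E d)) ⁻¹' Metric.ball 0 r ∈ 𝓝 0 :=
        (Metric.isOpen_ball.preimage hc).mem_nhds (by simpa using hr)
      obtain ⟨ε, hε, h1⟩ := Metric.mem_nhds_iff.1 h0
      refine ⟨ε, hε, fun y hy => h1 ?_⟩
      rw [mem_ball_zero_iff, pi_norm_lt_iff hε]
      exact fun i => abs_lt.2 (hy i)
    refine MvPolynomial.funext_set (fun _ => Ioo (-ε) ε)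
      (fun _ => (Ioo_infinite (by linarith))) fun y hy => ?_
    have h1 := h _ (hsub y fun i => hy i (mem_univ i))
    rw [hpe] at h1
    rw [map_zero]
    exact h1
  funext x
  rw [hpe, hp, map_zero]
  rfl

theorem gradient_comp_affine {q : E d → ℝ} (hq : ContDiff ℝ ∞ q) (x : E d) (h : ℝ) (z : E d) :
    gradient (fun y => q (x + h • y)) z = h • gradient q (x + h • z) := by
  have h1 : HasFDerivAt (fun y : E d => x + h • y) (h • ContinuousLinearMap.id ℝ (E d)) z :=
    ((hasFDerivAt_id z).const_smul h).const_add x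
  have h2 := ((hq.differentiable (by simp)) (x + h • z)).hasFDerivAt.comp z h1
  have h3 : fderiv ℝ (fun y => q (x + h • y)) z = h • fderiv ℝ q (x + h • z) := by
    rw [show (fun y => q (x + h • y)) = q ∘ fun y => x + h • y from rfl, h2.fderiv]
    ext w
    simp
  rw [gradient, h3, map_smul]; rfl

/-- The map `G` composed with the inverse of `L` on its range has a finite-dimensional source, hence
is continuous; no norm on `V` is needed. -/
theorem exists_norm_le_of_injective {V A B : Type*} [AddCommGroup V] [Module ℝ V]
    [Module.Finite ℝ V] [NormedAddCommGroup A] [NormedSpace ℝ A] [NormedAddCommGroup B]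
    [NormedSpace ℝ B] (L : V →ₗ[ℝ] A) (hL : Function.Injective L) (G : V →ₗ[ℝ] B) :
    ∃ C : ℝ≥0∞, C ≠ ⊤ ∧ ∀ v, ‖G v‖ₑ ≤ C * ‖L v‖ₑ := by
  let e := LinearEquiv.ofInjective L hL
  let T := LinearMap.toContinuousLinearMap (G ∘ₗ e.symm.toLinearMap)
  refine ⟨‖T‖ₑ, by finiteness, fun v => ?_⟩
  have h1 : G v = T (e v) := by
    simp only [T, LinearMap.coe_toContinuousLinearMap', LinearMap.comp_apply,
      LinearEquiv.coe_coe, LinearEquiv.symm_apply_apply]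
  rw [h1]
  exact T.le_opENorm _

theorem memLp_ball_of_mem_polyFun {l : ℕ} (q : polyFun d l) (r : ℝ) :
    MemLp (q : E d → ℝ) 2 (volume.restrict (Metric.ball (0 : E d) r)) :=
  memLp_restrict_of_continuous Metric.isBounded_ball (contDiff_of_mem_polyFun q.2).continuous

theorem memLp_ball_gradient_of_mem_polyFun {l : ℕ} (q : polyFun d l) (r : ℝ) :
    MemLp (gradient (q : E d → ℝ)) 2 (volume.restrict (Metric.ball (0 : E d) r)) :=
  memLp_restrict_of_continuous Metric.isBounded_ball
    (continuous_gradient (contDiff_of_mem_polyFun q.2))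

/-- A polynomial as an element of `L²` of a ball. -/
def polyToL2 (d l : ℕ) (r : ℝ) :
    polyFun d l →ₗ[ℝ] Lp ℝ 2 (volume.restrict (Metric.ball (0 : E d) r)) where
  toFun q := (memLp_ball_of_mem_polyFun q r).toLp _
  map_add' q q' := (memLp_ball_of_mem_polyFun q r).toLp_add (memLp_ball_of_mem_polyFun q' r)
  map_smul' c q := (memLp_ball_of_mem_polyFun q r).toLp_const_smul c

/-- The gradient of a polynomial as an element of `L²` of a ball. -/
def polyGradToL2 (d l : ℕ) (r : ℝ) :
    polyFun d l →ₗ[ℝ] Lp (E d) 2 (volume.restrict (Metric.ball (0 : E d) r)) where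
  toFun q := (memLp_ball_gradient_of_mem_polyFun q r).toLp _
  map_add' q q' := by
    rw [← (memLp_ball_gradient_of_mem_polyFun q r).toLp_add
      (memLp_ball_gradient_of_mem_polyFun q' r)]
    refine MemLp.toLp_congr _ _ (Eventually.of_forall fun x => ?_)
    exact gradient_add' (contDiff_of_mem_polyFun q.2) (contDiff_of_mem_polyFun q'.2) x
  map_smul' c q := by
    rw [RingHom.id_apply, ← (memLp_ball_gradient_of_mem_polyFun q r).toLp_const_smul c]
    refine MemLp.toLp_congr _ _ (Eventually.of_forall fun x => ?_)
    exact gradient_smul' (contDiff_of_mem_polyFun q.2) c x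

theorem polyToL2_injective (d l : ℕ) {r : ℝ} (hr : 0 < r) :
    Function.Injective (polyToL2 d l r) := by
  rw [← LinearMap.ker_eq_bot, LinearMap.ker_eq_bot']
  intro q hq
  have h1 : (q : E d → ℝ) =ᵐ[volume.restrict (Metric.ball (0 : E d) r)] 0 :=
    ((memLp_ball_of_mem_polyFun q r).coeFn_toLp).symm.trans ((Lp.eq_zero_iff_ae_eq_zero).1 hq)
  have h2 : EqOn (q : E d → ℝ) (fun _ => 0) (Metric.ball (0 : E d) r) :=
    Measure.eqOn_open_of_ae_eq h1 Metric.isOpen_ball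
      (contDiff_of_mem_polyFun q.2).continuous.continuousOn continuousOn_const
  exact Subtype.ext (eq_zero_of_mem_polyFun q.2 hr h2)

/-- All norms being equivalent, the gradient of a polynomial on a ball is controlled by
the polynomial on a smaller ball. -/
theorem exists_sqInt_gradient_le_unit (d l : ℕ) {σ : ℝ} (hσ : 0 < σ) : ∃ C : ℝ≥0∞, C ≠ ⊤ ∧
    ∀ q ∈ polyFun d l, sqInt (volume.restrict (Metric.ball (0 : E d) 2)) (gradient q) ≤
      C * sqInt (volume.restrict (Metric.ball (0 : E d) σ)) q := by
  obtain ⟨C, hC, hCq⟩ := exists_norm_le_of_injective (polyToL2 d l σ)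
    (polyToL2_injective d l hσ) (polyGradToL2 d l 2)
  refine ⟨C ^ 2, by finiteness, fun q hq => ?_⟩
  have h2 := hCq ⟨q, hq⟩
  have h3 : ‖polyGradToL2 d l 2 ⟨q, hq⟩‖ₑ = eLpNorm (gradient q) 2
      (volume.restrict (Metric.ball (0 : E d) 2)) :=
    Lp.enorm_toLp (memLp_ball_gradient_of_mem_polyFun ⟨q, hq⟩ 2)
  have h4 : ‖polyToL2 d l σ ⟨q, hq⟩‖ₑ = eLpNorm q 2
      (volume.restrict (Metric.ball (0 : E d) σ)) :=
    Lp.enorm_toLp (memLp_ball_of_mem_polyFun ⟨q, hq⟩ σ)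
  rw [h3, h4] at h2
  rw [← eLpNorm_two_sq, ← eLpNorm_two_sq, ← mul_pow]
  exact pow_le_pow_left' h2 2

/-- The inverse inequality for polynomials. -/
theorem exists_inverse_inequality (d l : ℕ) {σ : ℝ} (hσ : 0 < σ) : ∃ C : ℝ≥0∞, C ≠ ⊤ ∧
    ∀ q ∈ polyFun d l, ∀ (x : E d) (h : ℝ), 0 < h → ∀ S : Set (E d),
      Metric.ball x (σ * h) ⊆ S → S ⊆ Metric.ball x (2 * h) →
      ENNReal.ofReal (h ^ 2) * sqInt (volume.restrict S) (gradient q) ≤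
        C * sqInt (volume.restrict S) q := by
  obtain ⟨C, hC, hCq⟩ := exists_sqInt_gradient_le_unit d l hσ
  refine ⟨C, hC, fun q hq x h hh S hS1 hS2 => ?_⟩
  have hqs := contDiff_of_mem_polyFun hq
  have h1 := hCq _ (comp_affine_mem_polyFun hq x h)
  -- Scaling to unit size turns the gradient into `h` times a gradient, which accounts for `h ^ 2`;
  -- the Jacobian `h ^ d` appears on both sides.
  have hg : ∀ z, ‖gradient (fun y => q (x + h • y)) z‖ₑ ^ 2 =
      ENNReal.ofReal (h ^ 2) * ‖gradient q (x + h • z)‖ₑ ^ 2 := fun z => by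
    rw [gradient_comp_affine hqs, enorm_smul, mul_pow, Real.enorm_eq_ofReal hh.le,
      ENNReal.ofReal_pow hh.le]
  have e1 := setLIntegral_ball_comp_affine x hh 2 (F := fun y => ‖gradient q y‖ₑ ^ 2)
    ((measurable_gradient q).enorm.pow_const 2)
  have e2 := setLIntegral_ball_comp_affine x hh σ (F := fun y => ‖q y‖ₑ ^ 2)
    (hqs.continuous.measurable.enorm.pow_const 2)
  rw [mul_comm h] at e1 e2
  have hh2 : ENNReal.ofReal (h ^ 2) ≠ ⊤ := ENNReal.ofReal_ne_top
  calc ENNReal.ofReal (h ^ 2) * sqInt (volume.restrict S) (gradient q)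
      ≤ ENNReal.ofReal (h ^ 2) * ∫⁻ y in Metric.ball x (2 * h), ‖gradient q y‖ₑ ^ 2 := by
        gcongr
        exact sqInt_mono_set hS2 _
    _ = ENNReal.ofReal (h ^ d) * sqInt (volume.restrict (Metric.ball (0 : E d) 2))
          (gradient fun y => q (x + h • y)) := by
        rw [e1, sqInt]
        simp_rw [hg]
        rw [lintegral_const_mul' _ _ hh2]
        ring
    _ ≤ ENNReal.ofReal (h ^ d) * (C * sqInt (volume.restrict (Metric.ball (0 : E d) σ))
          fun y => q (x + h • y)) := by gcongr
    _ = C * ∫⁻ y in Metric.ball x (σ * h), ‖q y‖ₑ ^ 2 := by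
        rw [e2, sqInt]; ring
    _ ≤ C * sqInt (volume.restrict S) q := by
        gcongr
        exact sqInt_mono_set hS1 _

/-! ### Gradients of finite element functions -/

variable {Ω Γ : Set (E d)}

/-- Test functions supported in `U` see only `q`. Integrating by parts there and applying the
fundamental lemma of the calculus of variations identifies the gradients. -/
theorem IsWeakGradient.ae_eq_gradient {v : L2 Ω} {g : L2Vec Ω} (hv : IsWeakGradient Ω v g)
    (ho : IsOpen Ω) (hb : Bornology.IsBounded Ω) {U : Set (E d)} (hU : IsOpen U) (hUΩ : U ⊆ Ω) {q : E d → ℝ}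
    (hq : ContDiff ℝ ∞ q) (hvq : v =ᵐ[volume.restrict U] q) :
    g =ᵐ[volume.restrict U] gradient q := by
  have hint : IntegrableOn (fun x => g x - gradient q x) U := by
    have : IsFiniteMeasure (volume.restrict Ω) := ⟨by
      rw [Measure.restrict_apply_univ]; exact hb.measure_lt_top⟩
    have h1 : MemLp (fun x => g x - gradient q x) 2 (volume.restrict Ω) :=
      (Lp.memLp g).sub (memLp_restrict_of_continuous hb (continuous_gradient hq))
    exact (h1.integrable (by norm_num)).mono_measure (Measure.restrict_mono hUΩ le_rfl)
  have h0 := hU.ae_eq_zero_of_integral_contDiff_smul_eq_zero (μ := volume)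
    (f := fun x => g x - gradient q x) hint.locallyIntegrableOn (fun φ hφ hc hs => ?_)
  · rw [EventuallyEq, ae_restrict_iff' hU.measurableSet]
    filter_upwards [h0] with x hx hxU
    exact sub_eq_zero.1 (hx hxU)
  have hφ0 : ∀ x ∉ U, φ x = 0 := fun x hx => image_eq_zero_of_notMem_tsupport fun h => hx (hs h)
  have hgφ0 : ∀ x ∉ U, gradient φ x = 0 := fun x hx => by
    have : fderiv ℝ φ x = 0 := image_eq_zero_of_notMem_tsupport
      fun h => hx (hs (tsupport_fderiv_subset ℝ h))
    rw [gradient, this, map_zero]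
  have key := hv φ hφ hc (hs.trans hUΩ)
  have e1 : ∫ x in Ω, v x • gradient φ x = ∫ x in U, v x • gradient φ x :=
    (setIntegral_eq_of_subset_of_forall_sdiff_eq_zero ho.measurableSet hUΩ
      fun x hx => by rw [hgφ0 x hx.2, smul_zero])
  have e2 : ∫ x in Ω, φ x • g x = ∫ x in U, φ x • g x :=
    (setIntegral_eq_of_subset_of_forall_sdiff_eq_zero ho.measurableSet hUΩ
      fun x hx => by rw [hφ0 x hx.2, zero_smul])
  have e3 : ∫ x in U, v x • gradient φ x = ∫ x, q x • gradient φ x := by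
    rw [← setIntegral_eq_integral_of_forall_compl_eq_zero (s := U) (f := fun x => q x • gradient φ x)
      (fun x hx => by rw [hgφ0 x hx, smul_zero])]
    refine integral_congr_ae ?_
    filter_upwards [hvq] with x hx
    rw [hx]
  have e4 : ∫ x, q x • gradient φ x = -∫ x, φ x • gradient q x :=
    integral_smul_gradient_eq_neg hq hφ hc
  have e5 : ∫ x, φ x • gradient q x = ∫ x in U, φ x • gradient q x :=
    (setIntegral_eq_integral_of_forall_compl_eq_zero
      (fun x hx => by rw [hφ0 x hx, zero_smul])).symm
  rw [← setIntegral_eq_integral_of_forall_compl_eq_zero (s := U)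
      (f := fun x => φ x • (g x - gradient q x)) (fun x hx => by rw [hφ0 x hx, zero_smul])]
  simp_rw [smul_sub]
  have i1 : IntegrableOn (fun x => φ x • g x) U :=
    (integrable_test_smul g hφ hc).mono_measure (Measure.restrict_mono hUΩ le_rfl)
  have i2 : IntegrableOn (fun x => φ x • gradient q x) U :=
    ((hφ.continuous.smul (continuous_gradient hq)).integrable_of_hasCompactSupport
      hc.smul_right).integrableOn
  rw [integral_sub i1 i2, ← e2, ← e5, sub_eq_zero]
  rw [e1, e3, e4] at key
  exact (neg_injective key).symm

end

section

/-! ### Mesh size and finite overlap -/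

/-- `m` is a mesh size for the triangulation `K`: it bounds the diameters of the elements, which
contain the balls of radius `σ m` around the points `z s`. -/
structure IsMeshSize (K : Geometry.SimplicialComplex ℝ (E d)) (σ m : ℝ) (z : Finset (E d) → E d) :
    Prop where
  pos : 0 < m
  dist_le : ∀ s ∈ elements K, ∀ x ∈ convexHull ℝ (s : Set (E d)),
    ∀ y ∈ convexHull ℝ (s : Set (E d)), dist x y ≤ m
  ball_subset : ∀ s ∈ elements K, Metric.ball (z s) (σ * m) ⊆
    interior (convexHull ℝ (s : Set (E d)))

variable {K : Geometry.SimplicialComplex ℝ (E d)} {Ω Γ : Set (E d)} {σ m : ℝ}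
  {z : Finset (E d) → E d}

/-- `m` is the largest diameter of an element, and quasi-uniformity is compared with an element
attaining it. It is positive because an element has at least two vertices when `d ≥ 1`. -/
theorem exists_isMeshSize (hd : 1 ≤ d) (hK : IsTriangulation K Ω) (hq : IsQuasiUniform σ K)
    (ho : IsOpen Ω) (hb : Bornology.IsBounded Ω) (hne : Ω.Nonempty) :
    ∃ m z, IsMeshSize K σ m z ∧ m ≤ Metric.diam Ω := by
  obtain ⟨x, hx⟩ := hne
  obtain ⟨s₀, hs₀, -⟩ := hK.exists_mem ho (subset_closure hx)
  obtain ⟨t, ht, hmax⟩ := hK.finite_elements.exists_maximalFor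
    (fun s : Finset (E d) => Metric.diam (convexHull ℝ (s : Set (E d)))) _ ⟨s₀, hs₀⟩
  set m := Metric.diam (convexHull ℝ (t : Set (E d))) with hm
  have hmax' : ∀ s ∈ elements K, Metric.diam (convexHull ℝ (s : Set (E d))) ≤ m := fun s hs => by
    by_contra hcon
    exact hcon (hmax hs (not_le.1 hcon).le)
  have hbd : ∀ s : Finset (E d), Bornology.IsBounded (convexHull ℝ (s : Set (E d))) := fun s =>
    (isCompact_convexHull_finset s).isBounded
  have hpos : 0 < m := by
    have hcard : 1 < t.card := by rw [ht.2]; omega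
    obtain ⟨p, hp, q, hq, hpq⟩ := Finset.one_lt_card.1 hcard
    exact (dist_pos.2 hpq).trans_le (Metric.dist_le_diam_of_mem (hbd t)
      (subset_convexHull ℝ _ hp) (subset_convexHull ℝ _ hq))
  have hball : ∀ s : Finset (E d), ∃ z, s ∈ elements K → Metric.ball z (σ * m) ⊆
      interior (convexHull ℝ (s : Set (E d))) := fun s => by
    by_cases hs : s ∈ elements K
    · obtain ⟨z, hz⟩ := hq s hs.1 hs.2 t ht.1 ht.2
      exact ⟨z, fun _ => interior_maximal hz Metric.isOpen_ball⟩
    · exact ⟨0, fun h => absurd h hs⟩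
  choose z hz using hball
  refine ⟨m, z, ⟨hpos, fun s hs x hx y hy => ?_, fun s hs => hz s hs⟩, ?_⟩
  · exact (Metric.dist_le_diam_of_mem (hbd s) hx hy).trans (hmax' s hs)
  · rw [← Metric.diam_closure (s := Ω)]
    exact Metric.diam_mono (hK.convexHull_subset ht) hb.closure

theorem IsMeshSize.center_mem (h : IsMeshSize K σ m z) (hσ : 0 < σ) {s : Finset (E d)}
    (hs : s ∈ elements K) : z s ∈ convexHull ℝ (s : Set (E d)) :=
  interior_subset (h.ball_subset s hs (Metric.mem_ball_self (mul_pos hσ h.pos)))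

theorem IsMeshSize.disjoint_balls (h : IsMeshSize K σ m z) {s t : Finset (E d)}
    (hs : s ∈ elements K) (ht : t ∈ elements K) (hst : s ≠ t) :
    Disjoint (Metric.ball (z s) (σ * m)) (Metric.ball (z t) (σ * m)) := by
  rw [disjoint_iff_inter_eq_empty, eq_empty_iff_forall_notMem]
  rintro x ⟨hxs, hxt⟩
  have := interior_inter_convexHull_eq_empty hs ht hst
  rw [eq_empty_iff_forall_notMem] at this
  exact this x ⟨h.ball_subset s hs hxs, interior_subset (h.ball_subset t ht hxt)⟩

/-- A point lies in boundedly many dilations of disjoint balls of the same radius. -/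
theorem card_le_of_disjoint_balls {ι : Type*} (I : Finset ι) (z : ι → E d) {r R : ℝ} (hr : 0 < r)
    (hR : 0 ≤ R) (hd : (I : Set ι).PairwiseDisjoint fun i => Metric.ball (z i) r) (y : E d)
    (hy : ∀ i ∈ I, y ∈ Metric.closedBall (z i) R) (hd1 : 1 ≤ d) :
    (I.card : ℝ≥0∞) ≤ ENNReal.ofReal (((R + r) / r) ^ d) := by
  have : Nonempty (Fin d) := ⟨⟨0, hd1⟩⟩
  have hnt : Nontrivial (E d) := inferInstance
  -- The disjoint balls of radius `r` all lie in the ball of radius `R + r` about `y`; comparing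
  -- volumes bounds their number.
  have h1 : volume (⋃ i ∈ I, Metric.ball (z i) r) ≤ volume (Metric.ball y (R + r)) := by
    refine measure_mono (iUnion₂_subset fun i hi x hx => ?_)
    have h2 := hy i hi
    rw [Metric.mem_closedBall, dist_comm] at h2
    rw [Metric.mem_ball] at hx ⊢
    linarith [dist_triangle x (z i) y]
  rw [measure_biUnion_finset hd fun i _ => Metric.isOpen_ball.measurableSet] at h1
  rw [Finset.sum_congr rfl fun i _ => volume_ball_eq (z i) hr.le,
    volume_ball_eq y (by positivity), Finset.sum_const, nsmul_eq_mul, ← mul_assoc] at h1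
  have hV : volume (Metric.ball (0 : E d) 1) ≠ 0 :=
    (Metric.measure_ball_pos volume _ one_pos).ne'
  have hV' : volume (Metric.ball (0 : E d) 1) ≠ ⊤ := measure_ball_lt_top.ne
  have h3 := (ENNReal.mul_le_mul_iff_left hV hV').1 h1
  have hrd : ENNReal.ofReal (r ^ d) ≠ 0 := by
    rw [Ne, ENNReal.ofReal_eq_zero, not_le]; positivity
  rw [div_pow, ENNReal.ofReal_div_of_pos (by positivity),
    ENNReal.le_div_iff_mul_le (Or.inl hrd) (Or.inl ENNReal.ofReal_ne_top)]
  exact h3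

theorem sum_sqInt_closedBall_le {F ι : Type*} [NormedAddCommGroup F] (I : Finset ι) (z : ι → E d)
    {r R : ℝ} (hr : 0 < r) (hR : 0 ≤ R)
    (hd : (I : Set ι).PairwiseDisjoint fun i => Metric.ball (z i) r) (hd1 : 1 ≤ d)
    {g : E d → F} (hg : AEStronglyMeasurable g (volume.restrict Ω)) :
    ∑ i ∈ I, sqInt (volume.restrict (Ω ∩ Metric.closedBall (z i) R)) g ≤
      ENNReal.ofReal (((R + r) / r) ^ d) * sqInt (volume.restrict Ω) g := by
  classical
  have h1 : ∀ i, sqInt (volume.restrict (Ω ∩ Metric.closedBall (z i) R)) g =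
      ∫⁻ x in Ω, (Metric.closedBall (z i) R).indicator (fun x => ‖g x‖ₑ ^ 2) x := fun i => by
    rw [lintegral_indicator Metric.isClosed_closedBall.measurableSet,
      Measure.restrict_restrict Metric.isClosed_closedBall.measurableSet, inter_comm]
    rfl
  simp_rw [h1]
  rw [← lintegral_finsetSum' _ fun i _ =>
    ((hg.enorm.pow_const 2).indicator Metric.isClosed_closedBall.measurableSet), sqInt,
    ← lintegral_const_mul' _ _ ENNReal.ofReal_ne_top]
  refine lintegral_mono fun y => ?_
  simp only [indicator_apply]
  rw [← Finset.sum_filter, Finset.sum_const, nsmul_eq_mul]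
  gcongr
  exact card_le_of_disjoint_balls _ z hr hR
    (hd.subset (Finset.coe_subset.2 (Finset.filter_subset _ _))) y (fun i hi => (Finset.mem_filter.1 hi).2) hd1

/-- The balls of radius `σ * m` inside the elements are disjoint, and `m` cancels from the overlap
bound, which is therefore independent of the mesh. -/
theorem IsMeshSize.sum_sqInt_le {F : Type*} [NormedAddCommGroup F] (h : IsMeshSize K σ m z)
    (hσ : 0 < σ) (hd : 1 ≤ d) (I : Finset (Finset (E d))) (hI : ∀ s ∈ I, s ∈ elements K)
    {R : ℝ} (hR : 0 ≤ R) {g : E d → F} (hg : AEStronglyMeasurable g (volume.restrict Ω)) :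
    ∑ s ∈ I, sqInt (volume.restrict (Ω ∩ Metric.closedBall (z s) (R * m))) g ≤
      ENNReal.ofReal (((R + σ) / σ) ^ d) * sqInt (volume.restrict Ω) g := by
  have h1 := sum_sqInt_closedBall_le I z (mul_pos hσ h.pos) (mul_nonneg hR h.pos.le)
    (fun s hs t ht hst => h.disjoint_balls (hI s hs) (hI t ht) hst) hd hg
  rwa [← add_mul, mul_div_mul_right _ _ h.pos.ne'] at h1

theorem sqInt_le_sum_interior {F : Type*} [NormedAddCommGroup F] (hK : IsTriangulation K Ω)
    (ho : IsOpen Ω) (g : E d → F) : sqInt (volume.restrict Ω) g ≤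
      ∑ s ∈ hK.finite_elements.toFinset,
        sqInt (volume.restrict (interior (convexHull ℝ (s : Set (E d))))) g := by
  have h1 : Ω ≤ᵐ[volume]
      ⋃ s ∈ hK.finite_elements.toFinset, interior (convexHull ℝ (s : Set (E d))) := by
    have := (ae_restrict_iff' ho.measurableSet).1 (ae_mem_interior hK ho)
    filter_upwards [this] with x hx hxΩ
    obtain ⟨s, hs, hxs⟩ := hx hxΩ
    exact mem_biUnion (hK.finite_elements.mem_toFinset.2 hs) hxs
  refine (sqInt_mono_measure (Measure.restrict_mono_ae h1) g).trans ?_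
  rw [sqInt, ← Finset.sum_coe_sort, ← tsum_fintype (L := .unconditional _)]
  have h2 : (⋃ s ∈ hK.finite_elements.toFinset, interior (convexHull ℝ (s : Set (E d)))) =
      ⋃ s : hK.finite_elements.toFinset,
        interior (convexHull ℝ ((s : Finset (E d)) : Set (E d))) :=
    biUnion_eq_iUnion (hK.finite_elements.toFinset : Set (Finset (E d)))
      fun s _ => interior (convexHull ℝ (s : Set (E d)))
  rw [h2]
  exact lintegral_iUnion_le _ _

end

section

/-! ### The inverse inequality on the finite element space, and quasi-interpolation -/

variable {K : Geometry.SimplicialComplex ℝ (E d)} {Ω Γ : Set (E d)} {σ m : ℝ}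
  {z : Finset (E d) → E d} {a : E d} {b : ℝ}

theorem IsMeshSize.subset_closedBall (h : IsMeshSize K σ m z) {s : Finset (E d)}
    (hs : s ∈ elements K) {x : E d} (hx : x ∈ convexHull ℝ (s : Set (E d))) :
    convexHull ℝ (s : Set (E d)) ⊆ Metric.closedBall x m :=
  fun y hy => h.dist_le s hs y hy x hx

/-- The local inverse inequality for finite element functions. -/
theorem exists_local_inverse (d l : ℕ) (hσ : 0 < σ) : ∃ C : ℝ≥0∞, C ≠ ⊤ ∧
    ∀ (Ω Γ : Set (E d)), Convex ℝ Ω → IsOpen Ω → Bornology.IsBounded Ω → Ω.Nonempty →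
    ∀ (K : Geometry.SimplicialComplex ℝ (E d)) (m : ℝ) (z : Finset (E d) → E d),
    IsTriangulation K Ω → IsMeshSize K σ m z →
    ∀ v ∈ Xh Ω Γ K l, ∀ s ∈ elements K, ∀ c : ℝ,
      ENNReal.ofReal (m ^ 2) *
          sqInt (volume.restrict (interior (convexHull ℝ (s : Set (E d))))) (grad v) ≤
        C * sqInt (volume.restrict (interior (convexHull ℝ (s : Set (E d)))))
          (fun x => val v x - c) := by
  obtain ⟨C, hC, hinv⟩ := exists_inverse_inequality d l hσ
  refine ⟨C, hC, fun Ω Γ hc ho hb hne K m z hK hm v hv s hs c => ?_⟩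
  obtain ⟨f, ⟨-, hf⟩, hvf⟩ := hv
  obtain ⟨p, hp, hfp⟩ := hf s hs.1 hs.2
  set S := interior (convexHull ℝ (s : Set (E d))) with hS
  have hSΩ : S ⊆ Ω := hK.interior_subset hc ho hne hs
  have hq : polyEval d p ∈ polyFun d l := mem_polyFun.2 ⟨p, hp, fun x => rfl⟩
  have hvq : val v =ᵐ[volume.restrict S] polyEval d p := by
    filter_upwards [ae_restrict_of_ae_restrict_of_subset hSΩ hvf,
      ae_restrict_mem isOpen_interior.measurableSet] with x hx hxS
    rw [hx, hfp x (interior_subset hxS)]; rfl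
  have hg := v.2.1.ae_eq_gradient ho hb isOpen_interior hSΩ (contDiff_of_mem_polyFun hq) hvq
  -- Subtracting a constant leaves the gradient unchanged, so the gradient is bounded by the
  -- deviation of the function from any chosen constant.
  have hq' : (polyEval d p - fun _ => c) ∈ polyFun d l := sub_mem hq (const_mem_polyFun l c)
  have h1 := hinv _ hq' (z s) m hm.pos S (hm.ball_subset s hs)
    ((interior_subset.trans (hm.subset_closedBall hs (hm.center_mem hσ hs))).trans
      (Metric.closedBall_subset_ball (by linarith [hm.pos])))
  have e1 : sqInt (volume.restrict S) (grad v) =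
      sqInt (volume.restrict S) (gradient (polyEval d p - fun _ => c)) := by
    refine lintegral_congr_ae ?_
    filter_upwards [hg] with x hx
    rw [hx]
    congr 2
    simp only [gradient]
    rw [show (polyEval d p - fun _ => c) = fun y => polyEval d p y - c from rfl, fderiv_sub_const]
  have e2 : sqInt (volume.restrict S) (fun x => val v x - c) =
      sqInt (volume.restrict S) (polyEval d p - fun _ => c) := by
    refine lintegral_congr_ae ?_
    filter_upwards [hvq] with x hx
    rw [hx]; rfl
  rwa [e1, e2]

/-- The inverse inequality for finite element functions. -/
theorem exists_inverse (hd : 1 ≤ d) (l : ℕ) (hσ : 0 < σ) : ∃ C : ℝ≥0∞, C ≠ ⊤ ∧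
    ∀ (Ω Γ : Set (E d)), Convex ℝ Ω → IsOpen Ω → Bornology.IsBounded Ω → Ω.Nonempty →
    ∀ (K : Geometry.SimplicialComplex ℝ (E d)) (m : ℝ) (z : Finset (E d) → E d),
    IsTriangulation K Ω → IsMeshSize K σ m z → ∀ v ∈ Xh Ω Γ K l,
      ENNReal.ofReal (m ^ 2) * sqInt (volume.restrict Ω) (grad v) ≤
        C * sqInt (volume.restrict Ω) (val v) := by
  obtain ⟨C, hC, hinv⟩ := exists_local_inverse d l hσ
  refine ⟨C * ENNReal.ofReal (((1 + σ) / σ) ^ d), by finiteness,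
    fun Ω Γ hc ho hb hne K m z hK hm v hv => ?_⟩
  calc ENNReal.ofReal (m ^ 2) * sqInt (volume.restrict Ω) (grad v)
      ≤ ENNReal.ofReal (m ^ 2) * ∑ s ∈ hK.finite_elements.toFinset,
          sqInt (volume.restrict (interior (convexHull ℝ (s : Set (E d))))) (grad v) := by
        gcongr
        exact sqInt_le_sum_interior hK ho _
    _ ≤ ∑ s ∈ hK.finite_elements.toFinset, C *
          sqInt (volume.restrict (Ω ∩ Metric.closedBall (z s) (1 * m))) (val v) := by
        rw [Finset.mul_sum]
        refine Finset.sum_le_sum fun s hs => ?_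
        rw [Set.Finite.mem_toFinset] at hs
        have h1 := hinv Ω Γ hc ho hb hne K m z hK hm v hv s hs 0
        simp only [sub_zero] at h1
        refine h1.trans ?_
        gcongr
        rw [one_mul]
        exact sqInt_mono_set (subset_inter (hK.interior_subset hc ho hne hs)
          (interior_subset.trans (hm.subset_closedBall hs (hm.center_mem hσ hs)))) _
    _ ≤ C * (ENNReal.ofReal (((1 + σ) / σ) ^ d) * sqInt (volume.restrict Ω) (val v)) := by
        rw [← Finset.mul_sum]
        gcongr
        exact hm.sum_sqInt_le hσ hd _ (fun s hs => by rwa [Set.Finite.mem_toFinset] at hs)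
          zero_le_one (Lp.aestronglyMeasurable _)
    _ = _ := by ring

open Classical in
/-- The nodal values of the quasi-interpolant of `w`: averages over balls of radius `m` around
the vertices whose hat function vanishes on `∂Ω \ Γ`, and zero at the other vertices. -/
def clementCoeff (K : Geometry.SimplicialComplex ℝ (E d)) (Ω Γ : Set (E d)) (m : ℝ)
    (w : E d → ℝ) (p : E d) : ℝ :=
  if ∃ s ∈ elements K, ∃ x ∈ convexHull ℝ (s : Set (E d)), x ∈ frontier Ω ∧ x ∉ Γ ∧
    bary s p x ≠ 0 then 0 else ⨍ y in Ω ∩ Metric.closedBall p m, w y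

/-- `Γ` need not be a union of faces of elements. Each vertex that could contribute at a point of
`∂Ω \ Γ` has been given the value zero, so every term of the interpolant at such a point vanishes.
-/
theorem pwAffine_clementCoeff_eq_zero (hK : IsTriangulation K Ω) (ho : IsOpen Ω) (m : ℝ)
    (w : E d → ℝ) {x : E d} (hx : x ∈ frontier Ω) (hxΓ : x ∉ Γ) :
    pwAffine K (clementCoeff K Ω Γ m w) x = 0 := by
  obtain ⟨s, hs, hxs⟩ := hK.exists_mem ho (frontier_subset_closure hx)
  rw [pwAffine_eq _ hs hxs, affineInterp_apply]
  refine Finset.sum_eq_zero fun p _ => ?_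
  by_cases h : bary s p x = 0
  · rw [h, mul_zero]
  · rw [clementCoeff, if_pos ⟨s, hs, x, hxs, hx, hxΓ, h⟩, zero_mul]

/-- The error of the nodal values of the quasi-interpolant. -/
theorem IsFlatPart.exists_clementCoeff_le (h : IsFlatPart Ω Γ a b) (hσ : 0 < σ) :
    ∃ (R : ℝ) (C : ℝ≥0∞), 0 ≤ R ∧ C ≠ ⊤ ∧
    ∀ (K : Geometry.SimplicialComplex ℝ (E d)) (m : ℝ) (z : Finset (E d) → E d),
    IsTriangulation K Ω → IsMeshSize K σ m z → m ≤ Metric.diam Ω → ∀ w : X Ω Γ,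
    ∀ s ∈ elements K, ∀ p ∈ s,
      sqInt (volume.restrict (interior (convexHull ℝ (s : Set (E d)))))
          (fun x => val w x - clementCoeff K Ω Γ m (val w) p) ≤
        C * ENNReal.ofReal (m ^ 2) *
          sqInt (volume.restrict (Ω ∩ Metric.closedBall (z s) (R * m))) (grad w) := by
  obtain ⟨M, C, hM, hC, hloc⟩ := h.exists_local_poincare
  -- The point `x` is within `m` of the vertex `p`, and `p` is within `m` of `z s`; a ball of radius
  -- `M * m` about `x` thus lies in the ball of radius `(M + 2) * m` about `z s`.
  refine ⟨M + 2, C + ENNReal.ofReal (2 ^ 2 * 2 ^ d), by linarith, by finiteness,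
    fun K m z hK hm hmd w s hs p hp => ?_⟩
  have hSΩ := hK.interior_subset h.convex h.isOpen h.nonempty hs
  have hps : p ∈ convexHull ℝ (s : Set (E d)) := subset_convexHull ℝ _ hp
  have hm0 := hm.pos
  have hzp : dist p (z s) ≤ m := hm.dist_le s hs p hps _ (hm.center_mem hσ hs)
  -- A vertex with prescribed value zero is within `m` of a point of `∂Ω \ Γ`, where the local
  -- Poincaré inequality needs no mean value. At any other vertex the value is a mean, and the
  -- ordinary Poincaré inequality applies.
  by_cases hfree : ∃ t ∈ elements K, ∃ x ∈ convexHull ℝ (t : Set (E d)), x ∈ frontier Ω ∧ x ∉ Γ ∧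
      bary t p x ≠ 0
  · rw [clementCoeff, if_pos hfree]
    obtain ⟨t, ht, x, hxt, hxf, hxΓ, hbx⟩ := hfree
    have hpt : p ∈ t := by
      by_contra hcon
      exact hbx (bary_of_notMem hcon x)
    have hxp : dist p x ≤ m := hm.dist_le t ht p (subset_convexHull ℝ _ hpt) x hxt
    have h1 := hloc x hxf hxΓ m ⟨hm0, hmd⟩ (val w) (grad w) (tr w) ⟨w.2.2.1, w.2.2.2⟩
    simp only [sub_zero]
    calc sqInt (volume.restrict (interior (convexHull ℝ (s : Set (E d))))) (fun x => val w x)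
        ≤ sqInt (volume.restrict (Ω ∩ Metric.closedBall x (M * m))) (val w) := by
          refine sqInt_mono_set (subset_inter hSΩ fun y hy => ?_) _
          have h2 := hm.dist_le s hs y (interior_subset hy) p hps
          rw [Metric.mem_closedBall]
          nlinarith [dist_triangle y p x]
      _ ≤ C * ENNReal.ofReal (m ^ 2) *
          sqInt (volume.restrict (Ω ∩ Metric.closedBall x (M * m))) (grad w) := h1
      _ ≤ _ := by
          gcongr
          · exact le_self_add
          · refine sqInt_mono_set (inter_subset_inter_right _ fun y hy => ?_) _
            rw [Metric.mem_closedBall] at hy ⊢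
            have h3 := dist_triangle y x (z s)
            have h4 := dist_triangle x p (z s)
            rw [dist_comm x p] at h4
            nlinarith
  · rw [clementCoeff, if_neg hfree]
    have h1 := sqInt_sub_average_ball_le h.convex h.isOpen w.2.2.1 p hm0.le
    calc sqInt (volume.restrict (interior (convexHull ℝ (s : Set (E d)))))
          (fun x => val w x - ⨍ y in Ω ∩ Metric.closedBall p m, val w y)
        ≤ sqInt (volume.restrict (Ω ∩ Metric.closedBall p m))
          (fun x => val w x - ⨍ y in Ω ∩ Metric.closedBall p m, val w y) :=
          sqInt_mono_set (subset_inter hSΩ (interior_subset.trans (hm.subset_closedBall hs hps))) _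
      _ ≤ _ := h1
      _ = ENNReal.ofReal (2 ^ 2 * 2 ^ d) * ENNReal.ofReal (m ^ 2) *
          sqInt (volume.restrict (Ω ∩ Metric.closedBall p m)) (grad w) := by
          rw [← ENNReal.ofReal_mul (by positivity)]
          congr 2
          ring
      _ ≤ _ := by
          gcongr
          · exact le_add_self
          · refine sqInt_mono_set (inter_subset_inter_right _ fun y hy => ?_) _
            rw [Metric.mem_closedBall] at hy ⊢
            have h3 := dist_triangle y p (z s)
            nlinarith

/-- At each point of the element, the error is the average of the differences `w - c p` with the
barycentric coordinates as weights; the square is convex and the weights are at most one. -/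
theorem sqInt_sub_affineInterp_le {s : Finset (E d)} (hs : IsSimplex s) {w : E d → ℝ}
    (hw : AEStronglyMeasurable w (volume.restrict (interior (convexHull ℝ (s : Set (E d))))))
    (c : E d → ℝ) :
    sqInt (volume.restrict (interior (convexHull ℝ (s : Set (E d)))))
        (fun x => w x - affineInterp s c x) ≤
      ∑ p ∈ s, sqInt (volume.restrict (interior (convexHull ℝ (s : Set (E d)))))
        (fun x => w x - c p) := by
  simp_rw [sqInt]
  have hm : ∀ p ∈ s, AEMeasurable (fun x => ‖w x - c p‖ₑ ^ 2)
      (volume.restrict (interior (convexHull ℝ (s : Set (E d))))) := fun p _ =>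
    (hw.sub aestronglyMeasurable_const).enorm.pow_const 2
  rw [← lintegral_finsetSum' _ hm]
  refine setLIntegral_mono' isOpen_interior.measurableSet fun x hx => ?_
  have hxs := interior_subset hx
  have e1 : w x - affineInterp s c x = ∑ p ∈ s, bary s p x * (w x - c p) := by
    rw [affineInterp_apply]
    simp_rw [mul_sub]
    rw [Finset.sum_sub_distrib, ← Finset.sum_mul, sum_bary hs, one_mul]
    congr 1
    exact Finset.sum_congr rfl fun p _ => mul_comm _ _
  have h1 : (w x - affineInterp s c x) ^ 2 ≤ ∑ p ∈ s, (w x - c p) ^ 2 := by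
    rw [e1]
    have h3 := (Even.convexOn_pow (𝕜 := ℝ) (n := 2) (by norm_num)).map_sum_le (t := s)
      (w := fun p => bary s p x) (p := fun p => w x - c p)
      (fun p _ => bary_nonneg hs hxs p) (sum_bary hs x) (fun _ _ => mem_univ _)
    simp only [smul_eq_mul] at h3
    refine h3.trans (Finset.sum_le_sum fun p _ => ?_)
    exact mul_le_of_le_one_left (sq_nonneg _) (bary_le_one hs hxs p)
  have e2 : ∀ r : ℝ, ‖r‖ₑ ^ 2 = ENNReal.ofReal (r ^ 2) := fun r => by
    rw [Real.enorm_eq_ofReal_abs, ← ENNReal.ofReal_pow (abs_nonneg r), sq_abs]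
  simp_rw [e2]
  rw [← ENNReal.ofReal_sum_of_nonneg fun p _ => sq_nonneg _]
  exact ENNReal.ofReal_le_ofReal h1

/-- Quasi-interpolation in the finite element space. -/
theorem IsFlatPart.exists_quasi_interpolant (h : IsFlatPart Ω Γ a b) (hd : 1 ≤ d) (hσ : 0 < σ)
    {l : ℕ} (hl : 1 ≤ l) : ∃ C : ℝ≥0∞, C ≠ ⊤ ∧
    ∀ (K : Geometry.SimplicialComplex ℝ (E d)) (m : ℝ) (z : Finset (E d) → E d),
    IsTriangulation K Ω → IsMeshSize K σ m z → m ≤ Metric.diam Ω → ∀ w : X Ω Γ,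
    ∃ v ∈ Xh Ω Γ K l,
      sqInt (volume.restrict Ω) (fun x => val w x - val v x) ≤
          C * ENNReal.ofReal (m ^ 2) * sqInt (volume.restrict Ω) (grad w) ∧
        sqInt (volume.restrict Ω) (grad v) ≤ C * sqInt (volume.restrict Ω) (grad w) := by
  obtain ⟨R, C₁, hR, hC₁, hcl⟩ := h.exists_clementCoeff_le (σ := σ) hσ
  obtain ⟨C₂, hC₂, hinv⟩ := exists_local_inverse d l hσ
  -- `N` is the overlap of the enlarged balls, `A` adds the errors of the `d + 1` nodal values of an
  -- element, and `B` is the resulting gradient bound from the inverse inequality.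
  set N : ℝ≥0∞ := ENNReal.ofReal (((R + σ) / σ) ^ d) with hN
  set A : ℝ≥0∞ := ((d + 1 : ℕ) : ℝ≥0∞) * C₁ with hA
  set B : ℝ≥0∞ := C₂ * (2 * A + 2 * C₁) with hB
  refine ⟨(A + B) * N, by finiteness, fun K m z hK hm hmd w => ?_⟩
  set c := clementCoeff K Ω Γ m (val w) with hc
  obtain ⟨v, hv, hvc⟩ := exists_mem_Xh hd hK h.convex h.isOpen h.isBounded h.nonempty hl c
    (fun x hx hxΓ => pwAffine_clementCoeff_eq_zero hK h.isOpen m _ hx hxΓ)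
  have hm2 : ENNReal.ofReal (m ^ 2) ≠ 0 := by
    rw [Ne, ENNReal.ofReal_eq_zero, not_le]; exact pow_pos hm.pos 2
  have hloc : ∀ s ∈ elements K,
      sqInt (volume.restrict (interior (convexHull ℝ (s : Set (E d)))))
        (fun x => val w x - val v x) ≤ A * ENNReal.ofReal (m ^ 2) *
          sqInt (volume.restrict (Ω ∩ Metric.closedBall (z s) (R * m))) (grad w) := by
    intro s hs
    have hSΩ := hK.interior_subset h.convex h.isOpen h.nonempty hs
    have e1 : sqInt (volume.restrict (interior (convexHull ℝ (s : Set (E d)))))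
        (fun x => val w x - val v x) =
        sqInt (volume.restrict (interior (convexHull ℝ (s : Set (E d)))))
        (fun x => val w x - affineInterp s c x) := by
      refine lintegral_congr_ae ?_
      filter_upwards [ae_restrict_of_ae_restrict_of_subset hSΩ hvc,
        ae_restrict_mem isOpen_interior.measurableSet] with x hx hxS
      rw [hx, pwAffine_eq c hs (interior_subset hxS)]
    rw [e1]
    refine (sqInt_sub_affineInterp_le (isSimplex_of_mem hs)
      ((Lp.aestronglyMeasurable (val w)).mono_measure (Measure.restrict_mono hSΩ le_rfl)) c).trans ?_
    refine (Finset.sum_le_sum fun p hp => hcl K m z hK hm hmd w s hs p hp).trans_eq ?_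
    rw [Finset.sum_const, hs.2, nsmul_eq_mul, hA]
    ring
  have hlocg : ∀ s ∈ elements K,
      sqInt (volume.restrict (interior (convexHull ℝ (s : Set (E d))))) (grad v) ≤
        B * sqInt (volume.restrict (Ω ∩ Metric.closedBall (z s) (R * m))) (grad w) := by
    intro s hs
    have hSΩ := hK.interior_subset h.convex h.isOpen h.nonempty hs
    -- The nodal value at any one vertex serves as the constant in the local inverse inequality; the
    -- deviation of `v` from it is of order `m`, which compensates the inverse power of `m`.
    obtain ⟨p, hp⟩ : s.Nonempty := Finset.card_pos.1 (by rw [hs.2]; omega)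
    have h1 := hinv Ω Γ h.convex h.isOpen h.isBounded h.nonempty K m z hK hm v hv s hs (c p)
    set G := sqInt (volume.restrict (Ω ∩ Metric.closedBall (z s) (R * m))) (grad w) with hG
    have hmeas : ∀ u : L2 Ω, AEStronglyMeasurable u
        (volume.restrict (interior (convexHull ℝ (s : Set (E d))))) := fun u =>
      (Lp.aestronglyMeasurable u).mono_measure (Measure.restrict_mono hSΩ le_rfl)
    have h2 : sqInt (volume.restrict (interior (convexHull ℝ (s : Set (E d)))))
        (fun x => val v x - c p) ≤ 2 * (A * ENNReal.ofReal (m ^ 2) * G) +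
          2 * (C₁ * ENNReal.ofReal (m ^ 2) * G) := by
      have h3 := sqInt_add_le (f := fun x => val v x - val w x)
        (μ := volume.restrict (interior (convexHull ℝ (s : Set (E d)))))
        ((hmeas (val v)).sub (hmeas (val w))) (fun x => val w x - c p)
      simp only [sub_add_sub_cancel] at h3
      refine h3.trans ?_
      gcongr
      · refine le_trans (le_of_eq ?_) (hloc s hs)
        refine lintegral_congr fun x => ?_
        rw [enorm_sub_rev]
      · exact hcl K m z hK hm hmd w s hs p hp
    rw [← ENNReal.mul_le_mul_iff_right hm2 ENNReal.ofReal_ne_top]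
    refine h1.trans ((mul_le_mul_right h2 C₂).trans_eq ?_)
    rw [hB]; ring
  have hsum := hm.sum_sqInt_le hσ hd hK.finite_elements.toFinset
    (fun s hs => by rwa [Set.Finite.mem_toFinset] at hs) hR (Ω := Ω)
    (Lp.aestronglyMeasurable (grad w))
  refine ⟨v, hv, ?_, ?_⟩
  · calc sqInt (volume.restrict Ω) (fun x => val w x - val v x)
        ≤ ∑ s ∈ hK.finite_elements.toFinset, A * ENNReal.ofReal (m ^ 2) *
          sqInt (volume.restrict (Ω ∩ Metric.closedBall (z s) (R * m))) (grad w) :=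
          (sqInt_le_sum_interior hK h.isOpen _).trans (Finset.sum_le_sum fun s hs =>
            hloc s (hK.finite_elements.mem_toFinset.1 hs))
      _ ≤ A * ENNReal.ofReal (m ^ 2) * (N * sqInt (volume.restrict Ω) (grad w)) := by
          rw [← Finset.mul_sum]; gcongr
      _ ≤ (A + B) * ENNReal.ofReal (m ^ 2) * (N * sqInt (volume.restrict Ω) (grad w)) := by
          gcongr; exact le_self_add
      _ = _ := by ring
  · calc sqInt (volume.restrict Ω) (grad v)
        ≤ ∑ s ∈ hK.finite_elements.toFinset, B *
          sqInt (volume.restrict (Ω ∩ Metric.closedBall (z s) (R * m))) (grad w) :=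
          (sqInt_le_sum_interior hK h.isOpen _).trans (Finset.sum_le_sum fun s hs =>
            hlocg s (hK.finite_elements.mem_toFinset.1 hs))
      _ ≤ B * (N * sqInt (volume.restrict Ω) (grad w)) := by
          rw [← Finset.mul_sum]; gcongr
      _ ≤ (A + B) * (N * sqInt (volume.restrict Ω) (grad w)) := by
          gcongr; exact le_add_self
      _ = _ := by ring

end

section

/-! ### The `L²` projection onto the finite element space -/

variable {K : Geometry.SimplicialComplex ℝ (E d)} {Ω Γ : Set (E d)} {σ m : ℝ}
  {z : Finset (E d) → E d} {a : E d} {b : ℝ}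

theorem sqInt_eq_ofReal_norm_sq {α F : Type*} [MeasurableSpace α] [NormedAddCommGroup F]
    {μ : Measure α} (f : Lp F 2 μ) : sqInt μ f = ENNReal.ofReal (‖f‖ ^ 2) := by
  rw [← eLpNorm_two_sq, ENNReal.ofReal_pow (norm_nonneg _), ofReal_norm, Lp.enorm_def]

theorem norm_sq_le_of_sqInt_le {α β F G : Type*} [MeasurableSpace α] [MeasurableSpace β]
    [NormedAddCommGroup F] [NormedAddCommGroup G] {μ : Measure α} {ν : Measure β} {f : Lp F 2 μ}
    {g : Lp G 2 ν} {C : ℝ≥0∞} (hC : C ≠ ⊤) (h : sqInt μ f ≤ C * sqInt ν g) :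
    ‖f‖ ^ 2 ≤ C.toReal * ‖g‖ ^ 2 := by
  rw [sqInt_eq_ofReal_norm_sq, sqInt_eq_ofReal_norm_sq, ← ENNReal.ofReal_toReal hC,
    ← ENNReal.ofReal_mul ENNReal.toReal_nonneg] at h
  exact (ENNReal.ofReal_le_ofReal_iff (by positivity)).1 h

theorem sqInt_coe_sub {α F : Type*} [MeasurableSpace α] [NormedAddCommGroup F] {μ : Measure α}
    (f g : Lp F 2 μ) : sqInt μ (fun x => f x - g x) = sqInt μ (f - g : Lp F 2 μ) := by
  refine lintegral_congr_ae ?_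
  filter_upwards [Lp.coeFn_sub f g] with x hx
  rw [hx, Pi.sub_apply]

/-- The function underlying an element of `X`, as a linear map. -/
def valLin (Ω Γ : Set (E d)) : X Ω Γ →ₗ[ℝ] L2 Ω :=
  (LinearMap.fst ℝ (L2 Ω) (L2Vec Ω × L2Bdry Ω)).comp (X Ω Γ).subtype

theorem valLin_apply (v : X Ω Γ) : valLin Ω Γ v = val v := rfl

theorem memLp_indicator_polyFun (hb : Bornology.IsBounded Ω) {l : ℕ} (s : Finset (E d))
    (q : polyFun d l) :
    MemLp ((interior (convexHull ℝ (s : Set (E d)))).indicator (q : E d → ℝ)) 2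
      (volume.restrict Ω) :=
  (memLp_restrict_of_continuous hb (contDiff_of_mem_polyFun q.2).continuous).indicator
    isOpen_interior.measurableSet

/-- A polynomial on one element, extended by zero. -/
def localPoly (hb : Bornology.IsBounded Ω) (l : ℕ) (s : Finset (E d)) :
    polyFun d l →ₗ[ℝ] L2 Ω where
  toFun q := (memLp_indicator_polyFun hb s q).toLp _
  map_add' q q' := by
    rw [← (memLp_indicator_polyFun hb s q).toLp_add (memLp_indicator_polyFun hb s q')]
    refine MemLp.toLp_congr _ _ (Eventually.of_forall fun x => ?_)
    rw [Submodule.coe_add, indicator_add']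
  map_smul' c q := by
    rw [RingHom.id_apply, ← (memLp_indicator_polyFun hb s q).toLp_const_smul c]
    refine MemLp.toLp_congr _ _ (Eventually.of_forall fun x => ?_)
    exact congrFun (indicator_const_smul _ c (q : E d → ℝ)) x

/-- Up to null sets, a finite element function is the sum of its polynomial pieces over finitely
many elements. Finite dimension provides the orthogonal projection. -/
theorem finiteDimensional_map_Xh (hK : IsTriangulation K Ω) (ho : IsOpen Ω)
    (hb : Bornology.IsBounded Ω) (l : ℕ) :
    FiniteDimensional ℝ ((Xh Ω Γ K l).map (valLin Ω Γ)) := by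
  have : Finite (elements K) := hK.finite_elements
  have hfin : FiniteDimensional ℝ
      (⨆ s : elements K, LinearMap.range (localPoly hb l (s : Finset (E d))) : Submodule ℝ (L2 Ω)) :=
    inferInstance
  refine Submodule.finiteDimensional_of_le (S₂ := ⨆ s : elements K,
    LinearMap.range (localPoly hb l (s : Finset (E d)))) ?_
  rintro _ ⟨v, ⟨f, ⟨-, hf⟩, hvf⟩, rfl⟩
  have hq : ∀ s : Finset (E d), ∃ q : polyFun d l, s ∈ elements K →
      ∀ x ∈ convexHull ℝ (s : Set (E d)), f x = (q : E d → ℝ) x := fun s => by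
    by_cases hs : s ∈ elements K
    · obtain ⟨p, hp, hfp⟩ := hf s hs.1 hs.2
      exact ⟨⟨polyEval d p, mem_polyFun.2 ⟨p, hp, fun x => rfl⟩⟩, fun _ => hfp⟩
    · exact ⟨0, fun h => absurd h hs⟩
  choose q hq using hq
  have hsum : valLin Ω Γ v = ∑ s ∈ hK.finite_elements.toFinset, localPoly hb l s (q s) := by
    refine Lp.ext ?_
    have h1 : ∀ᵐ x ∂(volume.restrict Ω), ∀ s ∈ hK.finite_elements.toFinset,
        localPoly hb l s (q s) x =
          (interior (convexHull ℝ (s : Set (E d)))).indicator (q s : E d → ℝ) x :=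
      (ae_ball_iff (Finset.countable_toSet _)).2 fun s _ =>
        (memLp_indicator_polyFun hb s (q s)).coeFn_toLp
    filter_upwards [hvf, h1, ae_mem_interior hK ho,
      Lp.coeFn_finsetSum hK.finite_elements.toFinset fun s => localPoly hb l s (q s)]
      with x hx h1x ⟨s, hs, hxs⟩ h2x
    rw [valLin_apply, hx, h2x, Finset.sum_apply, Finset.sum_congr rfl h1x, Finset.sum_eq_single s]
    · rw [indicator_of_mem hxs, hq s hs x (interior_subset hxs)]
    · intro t ht hts
      rw [Set.Finite.mem_toFinset] at ht
      refine indicator_of_notMem (fun hxt => ?_) _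
      have := interior_inter_convexHull_eq_empty hs ht hts.symm
      rw [eq_empty_iff_forall_notMem] at this
      exact this x ⟨hxs, interior_subset hxt⟩
    · intro h
      exact absurd (hK.finite_elements.mem_toFinset.2 hs) h
  rw [hsum]
  refine Submodule.sum_mem _ fun s hs => ?_
  exact Submodule.mem_iSup_of_mem ⟨s, hK.finite_elements.mem_toFinset.1 hs⟩
    (LinearMap.mem_range_self _ _)

/-- `p` is the `L²` projection of `w` onto the finite element space. -/
def IsL2Proj (K : Geometry.SimplicialComplex ℝ (E d)) (l : ℕ) (w p : X Ω Γ) : Prop :=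
  p ∈ Xh Ω Γ K l ∧ ∀ v ∈ Xh Ω Γ K l, inner ℝ (val w - val p) (val v) = (0 : ℝ)

theorem exists_isL2Proj (hK : IsTriangulation K Ω) (ho : IsOpen Ω)
    (hb : Bornology.IsBounded Ω) (l : ℕ) (w : X Ω Γ) :
    ∃ p, IsL2Proj K l w p := by
  have := finiteDimensional_map_Xh (Γ := Γ) hK ho hb l
  set V := (Xh Ω Γ K l).map (valLin Ω Γ) with hV
  obtain ⟨p, hp, hpe⟩ := (V.orthogonalProjectionOnto (val w)).2
  refine ⟨p, hp, fun v hv => ?_⟩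
  have h1 := V.starProjection_inner_eq_zero (val w) (valLin Ω Γ v) ⟨v, hv, rfl⟩
  rw [valLin_apply] at hpe h1
  rw [hpe]
  exact h1

/-- Pythagoras, as `p - v` lies in the finite element space. Both best approximation and the
contraction `‖p - v‖ ≤ ‖w - v‖` are read off from it. -/
theorem IsL2Proj.norm_sub_le {w p : X Ω Γ} {l : ℕ} (hp : IsL2Proj K l w p) {v : X Ω Γ}
    (hv : v ∈ Xh Ω Γ K l) : ‖val w - val p‖ ^ 2 + ‖val p - val v‖ ^ 2 = ‖val w - val v‖ ^ 2 := by
  have h1 : inner ℝ (val w - val p) (val p - val v) = (0 : ℝ) := hp.2 _ (sub_mem hp.1 hv)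
  have h2 := norm_add_sq_real (val w - val p) (val p - val v)
  rw [sub_add_sub_cancel, h1] at h2
  linarith

/-- The `L²` projection onto the finite element space is stable in `H¹`. -/
theorem IsFlatPart.exists_isL2Proj_stable (h : IsFlatPart Ω Γ a b) (hd : 1 ≤ d) (hσ : 0 < σ)
    {l : ℕ} (hl : 1 ≤ l) : ∃ C : ℝ, 0 ≤ C ∧
    ∀ K : Geometry.SimplicialComplex ℝ (E d), IsTriangulation K Ω → IsQuasiUniform σ K →
    ∀ w p : X Ω Γ, IsL2Proj K l w p → ∀ v ∈ Xh Ω Γ K l,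
      ‖grad (w - p)‖ ≤ C * ‖grad (w - v)‖ := by
  obtain ⟨C₁, hC₁, hinv⟩ := exists_inverse (d := d) hd l hσ
  obtain ⟨C₂, hC₂, hqi⟩ := h.exists_quasi_interpolant (σ := σ) hd hσ hl
  set c₁ := C₁.toReal
  set c₂ := C₂.toReal
  have hc₁ : 0 ≤ c₁ := ENNReal.toReal_nonneg
  have hc₂ : 0 ≤ c₂ := ENNReal.toReal_nonneg
  refine ⟨1 + √c₂ + √(c₁ * c₂), by positivity, fun K hK hq w p hp v hv => ?_⟩
  obtain ⟨m, z, hm, hmd⟩ := exists_isMeshSize hd hK hq h.isOpen h.isBounded h.nonempty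
  -- Interpolating `w - v` rather than `w` yields quasi-optimality instead of mere stability. The
  -- discrete function `p - v - I` is `O(m)` in `L²` by the projection property, the inverse
  -- inequality loses one power of `m`, and `w - p = (w - v) - (p - v - I) - I`.
  obtain ⟨I, hI, hI1, hI2⟩ := hqi K m z hK hm hmd (w - v)
  have hm0 := hm.pos
  have i1 : ‖val (w - v) - val I‖ ^ 2 ≤ c₂ * m ^ 2 * ‖grad (w - v)‖ ^ 2 := by
    rw [sqInt_coe_sub] at hI1
    have := norm_sq_le_of_sqInt_le (by finiteness) hI1
    rwa [ENNReal.toReal_mul, ENNReal.toReal_ofReal (by positivity)] at this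
  have i2 : ‖grad I‖ ^ 2 ≤ c₂ * ‖grad (w - v)‖ ^ 2 := norm_sq_le_of_sqInt_le hC₂ hI2
  have hmem : p - v - I ∈ Xh Ω Γ K l := sub_mem (sub_mem hp.1 hv) hI
  have i3 : m ^ 2 * ‖grad (p - v - I)‖ ^ 2 ≤ c₁ * ‖val (p - v - I)‖ ^ 2 := by
    have h1 := hinv Ω Γ h.convex h.isOpen h.isBounded h.nonempty K m z hK hm _ hmem
    rw [sqInt_eq_ofReal_norm_sq, sqInt_eq_ofReal_norm_sq, ← ENNReal.ofReal_mul (by positivity),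
      ← ENNReal.ofReal_toReal hC₁, ← ENNReal.ofReal_mul hc₁] at h1
    exact (ENNReal.ofReal_le_ofReal_iff (by positivity)).1 h1
  have i4 : ‖val (p - v - I)‖ ^ 2 ≤ ‖val (w - v) - val I‖ ^ 2 := by
    have h1 := hp.norm_sub_le (v := v + I) (add_mem hv hI)
    have e1 : val p - val (v + I) = val (p - v - I) := by
      rw [sub_sub]; rfl
    have e2 : val w - val (v + I) = val (w - v) - val I := by
      have : val (w - v) - val I = val (w - v - I) := rfl
      rw [this, sub_sub]; rfl
    rw [e1, e2] at h1
    nlinarith [sq_nonneg ‖val w - val p‖]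
  have i5 : ‖grad (p - v - I)‖ ≤ √(c₁ * c₂) * ‖grad (w - v)‖ := by
    rw [← Real.sqrt_sq (norm_nonneg (grad (w - v))), ← Real.sqrt_mul (by positivity)]
    refine Real.le_sqrt_of_sq_le ?_
    have h2 : m ^ 2 * ‖grad (p - v - I)‖ ^ 2 ≤ m ^ 2 * (c₁ * c₂ * ‖grad (w - v)‖ ^ 2) := by
      calc _ ≤ c₁ * ‖val (p - v - I)‖ ^ 2 := i3
        _ ≤ c₁ * (c₂ * m ^ 2 * ‖grad (w - v)‖ ^ 2) :=
          mul_le_mul_of_nonneg_left (i4.trans i1) hc₁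
        _ = _ := by ring
    exact le_of_mul_le_mul_left h2 (by positivity)
  have i6 : ‖grad I‖ ≤ √c₂ * ‖grad (w - v)‖ := by
    rw [← Real.sqrt_sq (norm_nonneg (grad (w - v))), ← Real.sqrt_mul (by positivity)]
    exact Real.le_sqrt_of_sq_le i2
  have e : grad (w - p) = grad (w - v) - (grad (p - v - I) + grad I) := by
    have e1 : grad (p - v - I) + grad I = grad (p - v - I + I) := rfl
    have e2 : grad (w - v) - grad (p - v) = grad (w - v - (p - v)) := rfl
    rw [e1, sub_add_cancel, e2, sub_sub_sub_cancel_right]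
  rw [e]
  calc _ ≤ ‖grad (w - v)‖ + (‖grad (p - v - I)‖ + ‖grad I‖) :=
        (_root_.norm_sub_le _ _).trans (add_le_add_right (norm_add_le _ _) _)
    _ ≤ _ := by linarith

end

/-! ### The two subdomains together, and functions of time -/

section

/-! ### The interface of two convex polytopes -/

theorem IsConvexPolytope.convex {Ω : Set (E d)} (h : IsConvexPolytope Ω) : Convex ℝ Ω := by
  obtain ⟨-, s, rfl⟩ := h
  exact (convex_convexHull ℝ _).interior

theorem IsConvexPolytope.isOpen {Ω : Set (E d)} (h : IsConvexPolytope Ω) : IsOpen Ω := by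
  obtain ⟨-, s, rfl⟩ := h
  exact isOpen_interior

theorem IsConvexPolytope.isBounded {Ω : Set (E d)} (h : IsConvexPolytope Ω) :
    Bornology.IsBounded Ω := by
  obtain ⟨-, s, rfl⟩ := h
  exact (isCompact_convexHull_finset s).isBounded.subset interior_subset

variable {Ω : Fin 2 → Set (E d)}

/-- A point in the closure of one open set cannot belong to the other, disjoint, open set. In this
form the interface is visibly convex. -/
theorem interface_eq (ho : ∀ i, IsOpen (Ω i)) (hdisj : Disjoint (Ω 0) (Ω 1)) :
    interface Ω = closure (Ω 0) ∩ closure (Ω 1) := by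
  refine Subset.antisymm (inter_subset_inter frontier_subset_closure frontier_subset_closure) ?_
  rintro x ⟨h0, h1⟩
  rw [interface, (ho 0).frontier_eq, (ho 1).frontier_eq]
  exact ⟨⟨h0, fun hx => disjoint_left.1 (hdisj.closure_right (ho 0)) hx h1⟩,
    ⟨h1, fun hx => disjoint_left.1 (hdisj.symm.closure_right (ho 1)) hx h0⟩⟩

theorem interface_subset (Ω : Fin 2 → Set (E d)) (i : Fin 2) : interface Ω ⊆ frontier (Ω i) := by
  fin_cases i
  · exact inter_subset_left
  · exact inter_subset_right

/-- The interface of two disjoint convex polytopes lies in a separating hyperplane. -/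
theorem exists_isFlatPart (hΩ : ∀ i, IsConvexPolytope (Ω i)) (hdisj : Disjoint (Ω 0) (Ω 1))
    (i : Fin 2) : ∃ a b, IsFlatPart (Ω i) (interface Ω) a b := by
  -- Points of the interface lie in both closures, hence on both sides of the separating hyperplane,
  -- hence on it.
  obtain ⟨f, u, hf0, hf1⟩ := geometric_hahn_banach_open_open (hΩ 0).convex (hΩ 0).isOpen
    (hΩ 1).convex (hΩ 1).isOpen hdisj
  set n : E d := (InnerProductSpace.toDual ℝ (E d)).symm f with hn
  have hnf : ∀ x, inner ℝ n x = f x := fun x => InnerProductSpace.toDual_symm_apply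
  have hn0 : n ≠ 0 := fun h => by
    obtain ⟨x, hx⟩ := (hΩ 0).1
    obtain ⟨y, hy⟩ := (hΩ 1).1
    have h1 := hf0 x hx
    have h2 := hf1 y hy
    rw [← hnf, h, inner_zero_left] at h1 h2
    linarith
  have hpos : 0 < ‖n‖⁻¹ := inv_pos.2 (norm_pos_iff.2 hn0)
  set a : E d := ‖n‖⁻¹ • n with ha
  set b : ℝ := ‖n‖⁻¹ * u with hb
  have han : ‖a‖ = 1 := norm_smul_inv_norm hn0
  have hax : ∀ x, inner ℝ a x = ‖n‖⁻¹ * f x := fun x => by rw [ha, real_inner_smul_left, hnf]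
  have h0 : ∀ x ∈ Ω 0, inner ℝ a x < b := fun x hx => by
    rw [hax]; exact mul_lt_mul_of_pos_left (hf0 x hx) hpos
  have h1 : ∀ x ∈ Ω 1, b < inner ℝ a x := fun x hx => by
    rw [hax]; exact mul_lt_mul_of_pos_left (hf1 x hx) hpos
  have hΓ := interface_eq (fun i => (hΩ i).isOpen) hdisj
  have hcΓ : Convex ℝ (interface Ω) := by
    rw [hΓ]; exact (hΩ 0).convex.closure.inter (hΩ 1).convex.closure
  have hclΓ : IsClosed (interface Ω) := isClosed_frontier.inter isClosed_frontier
  have heq : ∀ x ∈ interface Ω, inner ℝ a x = b := fun x hx => by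
    rw [hΓ] at hx
    refine le_antisymm ?_ ?_
    · exact closure_minimal (t := {x | inner ℝ a x ≤ b}) (fun x hx => (h0 x hx).le)
        (isClosed_le (by fun_prop) continuous_const) hx.1
    · exact closure_minimal (t := {x | b ≤ inner ℝ a x}) (fun x hx => (h1 x hx).le)
        (isClosed_le continuous_const (by fun_prop)) hx.2
  fin_cases i
  · exact ⟨a, b, (hΩ 0).convex, (hΩ 0).isOpen, (hΩ 0).isBounded, (hΩ 0).1, hcΓ, hclΓ,
      interface_subset Ω 0, han, h0, heq⟩
  -- Seen from the second subdomain, the hyperplane has the opposite normal.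
  · exact ⟨-a, -b, (hΩ 1).convex, (hΩ 1).isOpen, (hΩ 1).isBounded, (hΩ 1).1, hcΓ, hclΓ,
      interface_subset Ω 1, by rw [norm_neg, han],
      fun x hx => by rw [inner_neg_left]; exact neg_lt_neg (h1 x hx),
      fun x hx => by rw [inner_neg_left, heq x hx]⟩

/-! ### Traces on the interface -/

theorem memLp_tr (Ω : Fin 2 → Set (E d)) {i : Fin 2} (v : X (Ω i) (interface Ω)) :
    MemLp (tr v) 2 ((surf d).restrict (interface Ω)) :=
  (Lp.memLp (tr v)).mono_measure (Measure.restrict_mono (interface_subset Ω i) le_rfl)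

/-- The trace on the interface. -/
def traceInterface (Ω : Fin 2 → Set (E d)) (i : Fin 2) :
    X (Ω i) (interface Ω) →ₗ[ℝ] Lp ℝ 2 ((surf d).restrict (interface Ω)) where
  toFun v := (memLp_tr Ω v).toLp _
  map_add' v w := by
    rw [← (memLp_tr Ω v).toLp_add (memLp_tr Ω w)]
    exact MemLp.toLp_congr _ _ (ae_restrict_of_ae_restrict_of_subset (interface_subset Ω i)
      (Lp.coeFn_add (tr v) (tr w)))
  map_smul' c v := by
    rw [RingHom.id_apply, ← (memLp_tr Ω v).toLp_const_smul c]
    exact MemLp.toLp_congr _ _ (ae_restrict_of_ae_restrict_of_subset (interface_subset Ω i)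
      (Lp.coeFn_smul c (tr v)))

theorem coeFn_traceInterface {i : Fin 2} (v : X (Ω i) (interface Ω)) :
    traceInterface Ω i v =ᵐ[(surf d).restrict (interface Ω)] tr v :=
  (memLp_tr Ω v).coeFn_toLp

theorem sqrt_integral_tr_sq {i : Fin 2} (v : X (Ω i) (interface Ω)) :
    √(∫ x in interface Ω, (tr v x) ^ 2 ∂(surf d)) = ‖traceInterface Ω i v‖ := by
  have h : ∫ x in interface Ω, (tr v x) ^ 2 ∂(surf d) =
      inner ℝ (traceInterface Ω i v) (traceInterface Ω i v) := by
    rw [L2.inner_def]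
    refine integral_congr_ae ?_
    filter_upwards [coeFn_traceInterface v] with x hx
    rw [hx, real_inner_self_eq_norm_sq, Real.norm_eq_abs, sq_abs]
  rw [h, real_inner_self_eq_norm_sq, Real.sqrt_sq (norm_nonneg _)]

theorem IsFlatPart.norm_traceInterface_le {i : Fin 2} {a : E d} {b : ℝ}
    (h : IsFlatPart (Ω i) (interface Ω) a b) : ∃ C : ℝ, 0 ≤ C ∧
    ∀ v : X (Ω i) (interface Ω), ‖traceInterface Ω i v‖ ≤ C * ‖grad v‖ := by
  obtain ⟨C, hC, hCv⟩ := h.exists_trace_le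
  refine ⟨√C.toReal, Real.sqrt_nonneg _, fun v => ?_⟩
  have h1 : sqInt ((surf d).restrict (interface Ω)) (traceInterface Ω i v) ≤
      C * sqInt (volume.restrict (Ω i)) (grad v) := by
    refine le_trans (le_of_eq ?_) (hCv (val v) (grad v) (tr v) ⟨v.2.2.1, v.2.2.2⟩)
    refine lintegral_congr_ae ?_
    filter_upwards [coeFn_traceInterface v] with x hx
    rw [hx]
  have h2 := norm_sq_le_of_sqInt_le hC h1
  rw [← Real.sqrt_sq (norm_nonneg (grad v)), ← Real.sqrt_mul ENNReal.toReal_nonneg]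
  exact Real.le_sqrt_of_sq_le h2

theorem IsFlatPart.norm_val_le {Ω Γ : Set (E d)} {a : E d} {b : ℝ} (h : IsFlatPart Ω Γ a b) :
    ∃ C : ℝ, 0 ≤ C ∧ ∀ v : X Ω Γ, ‖val v‖ ≤ C * ‖grad v‖ := by
  refine ⟨√(ENNReal.ofReal (2 * (Metric.diam Ω + 1) ^ 2)).toReal, Real.sqrt_nonneg _,
    fun v => ?_⟩
  have h2 := norm_sq_le_of_sqInt_le ENNReal.ofReal_ne_top
    (h.sqInt_le (v := val v) (g := grad v) (w := tr v) ⟨v.2.2.1, v.2.2.2⟩)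
  rw [← Real.sqrt_sq (norm_nonneg (grad v)), ← Real.sqrt_mul ENNReal.toReal_nonneg]
  exact Real.le_sqrt_of_sq_le h2

/-- The constants of the two subdomains. -/
theorem exists_constants (hd : 1 ≤ d) (hΩ : ∀ i, IsConvexPolytope (Ω i))
    (hdisj : Disjoint (Ω 0) (Ω 1)) {σ : ℝ} (hσ : 0 < σ) {l : ℕ} (hl : 1 ≤ l) :
    ∃ CF CT CP : ℝ, 0 ≤ CF ∧ 0 ≤ CT ∧ 0 ≤ CP ∧ ∀ i,
      (∀ v : X (Ω i) (interface Ω), ‖val v‖ ≤ CF * ‖grad v‖) ∧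
      (∀ v : X (Ω i) (interface Ω), ‖traceInterface Ω i v‖ ≤ CT * ‖grad v‖) ∧
      ∀ K : Geometry.SimplicialComplex ℝ (E d), IsTriangulation K (Ω i) → IsQuasiUniform σ K →
        ∀ w p : X (Ω i) (interface Ω), IsL2Proj K l w p → ∀ v ∈ Xh (Ω i) (interface Ω) K l,
          ‖grad (w - p)‖ ≤ CP * ‖grad (w - v)‖ := by
  choose a b hab using exists_isFlatPart hΩ hdisj
  choose F hF hF' using fun i => (hab i).norm_val_le
  choose T hT hT' using fun i => (hab i).norm_traceInterface_le
  choose P hP hP' using fun i => (hab i).exists_isL2Proj_stable hd hσ hl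
  have key : ∀ (A : Fin 2 → ℝ), (∀ i, 0 ≤ A i) → ∀ i, A i ≤ A 0 + A 1 := fun A hA i => by
    fin_cases i
    · exact le_add_of_nonneg_right (hA 1)
    · exact le_add_of_nonneg_left (hA 0)
  refine ⟨F 0 + F 1, T 0 + T 1, P 0 + P 1, add_nonneg (hF 0) (hF 1), add_nonneg (hT 0) (hT 1),
    add_nonneg (hP 0) (hP 1), fun i => ⟨fun v => ?_, fun v => ?_, fun K hK hq w p hp v hv => ?_⟩⟩
  · exact (hF' i v).trans (mul_le_mul_of_nonneg_right (key F hF i) (norm_nonneg _))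
  · exact (hT' i v).trans (mul_le_mul_of_nonneg_right (key T hT i) (norm_nonneg _))
  · exact (hP' i K hK hq w p hp v hv).trans
      (mul_le_mul_of_nonneg_right (key P hP i) (norm_nonneg _))

/-! ### Functions of time -/

theorem intervalIntegrable_norm_sq_of_memLp {F : Type*} [NormedAddCommGroup F]
    {T : ℝ} {u' : ℝ → F} (h : MemLp u' 2 (volume.restrict (Ioc 0 T))) 
    {s t : ℝ} (hs : 0 ≤ s) (hst : s ≤ t) (ht : t ≤ T) :
    IntervalIntegrable (fun r => ‖u' r‖ ^ 2) volume s t := by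
  rw [intervalIntegrable_iff_integrableOn_Ioc_of_le hst]
  exact (h.integrable_norm_pow (by norm_num)).mono_measure
    (Measure.restrict_mono (Ioc_subset_Ioc hs ht) le_rfl)

theorem sq_integral_norm_le {F : Type*} [NormedAddCommGroup F]
    {T : ℝ} {u' : ℝ → F} (h : MemLp u' 2 (volume.restrict (Ioc 0 T))) 
    {s t : ℝ} (hs : 0 ≤ s) (hst : s ≤ t) (ht : t ≤ T) :
    (∫ r in s..t, ‖u' r‖) ^ 2 ≤ (t - s) * ∫ r in s..t, ‖u' r‖ ^ 2 := by
  have hm : MemLp (fun r => ‖u' r‖) 2 (volume.restrict (Ioc s t)) :=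
    h.norm.mono_measure (Measure.restrict_mono (Ioc_subset_Ioc hs ht) le_rfl)
  have i1 : IntervalIntegrable (fun r => ‖u' r‖) volume s t := by
    rw [intervalIntegrable_iff_integrableOn_Ioc_of_le hst]
    exact hm.integrable (by norm_num)
  have i2 := intervalIntegrable_norm_sq_of_memLp h hs hst ht
  rcases hst.eq_or_lt with rfl | hlt
  · simp
  set A := ∫ r in s..t, ‖u' r‖ with hA
  have hpos : 0 < t - s := sub_pos.2 hlt
  -- `c` is the mean of `‖u'‖`; expanding the nonnegative integral of `(‖u'‖ - c) ^ 2` gives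
  -- Cauchy–Schwarz.
  set c := A / (t - s) with hc
  have h0 : 0 ≤ ∫ r in s..t, (‖u' r‖ - c) ^ 2 :=
    intervalIntegral.integral_nonneg hst fun r _ => sq_nonneg _
  have h1 : ∫ r in s..t, (‖u' r‖ - c) ^ 2 =
      (∫ r in s..t, ‖u' r‖ ^ 2) - 2 * c * A + c ^ 2 * (t - s) := by
    have : ∀ r, (‖u' r‖ - c) ^ 2 = ‖u' r‖ ^ 2 - 2 * c * ‖u' r‖ + c ^ 2 := fun r => by ring
    simp_rw [this]
    rw [intervalIntegral.integral_add (i2.sub (i1.const_mul _)) intervalIntegrable_const,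
      intervalIntegral.integral_sub i2 (i1.const_mul _), intervalIntegral.integral_const_mul,
      intervalIntegral.integral_const, smul_eq_mul, mul_comm (t - s)]
  have h2 : c * (t - s) = A := div_mul_cancel₀ _ hpos.ne'
  nlinarith

section Time

variable {F : Type*} [NormedAddCommGroup F] [NormedSpace ℝ F] {T : ℝ} {u u' : ℝ → F}

theorem HasL2TimeDeriv.integrableOn (h : HasL2TimeDeriv T u u') : IntegrableOn u' (Ioc 0 T) :=
  h.1.integrable (by norm_num)

theorem HasL2TimeDeriv.intervalIntegrable (h : HasL2TimeDeriv T u u') {s t : ℝ} (hs : 0 ≤ s)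
    (hst : s ≤ t) (ht : t ≤ T) : IntervalIntegrable u' volume s t := by
  rw [intervalIntegrable_iff_integrableOn_Ioc_of_le hst]
  exact h.integrableOn.mono_set (Ioc_subset_Ioc hs ht)

theorem HasL2TimeDeriv.sub_eq (h : HasL2TimeDeriv T u u') {s t : ℝ} (hs : 0 ≤ s)
    (hst : s ≤ t) (ht : t ≤ T) : u t - u s = ∫ r in s..t, u' r := by
  rw [h.2 t ⟨hs.trans hst, ht⟩, h.2 s ⟨hs, hst.trans ht⟩, add_sub_add_left_eq_sub]
  exact intervalIntegral.integral_interval_sub_left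
    (h.intervalIntegrable le_rfl (hs.trans hst) ht) (h.intervalIntegrable le_rfl hs (hst.trans ht))

theorem HasL2TimeDeriv.norm_sub_le (h : HasL2TimeDeriv T u u') {s t : ℝ} (hs : 0 ≤ s)
    (hst : s ≤ t) (ht : t ≤ T) : ‖u t - u s‖ ≤ ∫ r in s..t, ‖u' r‖ := by
  rw [h.sub_eq hs hst ht]
  exact intervalIntegral.norm_integral_le_integral_norm hst

theorem HasL2TimeDeriv.norm_sub_sq_le (h : HasL2TimeDeriv T u u') {s t : ℝ} (hs : 0 ≤ s)
    (hst : s ≤ t) (ht : t ≤ T) : ‖u t - u s‖ ^ 2 ≤ (t - s) * ∫ r in s..t, ‖u' r‖ ^ 2 :=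
  (pow_le_pow_left₀ (norm_nonneg _) (h.norm_sub_le hs hst ht) 2).trans
    (sq_integral_norm_le h.1 hs hst ht)

/-- The consistency error of the backward difference quotient. -/
theorem norm_difference_quotient_sub_sq_le {u'' : ℝ → F} [CompleteSpace F]
    (h : HasL2TimeDeriv T u u')
    (h' : HasL2TimeDeriv T u' u'') {s t : ℝ} (hs : 0 ≤ s) (hst : s < t) (ht : t ≤ T) :
    ‖(t - s)⁻¹ • (u t - u s) - u' t‖ ^ 2 ≤ (t - s) * ∫ r in s..t, ‖u'' r‖ ^ 2 := by
  have hpos : 0 < t - s := sub_pos.2 hst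
  -- The error is the mean over the step of `u' r - u' t`, and each of these differences is at most
  -- the integral of `‖u''‖` over the step. The value `u' t` is meaningful because `u'` is itself a
  -- primitive.
  have e1 : (t - s)⁻¹ • (u t - u s) - u' t = (t - s)⁻¹ • ∫ r in s..t, (u' r - u' t) := by
    rw [intervalIntegral.integral_sub (h.intervalIntegrable hs hst.le ht) intervalIntegrable_const,
      ← h.sub_eq hs hst.le ht, intervalIntegral.integral_const, smul_sub _ (u t - u s), smul_smul,
      inv_mul_cancel₀ hpos.ne', one_smul]
  have h1 : ‖∫ r in s..t, (u' r - u' t)‖ ≤ (∫ r in s..t, ‖u'' r‖) * |t - s| := by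
    refine intervalIntegral.norm_integral_le_of_norm_le_const fun r hr => ?_
    rw [uIoc_of_le hst.le] at hr
    rw [norm_sub_rev]
    have hr0 : 0 ≤ r := hs.trans hr.1.le
    refine (h'.norm_sub_le hr0 hr.2 ht).trans ?_
    refine intervalIntegral.integral_mono_interval hr.1.le hr.2 le_rfl
      (Eventually.of_forall fun _ => norm_nonneg _) ?_
    exact (h'.intervalIntegrable hs hst.le ht).norm
  have h2 : ‖(t - s)⁻¹ • (u t - u s) - u' t‖ ≤ ∫ r in s..t, ‖u'' r‖ := by
    rw [e1, norm_smul, norm_inv, Real.norm_eq_abs]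
    rw [inv_mul_le_iff₀ (abs_pos.2 hpos.ne'), mul_comm]
    exact h1
  exact (pow_le_pow_left₀ (norm_nonneg _) h2 2).trans (sq_integral_norm_le h'.1 hs hst.le ht)

theorem sum_intervalIntegral_steps {f : ℝ → ℝ} {N : ℕ} {Δt : ℝ} (hΔ : 0 ≤ Δt) (hT : N * Δt = T)
    (hf : IntervalIntegrable f volume 0 T) :
    ∑ n ∈ Finset.range N, ∫ r in (n : ℝ) * Δt..((n + 1 : ℕ) : ℝ) * Δt, f r =
      ∫ r in (0 : ℝ)..T, f r := by
  have h := intervalIntegral.sum_integral_adjacent_intervals (μ := volume) (f := f)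
    (a := fun n : ℕ => (n : ℝ) * Δt) (n := N) (fun k hk => by
      refine hf.mono_set ?_
      have h1 : (k : ℝ) * Δt ≤ ((k + 1 : ℕ) : ℝ) * Δt := by
        push_cast; nlinarith
      have h2 : ((k + 1 : ℕ) : ℝ) * Δt ≤ T := by
        rw [← hT]
        exact mul_le_mul_of_nonneg_right (by exact_mod_cast hk) hΔ
      have h0 : 0 ≤ (k : ℝ) * Δt := by positivity
      rw [uIcc_of_le h1, uIcc_of_le (h0.trans (h1.trans h2))]
      exact Icc_subset_Icc h0 h2)
  simpa [hT] using h

end Time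

end

/-! ### Energy stability of the scheme and the error estimate -/

section

/-! ### The energy estimate for one time step -/

/-- The diffusion form `∫_Ω ν g · g'`. -/
def diffusionForm (Ω : Set (E d)) (ν : E d → ℝ) (g g' : L2Vec Ω) : ℝ :=
  ∫ x in Ω, ν x * inner ℝ (g x) (g' x)

section Form

variable {Ω : Set (E d)} {ν : E d → ℝ} {ν₀ ν₁ : ℝ}

theorem integrable_norm_mul_norm (g g' : L2Vec Ω) :
    Integrable (fun x => ‖g x‖ * ‖g' x‖) (volume.restrict Ω) :=
  memLp_one_iff_integrable.1 ((Lp.memLp g').norm.smul (Lp.memLp g).norm (r := 1))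

theorem integral_norm_mul_norm_le (g g' : L2Vec Ω) :
    ∫ x in Ω, ‖g x‖ * ‖g' x‖ ≤ ‖g‖ * ‖g'‖ := by
  have h := real_inner_le_norm ((Lp.memLp g).norm.toLp (fun x => ‖g x‖))
    ((Lp.memLp g').norm.toLp (fun x => ‖g' x‖))
  rw [Lp.norm_toLp, Lp.norm_toLp, eLpNorm_norm, eLpNorm_norm, ← Lp.norm_def, ← Lp.norm_def,
    L2.inner_def] at h
  refine le_trans (le_of_eq (integral_congr_ae ?_)) h
  filter_upwards [(Lp.memLp g).norm.coeFn_toLp, (Lp.memLp g').norm.coeFn_toLp] with x h1 h2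
  rw [h1, h2]
  exact mul_comm _ _

theorem norm_mul_inner_le (hΩ : MeasurableSet Ω) (h0 : 0 ≤ ν₀)
    (hν : ∀ x ∈ Ω, ν₀ ≤ ν x ∧ ν x ≤ ν₁) (g g' : L2Vec Ω) :
    ∀ᵐ x ∂(volume.restrict Ω), ‖ν x * inner ℝ (g x) (g' x)‖ ≤ ν₁ * (‖g x‖ * ‖g' x‖) := by
  filter_upwards [ae_restrict_mem hΩ] with x hx
  rw [norm_mul, Real.norm_of_nonneg (h0.trans (hν x hx).1)]
  exact mul_le_mul (hν x hx).2 (norm_inner_le_norm _ _) (norm_nonneg _)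
    ((h0.trans (hν x hx).1).trans (hν x hx).2)

theorem integrable_diffusionForm (hΩ : MeasurableSet Ω) (h0 : 0 ≤ ν₀)
    (hm : AEStronglyMeasurable ν (volume.restrict Ω))
    (hν : ∀ x ∈ Ω, ν₀ ≤ ν x ∧ ν x ≤ ν₁) (g g' : L2Vec Ω) :
    Integrable (fun x => ν x * inner ℝ (g x) (g' x)) (volume.restrict Ω) :=
  ((integrable_norm_mul_norm g g').const_mul ν₁).mono'
    (hm.mul ((Lp.aestronglyMeasurable g).inner (Lp.aestronglyMeasurable g')))
    (norm_mul_inner_le hΩ h0 hν g g')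

theorem abs_diffusionForm_le (hΩ : MeasurableSet Ω) (h0 : 0 ≤ ν₀) (h1 : 0 ≤ ν₁)
    (hν : ∀ x ∈ Ω, ν₀ ≤ ν x ∧ ν x ≤ ν₁) (g g' : L2Vec Ω) :
    |diffusionForm Ω ν g g'| ≤ ν₁ * (‖g‖ * ‖g'‖) := by
  refine (norm_integral_le_of_norm_le ((integrable_norm_mul_norm g g').const_mul ν₁)
    (norm_mul_inner_le hΩ h0 hν g g')).trans ?_
  rw [integral_const_mul]
  exact mul_le_mul_of_nonneg_left (integral_norm_mul_norm_le g g') h1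

theorem le_diffusionForm_self (hΩ : MeasurableSet Ω) (h0 : 0 ≤ ν₀)
    (hm : AEStronglyMeasurable ν (volume.restrict Ω))
    (hν : ∀ x ∈ Ω, ν₀ ≤ ν x ∧ ν x ≤ ν₁) (g : L2Vec Ω) :
    ν₀ * ‖g‖ ^ 2 ≤ diffusionForm Ω ν g g := by
  have h1 : ν₀ * ‖g‖ ^ 2 = ∫ x in Ω, ν₀ * inner ℝ (g x) (g x) := by
    rw [integral_const_mul, ← L2.inner_def, real_inner_self_eq_norm_sq]
  rw [h1]
  refine integral_mono_ae ((L2.integrable_inner g g).const_mul ν₀)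
    (integrable_diffusionForm hΩ h0 hm hν g g) ?_
  filter_upwards [ae_restrict_mem hΩ] with x hx
  exact mul_le_mul_of_nonneg_right (hν x hx).1 real_inner_self_nonneg

theorem diffusionForm_add_left (hΩ : MeasurableSet Ω) (h0 : 0 ≤ ν₀)
    (hm : AEStronglyMeasurable ν (volume.restrict Ω))
    (hν : ∀ x ∈ Ω, ν₀ ≤ ν x ∧ ν x ≤ ν₁) (g₁ g₂ g' : L2Vec Ω) :
    diffusionForm Ω ν (g₁ + g₂) g' = diffusionForm Ω ν g₁ g' + diffusionForm Ω ν g₂ g' := by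
  rw [diffusionForm, diffusionForm, diffusionForm,
    ← integral_add (integrable_diffusionForm hΩ h0 hm hν g₁ g')
      (integrable_diffusionForm hΩ h0 hm hν g₂ g')]
  refine integral_congr_ae ?_
  filter_upwards [Lp.coeFn_add g₁ g₂] with x hx
  rw [hx, Pi.add_apply, inner_add_left, mul_add]

theorem diffusionForm_zero_right (g : L2Vec Ω) : diffusionForm Ω ν g 0 = 0 := by
  rw [diffusionForm, ← integral_zero (E d) ℝ (μ := volume.restrict Ω)]
  refine integral_congr_ae ?_
  filter_upwards [Lp.coeFn_zero (E d) 2 (volume.restrict Ω)] with x hx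
  rw [hx, Pi.zero_apply, inner_zero_right, mul_zero]

end Form

theorem integral_const_mul_sub_mul {μ : Measure (E d)} (κ : ℝ) (p q r : Lp ℝ 2 μ)
    {p' q' r' : E d → ℝ} (hp : p =ᵐ[μ] p') (hq : q =ᵐ[μ] q') (hr : r =ᵐ[μ] r') :
    ∫ x, κ * (p' x - q' x) * r' x ∂μ = κ * inner ℝ (p - q) r := by
  rw [L2.inner_def, ← integral_const_mul]
  refine integral_congr_ae ?_
  filter_upwards [hp, hq, hr, Lp.coeFn_sub p q] with x h1 h2 h3 h4
  rw [h4, Pi.sub_apply, h1, h2, h3, mul_assoc]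
  congr 1
  exact mul_comm _ _

variable {Ω : Fin 2 → Set (E d)}

local notation "τ" => traceInterface Ω

/-- The weak formulation tested on one subdomain. -/
theorem IsWeakSolution.single {T : ℝ} {ν : Fin 2 → ℝ → E d → ℝ} {κ : ℝ}
    {f : ∀ i, ℝ → X (Ω i) (interface Ω) →L[ℝ] ℝ} {u : ℝ → XX Ω} {ut0 : ℝ → ∀ i, L2 (Ω i)}
    (h : IsWeakSolution T ν κ f u ut0) {t : ℝ} (ht : t ∈ Ioc 0 T) (i : Fin 2)
    (w : X (Ω i) (interface Ω)) :
    inner ℝ (ut0 t i) (val w) + diffusionForm (Ω i) (ν i t) (grad (u t i)) (grad w)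
      + κ * inner ℝ (τ i (u t i) - τ i.rev (u t i.rev)) (τ i w) = f i t w := by
  have hI : ∀ v : XX Ω, ∫ x in interface Ω,
      κ * (tr (u t 0) x - tr (u t 1) x) * (tr (v 0) x - tr (v 1) x) ∂(surf d) =
        κ * inner ℝ (τ 0 (u t 0) - τ 1 (u t 1)) (τ 0 (v 0) - τ 1 (v 1)) := fun v => by
    refine integral_const_mul_sub_mul κ _ _ _ (coeFn_traceInterface _) (coeFn_traceInterface _) ?_
    filter_upwards [Lp.coeFn_sub (τ 0 (v 0)) (τ 1 (v 1)), coeFn_traceInterface (v 0),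
      coeFn_traceInterface (v 1)] with x h1 h2 h3
    rw [h1, Pi.sub_apply, h2, h3]
  have key := h t ht
  have hz : ∀ i, grad (0 : X (Ω i) (interface Ω)) = 0 := fun i => rfl
  have hv : ∀ i, val (0 : X (Ω i) (interface Ω)) = 0 := fun i => rfl
  fin_cases i
  · have h1 := key (fun k => Fin.cases w (fun _ => 0) k)
    rw [hI, Fin.sum_univ_two, Fin.sum_univ_two, Fin.sum_univ_two] at h1
    have h2 : inner ℝ (ut0 t 0) (val w) + inner ℝ (ut0 t 1) (val (0 : X (Ω 1) (interface Ω))) +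
        (diffusionForm (Ω 0) (ν 0 t) (grad (u t 0)) (grad w) +
          diffusionForm (Ω 1) (ν 1 t) (grad (u t 1)) (grad (0 : X (Ω 1) (interface Ω)))) +
        κ * inner ℝ (τ 0 (u t 0) - τ 1 (u t 1)) (τ 0 w - τ 1 0) = f 0 t w + f 1 t 0 := h1
    rw [hz, hv, inner_zero_right, diffusionForm_zero_right, map_zero, map_zero, sub_zero, add_zero,
      add_zero, add_zero] at h2
    exact h2
  · have h1 := key (fun k => Fin.cases 0 (fun j => Fin.cases w (fun j => j.elim0) j) k)
    rw [hI, Fin.sum_univ_two, Fin.sum_univ_two, Fin.sum_univ_two] at h1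
    have h2 : inner ℝ (ut0 t 0) (val (0 : X (Ω 0) (interface Ω))) + inner ℝ (ut0 t 1) (val w) +
        (diffusionForm (Ω 0) (ν 0 t) (grad (u t 0)) (grad (0 : X (Ω 0) (interface Ω))) +
          diffusionForm (Ω 1) (ν 1 t) (grad (u t 1)) (grad w)) +
        κ * inner ℝ (τ 0 (u t 0) - τ 1 (u t 1)) (τ 0 0 - τ 1 w) = f 0 t 0 + f 1 t w := h1
    -- Both jumps change sign when written from the second subdomain, so the formula has the same
    -- shape as on the first.
    rw [hz, hv, inner_zero_right, diffusionForm_zero_right, map_zero, map_zero, zero_add,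
      zero_add, zero_add, zero_sub, ← neg_sub (τ 1 (u t 1)), inner_neg_neg] at h2
    exact h2

/-- The energy inequality behind the error estimate, for one step on one subdomain. -/
theorem energy_step {H G : Type*} [NormedAddCommGroup H] [InnerProductSpace ℝ H]
    [NormedAddCommGroup G] [InnerProductSpace ℝ G] {φ φ' : H} {p p' q' : G}
    {Δt ν₀ κm κj A B D Y : ℝ} (hΔ : 0 < Δt) (hν : 0 < ν₀) (hκj : 0 ≤ κj) (hκ : κj ≤ κm)
    (hid : inner ℝ (Δt⁻¹ • (φ - φ')) φ + A + κm * ‖p‖ ^ 2 =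
      inner ℝ ((κm - κj) • p' + κj • q') p + B)
    (hA : ν₀ * D ^ 2 ≤ A) (hB : B ≤ Y * D) :
    ‖φ‖ ^ 2 + κm * Δt * ‖p‖ ^ 2 + ν₀ * Δt * D ^ 2 ≤
      ‖φ'‖ ^ 2 + Δt * ((κm - κj) * ‖p'‖ ^ 2 + κj * ‖q'‖ ^ 2) + Δt / ν₀ * Y ^ 2 := by
  have h1 : (‖φ‖ ^ 2 - ‖φ'‖ ^ 2) / 2 ≤ inner ℝ (φ - φ') φ := by
    rw [inner_sub_left, real_inner_self_eq_norm_sq]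
    have := real_inner_le_norm φ' φ
    nlinarith [sq_nonneg (‖φ'‖ - ‖φ‖)]
  have h2 : ∀ q : G, inner ℝ q p ≤ (‖q‖ ^ 2 + ‖p‖ ^ 2) / 2 := fun q => by
    have := real_inner_le_norm q p
    nlinarith [sq_nonneg (‖q‖ - ‖p‖)]
  -- The weights `κm - κj` and `κj` are nonnegative with sum `κm`. Young's inequality thus leaves
  -- exactly `κm / 2 * ‖p‖ ^ 2`, half of the implicit interface term, however large `κm - κj` is.
  have h3 : inner ℝ ((κm - κj) • p' + κj • q') p ≤
      (κm - κj) * ((‖p'‖ ^ 2 + ‖p‖ ^ 2) / 2) + κj * ((‖q'‖ ^ 2 + ‖p‖ ^ 2) / 2) := by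
    rw [inner_add_left, real_inner_smul_left, real_inner_smul_left]
    exact add_le_add (mul_le_mul_of_nonneg_left (h2 _) (sub_nonneg.2 hκ))
      (mul_le_mul_of_nonneg_left (h2 _) hκj)
  -- Young's inequality weighted so that half of the diffusion term absorbs `D`.
  have h4 : Y * D ≤ ν₀ / 2 * D ^ 2 + Y ^ 2 / (2 * ν₀) := by
    have h5 : 0 ≤ (ν₀ * D - Y) ^ 2 / (2 * ν₀) := by positivity
    have h6 : (ν₀ * D - Y) ^ 2 / (2 * ν₀) = ν₀ / 2 * D ^ 2 - Y * D + Y ^ 2 / (2 * ν₀) := by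
      field_simp
      ring
    linarith
  rw [real_inner_smul_left] at hid
  have h7 : Δt⁻¹ * ((‖φ‖ ^ 2 - ‖φ'‖ ^ 2) / 2) + ν₀ / 2 * D ^ 2 + κm / 2 * ‖p‖ ^ 2 ≤
      (κm - κj) / 2 * ‖p'‖ ^ 2 + κj / 2 * ‖q'‖ ^ 2 + Y ^ 2 / (2 * ν₀) := by
    have := mul_le_mul_of_nonneg_left h1 (inv_nonneg.2 hΔ.le)
    linarith
  have h8 := mul_le_mul_of_nonneg_left h7 (by positivity : 0 ≤ 2 * Δt)
  have e1 : 2 * Δt * (Δt⁻¹ * ((‖φ‖ ^ 2 - ‖φ'‖ ^ 2) / 2) + ν₀ / 2 * D ^ 2 + κm / 2 * ‖p‖ ^ 2) =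
      ‖φ‖ ^ 2 - ‖φ'‖ ^ 2 + ν₀ * Δt * D ^ 2 + κm * Δt * ‖p‖ ^ 2 := by
    field_simp
  have e2 : 2 * Δt * ((κm - κj) / 2 * ‖p'‖ ^ 2 + κj / 2 * ‖q'‖ ^ 2 + Y ^ 2 / (2 * ν₀)) =
      Δt * ((κm - κj) * ‖p'‖ ^ 2 + κj * ‖q'‖ ^ 2) + Δt / ν₀ * Y ^ 2 := by
    field_simp
  rw [e1, e2] at h8
  linarith

/-- The error equation tested with the discrete error `φ`: `u`, `u₁` are the exact solution at the
old and the new time, `w`, `w₁` their projections and `U`, `U₁` the discrete solutions. -/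
theorem error_identity {K : Fin 2 → Geometry.SimplicialComplex ℝ (E d)} {l : ℕ}
    {ν : Fin 2 → E d → ℝ} {ν₀ ν₁ κm κj Δt : ℝ} (hΩ : ∀ i, MeasurableSet (Ω i)) (h0 : 0 ≤ ν₀)
    (hm : ∀ i, AEStronglyMeasurable (ν i) (volume.restrict (Ω i)))
    (hν : ∀ i, ∀ x ∈ Ω i, ν₀ ≤ ν i x ∧ ν i x ≤ ν₁) {u u₁ w w₁ U U₁ : XX Ω}
    {ut : ∀ i, L2 (Ω i)} {f : ∀ i, X (Ω i) (interface Ω) →L[ℝ] ℝ} (i : Fin 2)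
    (hw : IsL2Proj (K i) l (u i) (w i)) (hw₁ : IsL2Proj (K i) l (u₁ i) (w₁ i))
    (hU₁ : U₁ i ∈ Xh (Ω i) (interface Ω) (K i) l)
    (hweak : ∀ v : X (Ω i) (interface Ω), inner ℝ (ut i) (val v) +
      diffusionForm (Ω i) (ν i) (grad (u₁ i)) (grad v) +
      κj * inner ℝ (τ i (u₁ i) - τ i.rev (u₁ i.rev)) (τ i v) = f i v)
    (hdisc : ∀ v ∈ Xh (Ω i) (interface Ω) (K i) l,
      inner ℝ (Δt⁻¹ • (val (U₁ i) - val (U i))) (val v) +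
      diffusionForm (Ω i) (ν i) (grad (U₁ i)) (grad v) +
      κm * inner ℝ (τ i (U₁ i) - τ i.rev (U i.rev)) (τ i v) +
      (κj - κm) * inner ℝ (τ i (U i) - τ i.rev (U i.rev)) (τ i v) = f i v) :
    inner ℝ (Δt⁻¹ • (val (w₁ i - U₁ i) - val (w i - U i))) (val (w₁ i - U₁ i)) +
      diffusionForm (Ω i) (ν i) (grad (w₁ i - U₁ i)) (grad (w₁ i - U₁ i)) +
      κm * ‖τ i (w₁ i - U₁ i)‖ ^ 2 =
    inner ℝ ((κm - κj) • τ i (w i - U i) + κj • τ i.rev (w i.rev - U i.rev)) (τ i (w₁ i - U₁ i)) +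
      (inner ℝ (Δt⁻¹ • (val (u₁ i) - val (u i)) - ut i) (val (w₁ i - U₁ i)) -
        diffusionForm (Ω i) (ν i) (grad (u₁ i - w₁ i)) (grad (w₁ i - U₁ i)) +
        inner ℝ ((κm - κj) • τ i (u₁ i - u i) + κj • τ i.rev (u₁ i.rev - u i.rev) -
          κm • τ i (u₁ i - w₁ i) + (κm - κj) • τ i (u i - w i) +
            κj • τ i.rev (u i.rev - w i.rev)) (τ i (w₁ i - U₁ i))) := by
  have hφ : w₁ i - U₁ i ∈ Xh (Ω i) (interface Ω) (K i) l := sub_mem hw₁.1 hU₁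
  have e1 := hweak (w₁ i - U₁ i)
  have e2 := hdisc _ hφ
  -- Orthogonality to the test function at both time levels removes the difference quotient of the
  -- projection error, so no time derivative of that error has to be estimated.
  have e3 := hw.2 _ hφ
  have e4 := hw₁.2 _ hφ
  have e5 : diffusionForm (Ω i) (ν i) (grad (u₁ i)) (grad (w₁ i - U₁ i)) =
      diffusionForm (Ω i) (ν i) (grad (u₁ i - w₁ i)) (grad (w₁ i - U₁ i)) +
      diffusionForm (Ω i) (ν i) (grad (w₁ i - U₁ i)) (grad (w₁ i - U₁ i)) +
      diffusionForm (Ω i) (ν i) (grad (U₁ i)) (grad (w₁ i - U₁ i)) := by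
    rw [← diffusionForm_add_left (hΩ i) h0 (hm i) (hν i),
      ← diffusionForm_add_left (hΩ i) h0 (hm i) (hν i)]
    congr 1
    have : grad (u₁ i - w₁ i) + grad (w₁ i - U₁ i) + grad (U₁ i) =
      grad (u₁ i - w₁ i + (w₁ i - U₁ i) + U₁ i) := rfl
    rw [this, sub_add_sub_cancel, sub_add_cancel]
  have e6 : val (w₁ i - U₁ i) - val (w i - U i) =
      (val (u₁ i) - val (u i)) - (val (u₁ i) - val (w₁ i)) + (val (u i) - val (w i)) -
        (val (U₁ i) - val (U i)) := by
    have h1 : val (w₁ i - U₁ i) = val (w₁ i) - val (U₁ i) := rfl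
    have h2 : val (w i - U i) = val (w i) - val (U i) := rfl
    rw [h1, h2]; abel
  rw [← real_inner_self_eq_norm_sq]
  rw [e6]
  set φ := val (w₁ i - U₁ i) with hφd
  set p := τ i (w₁ i - U₁ i) with hp
  have e7 : inner ℝ p p = inner ℝ (τ i (w₁ i)) p - inner ℝ (τ i (U₁ i)) p := by
    rw [← inner_sub_left, ← map_sub]
  rw [e7]
  simp only [map_sub, real_inner_smul_left, inner_add_left, inner_sub_left] at e1 e2 e3 e4 ⊢
  linear_combination e1 - e2 - e5 + Δt⁻¹ * e3 - Δt⁻¹ * e4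

end

section

/-! ### Summation of the energy estimates and of the data -/

/-- Adding the two subdomains turns `(κm - κj) * P i + κj * P i.rev` into `κm` times the sum of `P`,
which is what the left-hand side of the preceding step provides. The sum telescopes with constant
one. -/
theorem energy_sum {N : ℕ} {Δt ν₀ κm κj : ℝ} {A P D Y : ℕ → Fin 2 → ℝ}
    (h : ∀ n < N, ∀ i, A (n + 1) i + κm * Δt * P (n + 1) i + ν₀ * Δt * D (n + 1) i ≤
      A n i + Δt * ((κm - κj) * P n i + κj * P n i.rev) + Δt / ν₀ * Y n i) :
    ∑ i, (A N i + κm * Δt * P N i) + ν₀ * Δt * ∑ n ∈ Finset.range N, ∑ i, D (n + 1) i ≤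
      ∑ i, (A 0 i + κm * Δt * P 0 i) + Δt / ν₀ * ∑ n ∈ Finset.range N, ∑ i, Y n i := by
  induction N with
  | zero => simp
  | succ N ih =>
    have h1 := ih fun n hn => h n (hn.trans (Nat.lt_succ_self N))
    have h2 := h N (Nat.lt_succ_self N) 0
    have h3 := h N (Nat.lt_succ_self N) 1
    rw [Finset.sum_range_succ, Finset.sum_range_succ]
    simp only [Fin.sum_univ_two] at h1 ⊢
    have e0 : (0 : Fin 2).rev = 1 := rfl
    have e1 : (1 : Fin 2).rev = 0 := rfl
    rw [e0] at h2
    rw [e1] at h3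
    linarith

section Time

variable {F G : Type*} [NormedAddCommGroup F] [NormedSpace ℝ F] [NormedAddCommGroup G]
  [NormedSpace ℝ G] {T : ℝ} {u u' : ℝ → F}

theorem HasL2TimeDeriv.clm_comp [CompleteSpace F] [CompleteSpace G] (h : HasL2TimeDeriv T u u')
    (L : F →L[ℝ] G) : HasL2TimeDeriv T (fun t => L (u t)) (fun t => L (u' t)) := by
  refine ⟨L.comp_memLp' h.1, fun t ht => ?_⟩
  beta_reduce
  rw [h.2 t ht, map_add, L.intervalIntegral_comp_comm (h.intervalIntegrable le_rfl ht.1 ht.2)]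

theorem HasL2TimeDeriv.congr_deriv (h : HasL2TimeDeriv T u u') {v' : ℝ → F}
    (hv : u' =ᵐ[volume.restrict (Ioc 0 T)] v') : HasL2TimeDeriv T u v' := by
  refine ⟨h.1.ae_eq hv, fun t ht => ?_⟩
  rw [h.2 t ht]
  congr 1
  refine intervalIntegral.integral_congr_ae_restrict ?_
  rw [uIoc_of_le ht.1]
  exact ae_restrict_of_ae_restrict_of_subset (Ioc_subset_Ioc_right ht.2) hv

theorem HasL2TimeDeriv.sub {v v' : ℝ → F} (h : HasL2TimeDeriv T u u')
    (hv : HasL2TimeDeriv T v v') : HasL2TimeDeriv T (fun t => u t - v t) fun t => u' t - v' t := by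
  refine ⟨h.1.sub hv.1, fun t ht => ?_⟩
  beta_reduce
  rw [h.2 t ht, hv.2 t ht, intervalIntegral.integral_sub
    (h.intervalIntegrable le_rfl ht.1 ht.2) (hv.intervalIntegrable le_rfl ht.1 ht.2)]
  abel

end Time

theorem sum_integral_norm_sq_le {F : Fin 2 → Type*} [∀ i, NormedAddCommGroup (F i)] {T : ℝ}
    (hT : 0 ≤ T) {v : ℝ → ∀ i, F i}
    (h : ∀ i, MemLp (fun t => v t i) 2 (volume.restrict (Ioc 0 T))) :
    ∑ i, ∫ t in (0 : ℝ)..T, ‖v t i‖ ^ 2 ≤ ∫ t in (0 : ℝ)..T, (∑ i, ‖v t i‖) ^ 2 := by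
  have h1 : ∀ i, IntervalIntegrable (fun t => ‖v t i‖ ^ 2) volume 0 T := fun i =>
    intervalIntegrable_norm_sq_of_memLp (h i) le_rfl hT le_rfl
  have h2 : MemLp (fun t => ∑ i, ‖v t i‖) 2 (volume.restrict (Ioc 0 T)) :=
    memLp_finsetSum _ fun i _ => (h i).norm
  have h3 : IntervalIntegrable (fun t => (∑ i, ‖v t i‖) ^ 2) volume 0 T := by
    have := intervalIntegrable_norm_sq_of_memLp h2 le_rfl hT le_rfl
    simpa only [Real.norm_eq_abs, sq_abs] using this
  rw [← intervalIntegral.integral_finsetSum fun i _ => h1 i]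
  refine intervalIntegral.integral_mono_on hT (?_ : IntervalIntegrable _ _ _ _) h3
    fun t _ => ?_
  · have := IntervalIntegrable.sum Finset.univ fun i _ => h1 i
    rwa [Finset.sum_fn] at this
  · exact Finset.sum_sq_le_sq_sum_of_nonneg fun i _ => norm_nonneg _

theorem sum_sq_le_sq_sum (x : Fin 2 → ℝ) (h : ∀ i, 0 ≤ x i) : ∑ i, x i ^ 2 ≤ (∑ i, x i) ^ 2 := by
  simp only [Fin.sum_univ_two]
  nlinarith [mul_nonneg (h 0) (h 1)]

theorem sq_sum_le (x : Fin 2 → ℝ) : (∑ i, x i) ^ 2 ≤ 2 * ∑ i, x i ^ 2 := by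
  simp only [Fin.sum_univ_two]
  nlinarith [sq_nonneg (x 0 - x 1)]

variable {Ω : Fin 2 → Set (E d)}

local notation "τ" => traceInterface Ω

theorem nrmInterface_eq (v : XX Ω) : nrmInterface v = ∑ i, ‖τ i (v i)‖ :=
  Finset.sum_congr rfl fun i _ => sqrt_integral_tr_sq (v i)

variable {T : ℝ} {u ut : ℝ → XX Ω} {ut0 utt : ℝ → ∀ i, L2 (Ω i)}

theorem IsRegularInTime.deriv_val (h : IsRegularInTime T u ut ut0 utt) (i : Fin 2) :
    HasL2TimeDeriv T (fun t => val (u t i)) fun t => ut0 t i :=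
  ((h.deriv_u i).clm_comp (ContinuousLinearMap.fst ℝ (L2 (Ω i)) (L2Vec (Ω i) × L2Bdry (Ω i)))
    ).congr_deriv (h.ut_eq i)

theorem IsRegularInTime.deriv_grad (h : IsRegularInTime T u ut ut0 utt) (i : Fin 2) :
    HasL2TimeDeriv T (fun t => grad (u t i)) fun t => grad (ut t i) :=
  (h.deriv_u i).clm_comp ((ContinuousLinearMap.fst ℝ (L2Vec (Ω i)) (L2Bdry (Ω i))).comp
    (ContinuousLinearMap.snd ℝ (L2 (Ω i)) (L2Vec (Ω i) × L2Bdry (Ω i))))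

variable {K : Fin 2 → Geometry.SimplicialComplex ℝ (E d)} {l : ℕ}

/-- The projection error at the final time, in terms of the approximation in `H¹(0,T;X_h)`. -/
theorem sum_projection_error_le (hT : 0 ≤ T) (h : IsRegularInTime T u ut ut0 utt) {p₀ p₁ : XX Ω}
    (hp₀ : ∀ i, IsL2Proj (K i) l (u 0 i) (p₀ i)) (hp₁ : ∀ i, IsL2Proj (K i) l (u T i) (p₁ i)) :
    ∑ i, ‖val (u T i) - val (p₁ i)‖ ^ 2 ≤
      2 * ∑ i, ‖val (u 0 i) - val (p₀ i)‖ ^ 2 + 2 * (T * bestDeriv K l T ut0) := by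
  suffices hs : ∀ r ∈ {r | ∃ (v : ℝ → XXh Ω K l) (v' : ℝ → ∀ i, L2 (Ω i)),
      (∀ i, HasL2TimeDeriv T (fun t => val (v t i).1) (fun t => v' t i)) ∧
      r = ∫ t in (0 : ℝ)..T, normL2 (fun i => ut0 t i - v' t i) ^ 2},
      ∑ i, ‖val (u T i) - val (p₁ i)‖ ^ 2 ≤
        2 * ∑ i, ‖val (u 0 i) - val (p₀ i)‖ ^ 2 + 2 * (T * r) by
    have hne : {r | ∃ (v : ℝ → XXh Ω K l) (v' : ℝ → ∀ i, L2 (Ω i)),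
        (∀ i, HasL2TimeDeriv T (fun t => val (v t i).1) (fun t => v' t i)) ∧
        r = ∫ t in (0 : ℝ)..T, normL2 (fun i => ut0 t i - v' t i) ^ 2}.Nonempty := by
      refine ⟨_, fun _ _ => 0, fun _ _ => 0, fun i => ⟨MemLp.zero, fun t _ => ?_⟩, rfl⟩
      rw [intervalIntegral.integral_zero, add_zero]
    -- Passing to the infimum divides by `T`, so `T = 0` is separate; there any single member of the
    -- set suffices.
    rcases hT.eq_or_lt with h0 | hpos
    · obtain ⟨r, hr⟩ := hne
      have := hs r hr
      rw [← h0, zero_mul] at this ⊢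
      exact this
    · have h1 : (∑ i, ‖val (u T i) - val (p₁ i)‖ ^ 2 -
          2 * ∑ i, ‖val (u 0 i) - val (p₀ i)‖ ^ 2) / (2 * T) ≤ bestDeriv K l T ut0 := by
        refine le_csInf hne fun r hr => ?_
        rw [div_le_iff₀ (by positivity)]
        linarith [hs r hr]
      rw [div_le_iff₀ (by positivity)] at h1
      linarith
  rintro r ⟨v, v', hv, rfl⟩
  have hT' : T ∈ Icc 0 T := ⟨hT, le_rfl⟩
  have hd : ∀ i, HasL2TimeDeriv T (fun t => val (u t i) - val (v t i).1)
      fun t => ut0 t i - v' t i := fun i => (h.deriv_val i).sub (hv i)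
  have key : ∀ i, ‖val (u T i) - val (p₁ i)‖ ^ 2 ≤ 2 * ‖val (u 0 i) - val (p₀ i)‖ ^ 2 +
      2 * (T * ∫ t in (0 : ℝ)..T, ‖ut0 t i - v' t i‖ ^ 2) := by
    intro i
    -- The competitor `p₀ + v(T) - v(0)` carries the initial projection error along; what is left is
    -- the increment of `u - v` over `[0, T]`, the integral of its derivative.
    have h1 := (hp₁ i).norm_sub_le (v := p₀ i + ((v T i).1 - (v 0 i).1))
      (add_mem (hp₀ i).1 (sub_mem (v T i).2 (v 0 i).2))
    have h2 := (hd i).norm_sub_sq_le le_rfl hT le_rfl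
    rw [sub_zero] at h2
    have e : val (u T i) - val (p₀ i + ((v T i).1 - (v 0 i).1)) =
        (val (u 0 i) - val (p₀ i)) +
          (val (u T i) - val (v T i).1 - (val (u 0 i) - val (v 0 i).1)) := by
      have : val (p₀ i + ((v T i).1 - (v 0 i).1)) =
        val (p₀ i) + (val (v T i).1 - val (v 0 i).1) := rfl
      rw [this]; abel
    rw [e] at h1
    have h3 := norm_add_le (val (u 0 i) - val (p₀ i))
      (val (u T i) - val (v T i).1 - (val (u 0 i) - val (v 0 i).1))
    have h4 := pow_le_pow_left₀ (norm_nonneg _) h3 2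
    have h5 := sq_nonneg (‖val (u 0 i) - val (p₀ i)‖ -
      ‖val (u T i) - val (v T i).1 - (val (u 0 i) - val (v 0 i).1)‖)
    nlinarith [sq_nonneg ‖val (p₁ i) - val (p₀ i + ((v T i).1 - (v 0 i).1))‖]
  have h6 := sum_integral_norm_sq_le hT (v := fun t i => ut0 t i - v' t i) fun i => (hd i).1
  have h7 := mul_le_mul_of_nonneg_left h6 hT
  refine (Finset.sum_le_sum fun i _ => key i).trans ?_
  rw [Finset.sum_add_distrib, ← Finset.mul_sum, ← Finset.mul_sum, ← Finset.mul_sum]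
  exact add_le_add_right (mul_le_mul_of_nonneg_left h7 zero_le_two) _

instance : Nonempty (XXh Ω K l) := ⟨fun _ => 0⟩

theorem sum_projection_error_le_bestInitial {κ : ℝ} (hκ : 0 ≤ κ) {w p : XX Ω}
    (hp : ∀ i, IsL2Proj (K i) l (w i) (p i)) :
    ∑ i, ‖val (w i) - val (p i)‖ ^ 2 ≤ bestInitial K l κ w := by
  refine le_ciInf fun v => ?_
  have h1 : ∑ i, ‖val (w i) - val (p i)‖ ^ 2 ≤ ∑ i, ‖val ((w - v.toXX) i)‖ ^ 2 :=
    Finset.sum_le_sum fun i _ => by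
      have h2 := (hp i).norm_sub_le (v := (v i).1) (v i).2
      have e : val ((w - v.toXX) i) = val (w i) - val (v i).1 := rfl
      rw [e]
      linarith [sq_nonneg ‖val (p i) - val (v i).1‖]
  have h3 := sum_sq_le_sq_sum (fun i => ‖val ((w - v.toXX) i)‖) fun i => norm_nonneg _
  have h4 : 0 ≤ κ * nrmInterface (w - v.toXX) ^ 2 := mul_nonneg hκ (sq_nonneg _)
  exact h1.trans (h3.trans (le_add_of_nonneg_right h4))

theorem norm_grad_projection_error_le {C : ℝ} {w p : XX Ω}
    (hC : ∀ i, ∀ v ∈ Xh (Ω i) (interface Ω) (K i) l, ‖grad (w i - p i)‖ ≤ C * ‖grad (w i - v)‖)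
    (i : Fin 2) : ‖grad (w i - p i)‖ ^ 2 ≤ C ^ 2 * bestGrad K l w := by
  rw [bestGrad, Real.mul_iInf_of_nonneg (sq_nonneg C)]
  refine le_ciInf fun v => ?_
  have h1 := pow_le_pow_left₀ (norm_nonneg _) (hC i (v i).1 (v i).2) 2
  rw [mul_pow] at h1
  refine h1.trans (mul_le_mul_of_nonneg_left ?_ (sq_nonneg C))
  refine pow_le_pow_left₀ (norm_nonneg _) ?_ 2
  exact Finset.single_le_sum (f := fun i => ‖grad ((w - v.toXX) i)‖)
    (fun i _ => norm_nonneg _) (Finset.mem_univ i)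

end

section

/-! ### The error estimate for one member of the ensemble -/

theorem sq_consistency_le {CF CT κ ν₁ r h h' g' x x' y : ℝ} (hCT : 0 ≤ CT)
    (hy0 : 0 ≤ y) (hy : y ≤ κ * CT * (x + x' + h + h' + g')) :
    (CF * r + ν₁ * h + CT * y) ^ 2 ≤ 3 * CF ^ 2 * r ^ 2 + 3 * ν₁ ^ 2 * h ^ 2 +
      15 * κ ^ 2 * CT ^ 4 * (x ^ 2 + x' ^ 2 + h ^ 2 + h' ^ 2 + g' ^ 2) := by
  have h1 : ∀ a b c : ℝ, (a + b + c) ^ 2 ≤ 3 * a ^ 2 + 3 * b ^ 2 + 3 * c ^ 2 := fun a b c => by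
    nlinarith [sq_nonneg (a - b), sq_nonneg (b - c), sq_nonneg (a - c)]
  have h2 : (x + x' + h + h' + g') ^ 2 ≤ 5 * (x ^ 2 + x' ^ 2 + h ^ 2 + h' ^ 2 + g' ^ 2) := by
    nlinarith [sq_nonneg (x - x'), sq_nonneg (x - h), sq_nonneg (x - h'), sq_nonneg (x - g'),
      sq_nonneg (x' - h), sq_nonneg (x' - h'), sq_nonneg (x' - g'), sq_nonneg (h - h'),
      sq_nonneg (h - g'), sq_nonneg (h' - g')]
  have h4 : (CT * y) ^ 2 ≤ 5 * κ ^ 2 * CT ^ 4 * (x ^ 2 + x' ^ 2 + h ^ 2 + h' ^ 2 + g' ^ 2) := by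
    calc (CT * y) ^ 2 ≤ (CT * (κ * CT * (x + x' + h + h' + g'))) ^ 2 :=
          pow_le_pow_left₀ (mul_nonneg hCT hy0) (mul_le_mul_of_nonneg_left hy hCT) 2
      _ = κ ^ 2 * CT ^ 4 * (x + x' + h + h' + g') ^ 2 := by ring
      _ ≤ κ ^ 2 * CT ^ 4 * (5 * (x ^ 2 + x' ^ 2 + h ^ 2 + h' ^ 2 + g' ^ 2)) :=
          mul_le_mul_of_nonneg_left h2 (by positivity)
      _ = _ := by ring
  refine (h1 _ _ _).trans ?_
  rw [mul_pow, mul_pow]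
  linarith

theorem norm_interface_consistency_le {G : Type*} [NormedAddCommGroup G] [NormedSpace ℝ G]
    {κm κj κ : ℝ} (hj : 0 ≤ κj) (hjm : κj ≤ κm) (hm : κm ≤ κ) (x x' h h' g' : G) :
    ‖(κm - κj) • x + κj • x' - κm • h + (κm - κj) • h' + κj • g'‖ ≤
      κ * (‖x‖ + ‖x'‖ + ‖h‖ + ‖h'‖ + ‖g'‖) := by
  have key : ∀ c : ℝ, 0 ≤ c → c ≤ κ → ∀ v : G, ‖c • v‖ ≤ κ * ‖v‖ := fun c hc hcκ v => by
    rw [norm_smul, Real.norm_of_nonneg hc]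
    exact mul_le_mul_of_nonneg_right hcκ (norm_nonneg _)
  have k1 := key (κm - κj) (by linarith) (by linarith) x
  have k2 := key κj hj (hjm.trans hm) x'
  have k3 := key κm (hj.trans hjm) hm h
  have k4 := key (κm - κj) (by linarith) (by linarith) h'
  have k5 := key κj hj (hjm.trans hm) g'
  calc _ ≤ ‖(κm - κj) • x + κj • x' - κm • h + (κm - κj) • h'‖ + ‖κj • g'‖ := norm_add_le _ _
    _ ≤ ‖(κm - κj) • x + κj • x' - κm • h‖ + ‖(κm - κj) • h'‖ + ‖κj • g'‖ := by
        gcongr; exact norm_add_le _ _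
    _ ≤ ‖(κm - κj) • x + κj • x'‖ + ‖κm • h‖ + ‖(κm - κj) • h'‖ + ‖κj • g'‖ := by
        gcongr; exact norm_sub_le _ _
    _ ≤ ‖(κm - κj) • x‖ + ‖κj • x'‖ + ‖κm • h‖ + ‖(κm - κj) • h'‖ + ‖κj • g'‖ := by
        gcongr; exact norm_add_le _ _
    _ ≤ _ := by linarith

variable {Ω : Fin 2 → Set (E d)}

local notation "τ" => traceInterface Ω

/-- One step of Algorithm A1, with the interface integrals written as inner products. -/
theorem IsA1Solution.step {K : Fin 2 → Geometry.SimplicialComplex ℝ (E d)} {l : ℕ} {Δt : ℝ}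
    {N : ℕ} {ν : Fin 2 → ℝ → E d → ℝ} {J : ℕ} {κ : Fin J → ℝ}
    {f : Fin J → ∀ i, ℝ → X (Ω i) (interface Ω) →L[ℝ] ℝ} {U : Fin J → ℕ → XXh Ω K l}
    (h : IsA1Solution Δt N ν κ f U) {n : ℕ} (hn : n < N) (j : Fin J) (i : Fin 2)
    (v : X (Ω i) (interface Ω)) (hv : v ∈ Xh (Ω i) (interface Ω) (K i) l) :
    inner ℝ (Δt⁻¹ • (val ((U j (n + 1)).toXX i) - val ((U j n).toXX i))) (val v) +
      diffusionForm (Ω i) (ν i ((n + 1 : ℕ) * Δt)) (grad ((U j (n + 1)).toXX i)) (grad v) +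
      kmax κ * inner ℝ (τ i ((U j (n + 1)).toXX i) - τ i.rev ((U j n).toXX i.rev)) (τ i v) +
      (κ j - kmax κ) * inner ℝ (τ i ((U j n).toXX i) - τ i.rev ((U j n).toXX i.rev)) (τ i v) =
    f j i ((n + 1 : ℕ) * Δt) v := by
  have h1 := h n hn j i ⟨v, hv⟩
  rw [integral_const_mul_sub_mul (μ := (surf d).restrict (interface Ω)) (kmax κ)
      (τ i (U j (n + 1) i).1) (τ i.rev (U j n i.rev).1) (τ i v) (coeFn_traceInterface _)
      (coeFn_traceInterface _) (coeFn_traceInterface _),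
    integral_const_mul_sub_mul (μ := (surf d).restrict (interface Ω)) (κ j - kmax κ)
      (τ i (U j n i).1) (τ i.rev (U j n i.rev).1) (τ i v) (coeFn_traceInterface _)
      (coeFn_traceInterface _) (coeFn_traceInterface _)] at h1
  exact h1

/-- The data of one member of the ensemble: the exact solution `u`, the discrete solution `U`, the
projections `w` of the exact solution, and the constants of the Friedrichs, trace and projection
estimates. -/
structure ErrorData (Ω : Fin 2 → Set (E d)) (K : Fin 2 → Geometry.SimplicialComplex ℝ (E d))
    (l : ℕ) (T Δt : ℝ) (N : ℕ) (ν₀ ν₁ κm κj κ CF CT CP : ℝ) (ν : Fin 2 → ℝ → E d → ℝ)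
    (f : ∀ i, ℝ → X (Ω i) (interface Ω) →L[ℝ] ℝ)
    (u ut : ℝ → XX Ω) (ut0 utt : ℝ → ∀ i, L2 (Ω i)) (U : ℕ → XX Ω) (w : ℕ → XX Ω) : Prop where
  meas : ∀ i, MeasurableSet (Ω i)
  step_pos : 0 < Δt
  time_eq : N * Δt = T
  diffusion_pos : 0 < ν₀
  diffusion_meas : ∀ i, ∀ t ∈ Icc 0 T, AEStronglyMeasurable (ν i t) (volume.restrict (Ω i))
  diffusion_le : ∀ i, ∀ t ∈ Icc 0 T, ∀ x ∈ Ω i, ν₀ ≤ ν i t x ∧ ν i t x ≤ ν₁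
  diffusion_max : 0 ≤ ν₁
  friction_nonneg : 0 ≤ κj
  friction_le : κj ≤ κm
  friction_max : κm ≤ κ
  CT_nonneg : 0 ≤ CT
  friedrichs : ∀ i, ∀ v : X (Ω i) (interface Ω), ‖val v‖ ≤ CF * ‖grad v‖
  trace : ∀ i, ∀ v : X (Ω i) (interface Ω), ‖traceInterface Ω i v‖ ≤ CT * ‖grad v‖
  stable : ∀ i, ∀ w p : X (Ω i) (interface Ω), IsL2Proj (K i) l w p →
    ∀ v ∈ Xh (Ω i) (interface Ω) (K i) l, ‖grad (w - p)‖ ≤ CP * ‖grad (w - v)‖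
  regular : IsRegularInTime T u ut ut0 utt
  weak : IsWeakSolution T ν κj f u ut0
  proj : ∀ (n : ℕ) i, IsL2Proj (K i) l (u (n * Δt) i) (w n i)
  mem : ∀ (n : ℕ) i, U n i ∈ Xh (Ω i) (interface Ω) (K i) l
  scheme : ∀ n < N, ∀ i, ∀ v ∈ Xh (Ω i) (interface Ω) (K i) l,
    inner ℝ (Δt⁻¹ • (val (U (n + 1) i) - val (U n i))) (val v) +
      diffusionForm (Ω i) (ν i ((n + 1 : ℕ) * Δt)) (grad (U (n + 1) i)) (grad v) +
      κm * inner ℝ (traceInterface Ω i (U (n + 1) i) - traceInterface Ω i.rev (U n i.rev)) (traceInterface Ω i v) +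
      (κj - κm) * inner ℝ (traceInterface Ω i (U n i) - traceInterface Ω i.rev (U n i.rev)) (traceInterface Ω i v) =
    f i ((n + 1 : ℕ) * Δt) v

namespace ErrorData

variable {K : Fin 2 → Geometry.SimplicialComplex ℝ (E d)}
    {l : ℕ} {T Δt : ℝ} {N : ℕ} {ν₀ ν₁ κm κj κ CF CT CP : ℝ} {ν : Fin 2 → ℝ → E d → ℝ}
    {f : ∀ i, ℝ → X (Ω i) (interface Ω) →L[ℝ] ℝ}
    {u ut : ℝ → XX Ω} {ut0 utt : ℝ → ∀ i, L2 (Ω i)} {U : ℕ → XX Ω} {w : ℕ → XX Ω}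

theorem time_nonneg (h : ErrorData Ω K l T Δt N ν₀ ν₁ κm κj κ CF CT CP ν f u ut ut0 utt U w) :
    0 ≤ T := by
  rw [← h.time_eq]; exact mul_nonneg (Nat.cast_nonneg _) h.step_pos.le

theorem time_mem (h : ErrorData Ω K l T Δt N ν₀ ν₁ κm κj κ CF CT CP ν f u ut ut0 utt U w)
    {n : ℕ} (hn : n ≤ N) : (n : ℝ) * Δt ∈ Icc 0 T := by
  refine ⟨mul_nonneg (Nat.cast_nonneg _) h.step_pos.le, ?_⟩
  rw [← h.time_eq]
  exact mul_le_mul_of_nonneg_right (by exact_mod_cast hn) h.step_pos.le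

/-- The squared bracket bounds the dual norm of the consistency error: its three terms, tested with
the discrete error, are bounded by the gradient of the latter through Friedrichs' inequality, the
bound on the diffusion and the trace inequality. -/
theorem energy (h : ErrorData Ω K l T Δt N ν₀ ν₁ κm κj κ CF CT CP ν f u ut ut0 utt U w) :
    ∑ i, (‖val (w N i - U N i)‖ ^ 2 + κm * Δt * ‖τ i (w N i - U N i)‖ ^ 2) +
      ν₀ * Δt * ∑ n ∈ Finset.range N, ∑ i, ‖grad (w (n + 1) i - U (n + 1) i)‖ ^ 2 ≤
    ∑ i, (‖val (w 0 i - U 0 i)‖ ^ 2 + κm * Δt * ‖τ i (w 0 i - U 0 i)‖ ^ 2) +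
      Δt / ν₀ * ∑ n ∈ Finset.range N, ∑ i,
        (CF * ‖Δt⁻¹ • (val (u ((n + 1 : ℕ) * Δt) i) - val (u (n * Δt) i)) -
            ut0 ((n + 1 : ℕ) * Δt) i‖ +
          ν₁ * ‖grad (u ((n + 1 : ℕ) * Δt) i - w (n + 1) i)‖ +
          CT * ‖(κm - κj) • τ i (u ((n + 1 : ℕ) * Δt) i - u (n * Δt) i) +
            κj • τ i.rev (u ((n + 1 : ℕ) * Δt) i.rev - u (n * Δt) i.rev) -
            κm • τ i (u ((n + 1 : ℕ) * Δt) i - w (n + 1) i) +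
            (κm - κj) • τ i (u (n * Δt) i - w n i) +
            κj • τ i.rev (u (n * Δt) i.rev - w n i.rev)‖) ^ 2 := by
  refine energy_sum (A := fun n i => ‖val (w n i - U n i)‖ ^ 2)
    (P := fun n i => ‖τ i (w n i - U n i)‖ ^ 2) (D := fun n i => ‖grad (w n i - U n i)‖ ^ 2)
    (κj := κj) fun n hn i => ?_
  have ht : ((n + 1 : ℕ) : ℝ) * Δt ∈ Icc 0 T := h.time_mem hn
  have ht0 : ((n + 1 : ℕ) : ℝ) * Δt ∈ Ioc 0 T :=
    ⟨mul_pos (by exact_mod_cast Nat.succ_pos n) h.step_pos, ht.2⟩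
  have hid := error_identity (Ω := Ω) (K := K) (l := l) (ν := fun i => ν i ((n + 1 : ℕ) * Δt))
    (ν₀ := ν₀) (ν₁ := ν₁) (κm := κm) (κj := κj) (Δt := Δt) h.meas h.diffusion_pos.le
    (fun i => h.diffusion_meas i _ ht) (fun i => h.diffusion_le i _ ht)
    (u := u (n * Δt)) (u₁ := u ((n + 1 : ℕ) * Δt)) (w := w n) (w₁ := w (n + 1))
    (U := U n) (U₁ := U (n + 1)) (ut := ut0 ((n + 1 : ℕ) * Δt))
    (f := fun i => f i ((n + 1 : ℕ) * Δt)) i (h.proj n i) (h.proj (n + 1) i) (h.mem (n + 1) i)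
    (fun v => h.weak.single ht0 i v) (h.scheme n hn i)
  have hφ := h.friedrichs i (w (n + 1) i - U (n + 1) i)
  have hp := h.trace i (w (n + 1) i - U (n + 1) i)
  refine energy_step h.step_pos h.diffusion_pos h.friction_nonneg h.friction_le hid
    (le_diffusionForm_self (h.meas i) h.diffusion_pos.le (h.diffusion_meas i _ ht)
      (h.diffusion_le i _ ht) _) ?_
  rw [add_mul, add_mul]
  refine add_le_add ?_ ?_
  · rw [sub_eq_add_neg]
    refine add_le_add ?_ ?_
    · refine (real_inner_le_norm _ _).trans ((mul_le_mul_of_nonneg_left hφ (norm_nonneg _)).trans ?_)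
      exact le_of_eq (by ring)
    · refine (neg_le_abs _).trans ((abs_diffusionForm_le (h.meas i) h.diffusion_pos.le
        h.diffusion_max (h.diffusion_le i _ ht) _ _).trans ?_)
      exact le_of_eq (by ring)
  · refine (real_inner_le_norm _ _).trans ((mul_le_mul_of_nonneg_left hp (norm_nonneg _)).trans ?_)
    exact le_of_eq (by ring)

/-- The truncation error gives `utt`, the lag of the interface values gives `grad (ut r i)`, and the
projection errors at the two time levels give `G`. The increment on a subdomain is seen from both
sides, whence `30 = 2 * 15`; three projection errors on each of two subdomains give `90 = 6 * 15`.
-/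
theorem consistency (h : ErrorData Ω K l T Δt N ν₀ ν₁ κm κj κ CF CT CP ν f u ut ut0 utt U w)
    {G : ℝ} (hG : ∀ n ≤ N, bestGrad K l (u (n * Δt)) ≤ G) {n : ℕ} (hn : n < N) :
    ∑ i, (CF * ‖Δt⁻¹ • (val (u ((n + 1 : ℕ) * Δt) i) - val (u (n * Δt) i)) -
            ut0 ((n + 1 : ℕ) * Δt) i‖ +
          ν₁ * ‖grad (u ((n + 1 : ℕ) * Δt) i - w (n + 1) i)‖ +
          CT * ‖(κm - κj) • τ i (u ((n + 1 : ℕ) * Δt) i - u (n * Δt) i) +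
            κj • τ i.rev (u ((n + 1 : ℕ) * Δt) i.rev - u (n * Δt) i.rev) -
            κm • τ i (u ((n + 1 : ℕ) * Δt) i - w (n + 1) i) +
            (κm - κj) • τ i (u (n * Δt) i - w n i) +
            κj • τ i.rev (u (n * Δt) i.rev - w n i.rev)‖) ^ 2 ≤
      3 * CF ^ 2 * (Δt * ∑ i, ∫ r in (n : ℝ) * Δt..((n + 1 : ℕ) : ℝ) * Δt, ‖utt r i‖ ^ 2) +
      30 * κ ^ 2 * CT ^ 4 *
        (Δt * ∑ i, ∫ r in (n : ℝ) * Δt..((n + 1 : ℕ) : ℝ) * Δt, ‖grad (ut r i)‖ ^ 2) +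
      (6 * ν₁ ^ 2 + 90 * κ ^ 2 * CT ^ 4) * (CP ^ 2 * G) := by
  have ht := h.time_mem hn.le
  have ht' : ((n + 1 : ℕ) : ℝ) * Δt ∈ Icc 0 T := h.time_mem hn
  have hsub : ((n + 1 : ℕ) : ℝ) * Δt - n * Δt = Δt := by push_cast; ring
  have hlt : (n : ℝ) * Δt < ((n + 1 : ℕ) : ℝ) * Δt := by linarith [h.step_pos]
  have hη : ∀ m ≤ N, ∀ i, ‖grad (u (m * Δt) i - w m i)‖ ^ 2 ≤ CP ^ 2 * G := fun m hm i =>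
    (norm_grad_projection_error_le (K := K) (l := l) (w := u (m * Δt)) (p := w m)
      (fun i => h.stable i _ _ (h.proj m i)) i).trans
        (mul_le_mul_of_nonneg_left (hG m hm) (sq_nonneg _))
  have hR : ∀ i, ‖Δt⁻¹ • (val (u ((n + 1 : ℕ) * Δt) i) - val (u (n * Δt) i)) -
      ut0 ((n + 1 : ℕ) * Δt) i‖ ^ 2 ≤
      Δt * ∫ r in (n : ℝ) * Δt..((n + 1 : ℕ) : ℝ) * Δt, ‖utt r i‖ ^ 2 := fun i => by
    have h1 := norm_difference_quotient_sub_sq_le (h.regular.deriv_val i) (h.regular.deriv_ut i)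
      ht.1 hlt ht'.2
    rwa [hsub] at h1
  have hZ : ∀ i, ‖grad (u ((n + 1 : ℕ) * Δt) i - u (n * Δt) i)‖ ^ 2 ≤
      Δt * ∫ r in (n : ℝ) * Δt..((n + 1 : ℕ) : ℝ) * Δt, ‖grad (ut r i)‖ ^ 2 := fun i => by
    have h1 := (h.regular.deriv_grad i).norm_sub_sq_le ht.1 hlt.le ht'.2
    rwa [hsub] at h1
  have hκ : 0 ≤ κ := (h.friction_nonneg.trans h.friction_le).trans h.friction_max
  have key : ∀ i, _ := fun i => sq_consistency_le (CF := CF) (ν₁ := ν₁) (κ := κ)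
    (r := ‖Δt⁻¹ • (val (u ((n + 1 : ℕ) * Δt) i) - val (u (n * Δt) i)) -
      ut0 ((n + 1 : ℕ) * Δt) i‖)
    (x := ‖grad (u ((n + 1 : ℕ) * Δt) i - u (n * Δt) i)‖)
    (x' := ‖grad (u ((n + 1 : ℕ) * Δt) i.rev - u (n * Δt) i.rev)‖)
    (h := ‖grad (u ((n + 1 : ℕ) * Δt) i - w (n + 1) i)‖)
    (h' := ‖grad (u (n * Δt) i - w n i)‖) (g' := ‖grad (u (n * Δt) i.rev - w n i.rev)‖)
    h.CT_nonneg (norm_nonneg ((κm - κj) • τ i (u ((n + 1 : ℕ) * Δt) i - u (n * Δt) i) +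
            κj • τ i.rev (u ((n + 1 : ℕ) * Δt) i.rev - u (n * Δt) i.rev) -
            κm • τ i (u ((n + 1 : ℕ) * Δt) i - w (n + 1) i) +
            (κm - κj) • τ i (u (n * Δt) i - w n i) +
            κj • τ i.rev (u (n * Δt) i.rev - w n i.rev)))
    ((norm_interface_consistency_le h.friction_nonneg h.friction_le h.friction_max _ _ _ _ _).trans
      (by
        rw [mul_assoc]
        refine mul_le_mul_of_nonneg_left ?_ hκ
        rw [mul_add, mul_add, mul_add, mul_add]
        gcongr <;> exact h.trace _ _))
  have hc1 : 0 ≤ 3 * CF ^ 2 := by positivity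
  have hc2 : 0 ≤ 3 * ν₁ ^ 2 := by positivity
  have hc3 : 0 ≤ 15 * κ ^ 2 * CT ^ 4 := by positivity
  have key2 := fun i => (key i).trans (add_le_add (add_le_add
    (mul_le_mul_of_nonneg_left (hR i) hc1)
    (mul_le_mul_of_nonneg_left (hη (n + 1) hn i) hc2))
    (mul_le_mul_of_nonneg_left (add_le_add (add_le_add (add_le_add (add_le_add (hZ i) (hZ i.rev))
      (hη (n + 1) hn i)) (hη n hn.le i)) (hη n hn.le i.rev)) hc3))
  refine (Finset.sum_le_sum fun i _ => key2 i).trans (le_of_eq ?_)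
  simp only [Fin.sum_univ_two]
  have e0 : (0 : Fin 2).rev = 1 := rfl
  have e1 : (1 : Fin 2).rev = 0 := rfl
  rw [e0, e1]
  ring

end ErrorData

end

section

/-! ### The error estimate -/

variable {Ω : Fin 2 → Set (E d)}

local notation "τ" => traceInterface Ω

theorem norm_add_sq_le_two_mul {F : Type*} [NormedAddCommGroup F] (x y : F) :
    ‖x + y‖ ^ 2 ≤ 2 * ‖x‖ ^ 2 + 2 * ‖y‖ ^ 2 := by
  have h1 := pow_le_pow_left₀ (norm_nonneg _) (norm_add_le x y) 2
  linarith [sq_nonneg (‖x‖ - ‖y‖)]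

theorem norm_sub_sq_le_two_mul {F : Type*} [NormedAddCommGroup F] (x y : F) :
    ‖x - y‖ ^ 2 ≤ 2 * ‖x‖ ^ 2 + 2 * ‖y‖ ^ 2 := by
  rw [sub_eq_add_neg, ← norm_neg y]
  exact norm_add_sq_le_two_mul x (-y)

theorem bestGrad_nonneg (K : Fin 2 → Geometry.SimplicialComplex ℝ (E d)) (l : ℕ) (u : XX Ω) :
    0 ≤ bestGrad K l u :=
  Real.iInf_nonneg fun _ => sq_nonneg _

theorem bestInitial_nonneg (K : Fin 2 → Geometry.SimplicialComplex ℝ (E d)) (l : ℕ) {κ : ℝ}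
    (hκ : 0 ≤ κ) (u : XX Ω) : 0 ≤ bestInitial K l κ u :=
  Real.iInf_nonneg fun _ => add_nonneg (sq_nonneg _) (mul_nonneg hκ (sq_nonneg _))

theorem bestDeriv_nonneg (K : Fin 2 → Geometry.SimplicialComplex ℝ (E d)) (l : ℕ) {T : ℝ}
    (hT : 0 ≤ T) (ut0 : ℝ → ∀ i, L2 (Ω i)) : 0 ≤ bestDeriv K l T ut0 := by
  refine Real.sInf_nonneg ?_
  rintro r ⟨v, v', -, rfl⟩
  exact intervalIntegral.integral_nonneg hT fun _ _ => sq_nonneg _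

/-- Collects the coefficients of the separate estimates into one constant; the purely numerical ones
are at most `8`. -/
theorem weighted_sum_le {p q r b₁ b₂ b₃ b₄ b₅ b₆ b₇ : ℝ} (hp : 0 ≤ p) (hq : 0 ≤ q) (hr : 0 ≤ r)
    (h₁ : 0 ≤ b₁) (h₂ : 0 ≤ b₂) (h₃ : 0 ≤ b₃) (h₄ : 0 ≤ b₄) (h₅ : 0 ≤ b₅) (h₆ : 0 ≤ b₆)
    (h₇ : 0 ≤ b₇) :
    4 * b₁ + 8 * b₂ + p * b₃ + q * b₄ + 8 * b₅ + 8 * b₆ + r * b₇ ≤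
      (8 + p + q + r) * (b₁ + b₂ + b₃ + b₄ + b₅ + b₆ + b₇) := by
  have hp' := mul_nonneg hp (show 0 ≤ b₁ + b₂ + b₄ + b₅ + b₆ + b₇ by positivity)
  have hq' := mul_nonneg hq (show 0 ≤ b₁ + b₂ + b₃ + b₅ + b₆ + b₇ by positivity)
  have hr' := mul_nonneg hr (show 0 ≤ b₁ + b₂ + b₃ + b₄ + b₅ + b₆ by positivity)
  linarith

namespace ErrorData

variable {K : Fin 2 → Geometry.SimplicialComplex ℝ (E d)}
    {l : ℕ} {T Δt : ℝ} {N : ℕ} {ν₀ ν₁ κm κj κ CF CT CP : ℝ} {ν : Fin 2 → ℝ → E d → ℝ}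
    {f : ∀ i, ℝ → X (Ω i) (interface Ω) →L[ℝ] ℝ}
    {u ut : ℝ → XX Ω} {ut0 utt : ℝ → ∀ i, L2 (Ω i)} {U : ℕ → XX Ω} {w : ℕ → XX Ω}
    (h : ErrorData Ω K l T Δt N ν₀ ν₁ κm κj κ CF CT CP ν f u ut ut0 utt U w)
include h

theorem friction_max_nonneg : 0 ≤ κm := h.friction_nonneg.trans h.friction_le

theorem friction_bound_nonneg : 0 ≤ κ := h.friction_max_nonneg.trans h.friction_max

theorem step_le (hN : 0 < N) : Δt ≤ T := by
  rw [← h.time_eq]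
  exact le_mul_of_one_le_left h.step_pos.le (by exact_mod_cast hN)

theorem friction_mul_step_le (hN : 0 < N) : κm * Δt ≤ κ * T :=
  mul_le_mul h.friction_max (h.step_le hN) h.step_pos.le h.friction_bound_nonneg

variable {G : ℝ} (hG : ∀ n ≤ N, bestGrad K l (u (n * Δt)) ≤ G)
include hG

theorem norm_grad_projection_sq_le {n : ℕ} (hn : n ≤ N) (i : Fin 2) :
    ‖grad (u (n * Δt) i - w n i)‖ ^ 2 ≤ CP ^ 2 * G :=
  (norm_grad_projection_error_le (K := K) (l := l) (w := u (n * Δt)) (p := w n)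
    (fun i => h.stable i _ _ (h.proj n i)) i).trans
      (mul_le_mul_of_nonneg_left (hG n hn) (sq_nonneg _))

theorem norm_trace_projection_sq_le {n : ℕ} (hn : n ≤ N) (i : Fin 2) :
    ‖τ i (u (n * Δt) i - w n i)‖ ^ 2 ≤ CT ^ 2 * (CP ^ 2 * G) := by
  refine (pow_le_pow_left₀ (norm_nonneg _) (h.trace i _) 2).trans ?_
  rw [mul_pow]
  exact mul_le_mul_of_nonneg_left (h.norm_grad_projection_sq_le hG hn i) (sq_nonneg _)

theorem norm_val_projection_sq_le {n : ℕ} (hn : n ≤ N) (i : Fin 2) :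
    ‖val (u (n * Δt) i - w n i)‖ ^ 2 ≤ CF ^ 2 * (CP ^ 2 * G) := by
  refine (pow_le_pow_left₀ (norm_nonneg _) (h.friedrichs i _) 2).trans ?_
  rw [mul_pow]
  exact mul_le_mul_of_nonneg_left (h.norm_grad_projection_sq_le hG hn i) (sq_nonneg _)

/-- In `L²` the projection contracts, because `U 0` is in the finite element space. On the interface
it need not, so the trace of the projection error enters; its weight satisfies `κm * Δt ≤ κ * T`,
which makes it part of the `T * G` term. -/
theorem initial_le (hN : 0 < N) (hG0 : 0 ≤ G) :
    ∑ i, (‖val (w 0 i - U 0 i)‖ ^ 2 + κm * Δt * ‖τ i (w 0 i - U 0 i)‖ ^ 2) ≤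
      nrm (u 0 - U 0) ^ 2 + 2 * (κm * Δt * nrmInterface (u 0 - U 0) ^ 2) +
        4 * κ * CT ^ 2 * CP ^ 2 * (T * G) := by
  have h0 : u ((0 : ℕ) * Δt) = u 0 := by rw [Nat.cast_zero, zero_mul]
  have hκ : 0 ≤ κm * Δt := mul_nonneg h.friction_max_nonneg h.step_pos.le
  have hA : ∀ i, ‖val (w 0 i - U 0 i)‖ ^ 2 ≤ ‖val ((u 0 - U 0) i)‖ ^ 2 := fun i => by
    have h1 := (h.proj 0 i).norm_sub_le (h.mem 0 i)
    rw [h0] at h1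
    have e1 : val (w 0 i - U 0 i) = val (w 0 i) - val (U 0 i) := rfl
    have e2 : val ((u 0 - U 0) i) = val (u 0 i) - val (U 0 i) := rfl
    rw [e1, e2]
    linarith [sq_nonneg ‖val (u 0 i) - val (w 0 i)‖]
  have hB : ∀ i, ‖τ i (w 0 i - U 0 i)‖ ^ 2 ≤
      2 * ‖τ i ((u 0 - U 0) i)‖ ^ 2 + 2 * (CT ^ 2 * (CP ^ 2 * G)) := fun i => by
    have h1 := h.norm_trace_projection_sq_le hG (Nat.zero_le N) i
    rw [h0] at h1
    have e : w 0 i - U 0 i = (u 0 - U 0) i - (u 0 i - w 0 i) := by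
      rw [Pi.sub_apply]; abel
    rw [e, map_sub]
    linarith [norm_sub_sq_le_two_mul (τ i ((u 0 - U 0) i)) (τ i (u 0 i - w 0 i))]
  have hA' : ∑ i, ‖val ((u 0 - U 0) i)‖ ^ 2 ≤ nrm (u 0 - U 0) ^ 2 :=
    sum_sq_le_sq_sum (fun i => ‖val ((u 0 - U 0) i)‖) fun i => norm_nonneg _
  have hB' : ∑ i, ‖τ i ((u 0 - U 0) i)‖ ^ 2 ≤ nrmInterface (u 0 - U 0) ^ 2 := by
    rw [nrmInterface_eq]
    exact sum_sq_le_sq_sum (fun i => ‖τ i ((u 0 - U 0) i)‖) fun i => norm_nonneg _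
  have hD : κm * Δt * (CT ^ 2 * (CP ^ 2 * G)) ≤ κ * T * (CT ^ 2 * (CP ^ 2 * G)) :=
    mul_le_mul_of_nonneg_right (h.friction_mul_step_le hN) (by positivity)
  have hB0 := mul_le_mul_of_nonneg_left (hB 0) hκ
  have hB1 := mul_le_mul_of_nonneg_left (hB 1) hκ
  have hB2 := mul_le_mul_of_nonneg_left hB' hκ
  have hA0 := hA 0
  have hA1 := hA 1
  rw [Fin.sum_univ_two] at hA' hB2 ⊢
  linarith

omit hG in
theorem sum_integral_steps_le {F : Fin 2 → Type*} [∀ i, NormedAddCommGroup (F i)]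
    {v : ℝ → ∀ i, F i} (hv : ∀ i, MemLp (fun t => v t i) 2 (volume.restrict (Ioc 0 T))) :
    ∑ n ∈ Finset.range N, ∑ i, ∫ r in (n : ℝ) * Δt..((n + 1 : ℕ) : ℝ) * Δt, ‖v r i‖ ^ 2 ≤
      ∫ t in (0 : ℝ)..T, (∑ i, ‖v t i‖) ^ 2 := by
  rw [Finset.sum_comm]
  refine le_trans (le_of_eq ?_) (sum_integral_norm_sq_le h.time_nonneg hv)
  refine Finset.sum_congr rfl fun i _ => ?_
  exact sum_intervalIntegral_steps h.step_pos.le h.time_eq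
    (intervalIntegrable_norm_sq_of_memLp (hv i) le_rfl h.time_nonneg le_rfl)

theorem consistency_sum :
    Δt / ν₀ * ∑ n ∈ Finset.range N, ∑ i,
        (CF * ‖Δt⁻¹ • (val (u ((n + 1 : ℕ) * Δt) i) - val (u (n * Δt) i)) -
            ut0 ((n + 1 : ℕ) * Δt) i‖ +
          ν₁ * ‖grad (u ((n + 1 : ℕ) * Δt) i - w (n + 1) i)‖ +
          CT * ‖(κm - κj) • τ i (u ((n + 1 : ℕ) * Δt) i - u (n * Δt) i) +
            κj • τ i.rev (u ((n + 1 : ℕ) * Δt) i.rev - u (n * Δt) i.rev) -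
            κm • τ i (u ((n + 1 : ℕ) * Δt) i - w (n + 1) i) +
            (κm - κj) • τ i (u (n * Δt) i - w n i) +
            κj • τ i.rev (u (n * Δt) i.rev - w n i.rev)‖) ^ 2 ≤
      3 * CF ^ 2 / ν₀ * (Δt ^ 2 * ∫ t in (0 : ℝ)..T, normL2 (utt t) ^ 2) +
      30 * κ ^ 2 * CT ^ 4 / ν₀ * (Δt ^ 2 * ∫ t in (0 : ℝ)..T, nrmGrad (ut t) ^ 2) +
      (6 * ν₁ ^ 2 + 90 * κ ^ 2 * CT ^ 4) * CP ^ 2 / ν₀ * (T * G) := by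
  have hν := h.diffusion_pos
  have hΔ := h.step_pos.le
  have h1 := h.sum_integral_steps_le (v := utt) fun i => (h.regular.deriv_ut i).1
  have h2 := h.sum_integral_steps_le (v := fun t i => grad (ut t i))
    fun i => (h.regular.deriv_grad i).1
  have h3 := Finset.sum_le_sum fun n (hn : n ∈ Finset.range N) =>
    h.consistency hG (Finset.mem_range.1 hn)
  rw [Finset.sum_add_distrib, Finset.sum_add_distrib, ← Finset.mul_sum, ← Finset.mul_sum,
    ← Finset.mul_sum, ← Finset.mul_sum, Finset.sum_const, Finset.card_range, nsmul_eq_mul] at h3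
  refine (mul_le_mul_of_nonneg_left h3 (by positivity)).trans ?_
  have h4 := mul_le_mul_of_nonneg_left h1 (show 0 ≤ 3 * CF ^ 2 / ν₀ * Δt ^ 2 by positivity)
  have h5 := mul_le_mul_of_nonneg_left h2
    (show 0 ≤ 30 * κ ^ 2 * CT ^ 4 / ν₀ * Δt ^ 2 by positivity)
  have e : (6 * ν₁ ^ 2 + 90 * κ ^ 2 * CT ^ 4) * CP ^ 2 / ν₀ * (T * G) =
      Δt / ν₀ * (N * ((6 * ν₁ ^ 2 + 90 * κ ^ 2 * CT ^ 4) * (CP ^ 2 * G))) := by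
    rw [← h.time_eq]; ring
  rw [e, mul_add, mul_add]
  refine add_le_add (add_le_add ?_ ?_) le_rfl
  · refine le_trans (le_of_eq ?_) (h4.trans (le_of_eq (mul_assoc _ _ _)))
    ring
  · refine le_trans (le_of_eq ?_) (h5.trans (le_of_eq (mul_assoc _ _ _)))
    ring

/-- This error has no factor `Δt`, and the constant must not depend on `T`. For `T ≤ 1` the
projection error is transported from time zero, at the cost of `T ≤ 1` times `bestDeriv`. For `T ≥
1`, Friedrichs' inequality bounds it by a multiple of `G ≤ T * G`. -/
theorem final_projection_le (hG0 : 0 ≤ G) :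
    ∑ i, ‖val (u T i - w N i)‖ ^ 2 ≤
      2 * bestInitial K l (κm * Δt) (u 0) + 2 * bestDeriv K l T ut0 +
        2 * CF ^ 2 * CP ^ 2 * (T * G) := by
  have hT := h.time_nonneg
  have hκ : 0 ≤ κm * Δt := mul_nonneg h.friction_max_nonneg h.step_pos.le
  have hI := bestInitial_nonneg K l hκ (u 0)
  have hD := bestDeriv_nonneg K l hT ut0
  have h0 : u ((0 : ℕ) * Δt) = u 0 := by rw [Nat.cast_zero, zero_mul]
  have hTN : u (N * Δt) = u T := by rw [h.time_eq]
  rcases le_total T 1 with hT1 | hT1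
  · have hp₀ : ∀ i, IsL2Proj (K i) l (u 0 i) (w 0 i) := fun i => by
      have := h.proj 0 i
      rwa [h0] at this
    have hp₁ : ∀ i, IsL2Proj (K i) l (u T i) (w N i) := fun i => by
      have := h.proj N i
      rwa [hTN] at this
    have h1 := sum_projection_error_le hT h.regular hp₀ hp₁
    have h2 := sum_projection_error_le_bestInitial hκ hp₀
    have h3 : T * bestDeriv K l T ut0 ≤ bestDeriv K l T ut0 := mul_le_of_le_one_left hD hT1
    have h4 : 0 ≤ 2 * CF ^ 2 * CP ^ 2 * (T * G) := by positivity
    refine le_trans h1 ?_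
    linarith
  · have h1 : ∀ i, ‖val (u T i - w N i)‖ ^ 2 ≤ CF ^ 2 * (CP ^ 2 * G) := fun i => by
      have := h.norm_val_projection_sq_le hG le_rfl i
      rwa [hTN] at this
    have h2 : CF ^ 2 * CP ^ 2 * G ≤ CF ^ 2 * CP ^ 2 * (T * G) :=
      mul_le_mul_of_nonneg_left (le_mul_of_one_le_left hG0 hT1) (by positivity)
    rw [Fin.sum_univ_two]
    linarith [h1 0, h1 1]

/-- Triangle inequality through the projection. A factor `2` from squaring a sum over two subdomains
and a factor `2` from the split give `4`; projection terms bounded separately on each subdomain get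
`8`. -/
theorem error_le_discrete_error (hN : 0 < N) (hG0 : 0 ≤ G) :
    nrm (u T - U N) ^ 2 + κm * Δt * nrmInterface (u T - U N) ^ 2 +
      ν₀ * Δt * ∑ n ∈ Finset.range N, nrmGrad (u ((n + 1 : ℕ) * Δt) - U (n + 1)) ^ 2 ≤
    4 * ∑ i, ‖val (u T i - w N i)‖ ^ 2 +
      (8 * κ * CT ^ 2 * CP ^ 2 + 8 * ν₀ * CP ^ 2) * (T * G) +
      4 * (∑ i, (‖val (w N i - U N i)‖ ^ 2 + κm * Δt * ‖τ i (w N i - U N i)‖ ^ 2) +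
        ν₀ * Δt * ∑ n ∈ Finset.range N, ∑ i, ‖grad (w (n + 1) i - U (n + 1) i)‖ ^ 2) := by
  have hν := h.diffusion_pos
  have hκ : 0 ≤ κm * Δt := mul_nonneg h.friction_max_nonneg h.step_pos.le
  have hTN : u (N * Δt) = u T := by rw [h.time_eq]
  have hL : nrm (u T - U N) ^ 2 ≤
      4 * ∑ i, ‖val (u T i - w N i)‖ ^ 2 + 4 * ∑ i, ‖val (w N i - U N i)‖ ^ 2 := by
    have h1 : ∀ i, ‖val ((u T - U N) i)‖ ^ 2 ≤
        2 * ‖val (u T i - w N i)‖ ^ 2 + 2 * ‖val (w N i - U N i)‖ ^ 2 := fun i => by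
      have e : val ((u T - U N) i) = val (u T i - w N i) + val (w N i - U N i) := by
        change val (u T i) - val (U N i) =
          (val (u T i) - val (w N i)) + (val (w N i) - val (U N i))
        abel
      rw [e]
      exact norm_add_sq_le_two_mul _ _
    have h2 : nrm (u T - U N) ^ 2 ≤ 2 * ∑ i, ‖val ((u T - U N) i)‖ ^ 2 :=
      sq_sum_le fun i => ‖val ((u T - U N) i)‖
    rw [Fin.sum_univ_two] at h2 ⊢
    rw [Fin.sum_univ_two]
    linarith [h1 0, h1 1]
  have hS : nrmInterface (u T - U N) ^ 2 ≤
      8 * (CT ^ 2 * (CP ^ 2 * G)) + 4 * ∑ i, ‖τ i (w N i - U N i)‖ ^ 2 := by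
    have h1 : ∀ i, ‖τ i ((u T - U N) i)‖ ^ 2 ≤
        2 * (CT ^ 2 * (CP ^ 2 * G)) + 2 * ‖τ i (w N i - U N i)‖ ^ 2 := fun i => by
      have e : (u T - U N) i = (u T i - w N i) + (w N i - U N i) := by
        rw [Pi.sub_apply]; abel
      have h2 := h.norm_trace_projection_sq_le hG le_rfl i
      rw [hTN] at h2
      rw [e, map_add]
      linarith [norm_add_sq_le_two_mul (τ i (u T i - w N i)) (τ i (w N i - U N i))]
    have h2 : nrmInterface (u T - U N) ^ 2 ≤ 2 * ∑ i, ‖τ i ((u T - U N) i)‖ ^ 2 := by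
      rw [nrmInterface_eq]; exact sq_sum_le fun i => ‖τ i ((u T - U N) i)‖
    rw [Fin.sum_univ_two] at h2 ⊢
    linarith [h1 0, h1 1]
  have hD : ∀ n ∈ Finset.range N, nrmGrad (u ((n + 1 : ℕ) * Δt) - U (n + 1)) ^ 2 ≤
      8 * (CP ^ 2 * G) + 4 * ∑ i, ‖grad (w (n + 1) i - U (n + 1) i)‖ ^ 2 := fun n hn => by
    have h1 : ∀ i, ‖grad ((u ((n + 1 : ℕ) * Δt) - U (n + 1)) i)‖ ^ 2 ≤
        2 * (CP ^ 2 * G) + 2 * ‖grad (w (n + 1) i - U (n + 1) i)‖ ^ 2 := fun i => by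
      have e : grad ((u ((n + 1 : ℕ) * Δt) - U (n + 1)) i) =
          grad (u ((n + 1 : ℕ) * Δt) i - w (n + 1) i) + grad (w (n + 1) i - U (n + 1) i) := by
        change grad (u ((n + 1 : ℕ) * Δt) i) - grad (U (n + 1) i) =
          (grad (u ((n + 1 : ℕ) * Δt) i) - grad (w (n + 1) i)) +
            (grad (w (n + 1) i) - grad (U (n + 1) i))
        abel
      have h2 := h.norm_grad_projection_sq_le hG (n := n + 1) (Finset.mem_range.1 hn) i
      rw [e]
      linarith [norm_add_sq_le_two_mul (grad (u ((n + 1 : ℕ) * Δt) i - w (n + 1) i))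
        (grad (w (n + 1) i - U (n + 1) i))]
    have h2 : nrmGrad (u ((n + 1 : ℕ) * Δt) - U (n + 1)) ^ 2 ≤
        2 * ∑ i, ‖grad ((u ((n + 1 : ℕ) * Δt) - U (n + 1)) i)‖ ^ 2 :=
      sq_sum_le fun i => ‖grad ((u ((n + 1 : ℕ) * Δt) - U (n + 1)) i)‖
    rw [Fin.sum_univ_two] at h2 ⊢
    linarith [h1 0, h1 1]
  have hD' := Finset.sum_le_sum hD
  rw [Finset.sum_add_distrib, Finset.sum_const, Finset.card_range, nsmul_eq_mul,
    ← Finset.mul_sum] at hD'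
  have hD2 := mul_le_mul_of_nonneg_left hD' (mul_nonneg hν.le h.step_pos.le)
  have eD : ν₀ * Δt * (N * (8 * (CP ^ 2 * G))) = 8 * ν₀ * CP ^ 2 * (T * G) := by
    rw [← h.time_eq]; ring
  rw [mul_add, eD] at hD2
  have hS2 := mul_le_mul_of_nonneg_left hS hκ
  have hS3 : κm * Δt * (8 * (CT ^ 2 * (CP ^ 2 * G))) ≤ κ * T * (8 * (CT ^ 2 * (CP ^ 2 * G))) :=
    mul_le_mul_of_nonneg_right (h.friction_mul_step_le hN) (by positivity)
  rw [Finset.sum_add_distrib, ← Finset.mul_sum]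
  linarith

theorem error_le (hN : 0 < N) (hG0 : 0 ≤ G) :
    nrm (u T - U N) ^ 2 + κm * Δt * nrmInterface (u T - U N) ^ 2 +
      ν₀ * Δt * ∑ n ∈ Finset.range N, nrmGrad (u ((n + 1 : ℕ) * Δt) - U (n + 1)) ^ 2 ≤
    (8 + 120 * κ ^ 2 * CT ^ 4 / ν₀ + 12 * CF ^ 2 / ν₀ +
        (8 * CF ^ 2 * CP ^ 2 + 24 * κ * CT ^ 2 * CP ^ 2 + 8 * ν₀ * CP ^ 2 +
          4 * ((6 * ν₁ ^ 2 + 90 * κ ^ 2 * CT ^ 4) * CP ^ 2 / ν₀))) *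
      (nrm (u 0 - U 0) ^ 2 + κm * Δt * nrmInterface (u 0 - U 0) ^ 2 +
        Δt ^ 2 * (∫ t in (0 : ℝ)..T, nrmGrad (ut t) ^ 2) +
        Δt ^ 2 * (∫ t in (0 : ℝ)..T, normL2 (utt t) ^ 2) +
        bestInitial K l (κm * Δt) (u 0) + bestDeriv K l T ut0 + T * G) := by
  have hT := h.time_nonneg
  have hν := h.diffusion_pos
  have hκ0 := h.friction_bound_nonneg
  have hκ : 0 ≤ κm * Δt := mul_nonneg h.friction_max_nonneg h.step_pos.le
  have a3 : 0 ≤ Δt ^ 2 * (∫ t in (0 : ℝ)..T, nrmGrad (ut t) ^ 2) :=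
    mul_nonneg (sq_nonneg _) (intervalIntegral.integral_nonneg hT fun _ _ => sq_nonneg _)
  have a4 : 0 ≤ Δt ^ 2 * (∫ t in (0 : ℝ)..T, normL2 (utt t) ^ 2) :=
    mul_nonneg (sq_nonneg _) (intervalIntegral.integral_nonneg hT fun _ _ => sq_nonneg _)
  have main := (h.error_le_discrete_error hG hN hG0).trans (add_le_add (add_le_add
    (mul_le_mul_of_nonneg_left (h.final_projection_le hG hG0) zero_le_four) le_rfl)
    (mul_le_mul_of_nonneg_left (h.energy.trans
      (add_le_add (h.initial_le hG hN hG0) (h.consistency_sum hG))) zero_le_four))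
  refine main.trans ((le_of_eq ?_).trans (weighted_sum_le
    (show 0 ≤ 120 * κ ^ 2 * CT ^ 4 / ν₀ by positivity)
    (show 0 ≤ 12 * CF ^ 2 / ν₀ by positivity)
    (show 0 ≤ 8 * CF ^ 2 * CP ^ 2 + 24 * κ * CT ^ 2 * CP ^ 2 + 8 * ν₀ * CP ^ 2 +
      4 * ((6 * ν₁ ^ 2 + 90 * κ ^ 2 * CT ^ 4) * CP ^ 2 / ν₀) by positivity)
    (sq_nonneg (nrm (u 0 - U 0))) (mul_nonneg hκ (sq_nonneg (nrmInterface (u 0 - U 0)))) a3 a4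
    (bestInitial_nonneg K l hκ (u 0)) (bestDeriv_nonneg K l hT ut0) (mul_nonneg hT hG0)))
  ring

end ErrorData

end

end HeatHeat

end

theorem theorem3p2 (d : ℕ) (hd : d = 2 ∨ d = 3) (Ω : Fin 2 → Set (HeatHeat.E d))
    (hΩ : ∀ i, HeatHeat.IsConvexPolytope (Ω i)) (hdisj : Disjoint (Ω 0) (Ω 1))
    (νmin νmax κbound σ : ℝ) (hνmin : 0 < νmin) (hσ : 0 < σ) (l : ℕ) (hl : 1 ≤ l) :
    ∃ C : ℝ, 0 < C ∧
      ∀ (K : Fin 2 → Geometry.SimplicialComplex ℝ (HeatHeat.E d)),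
      (∀ i, HeatHeat.IsTriangulation (K i) (Ω i)) →
      (∀ i, HeatHeat.IsQuasiUniform σ (K i)) →
      ∀ (T : ℝ), 0 < T → ∀ (N : ℕ), 0 < N → ∀ (Δt : ℝ), Δt = T / N →
      ∀ (ν : Fin 2 → ℝ → HeatHeat.E d → ℝ),
      (∀ i, ∀ t ∈ Set.Icc 0 T,
        AEStronglyMeasurable (ν i t) (volume.restrict (Ω i))) →
      (∀ i, ∀ t ∈ Set.Icc 0 T, ∀ x ∈ Ω i, νmin ≤ ν i t x ∧ ν i t x ≤ νmax) →
      ∀ (J : ℕ) (κ : Fin J → ℝ), (∀ j, 0 < κ j ∧ κ j ≤ κbound) →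
      ∀ (f : Fin J → ∀ i, ℝ → HeatHeat.X (Ω i) (HeatHeat.interface Ω) →L[ℝ] ℝ)
        (u ut : Fin J → ℝ → HeatHeat.XX Ω)
        (ut0 utt : Fin J → ℝ → ∀ i, HeatHeat.L2 (Ω i))
        (U : Fin J → ℕ → HeatHeat.XXh Ω K l),
      (∀ j, HeatHeat.IsRegularInTime T (u j) (ut j) (ut0 j) (utt j)) →
      (∀ j, HeatHeat.IsWeakSolution T ν (κ j) (f j) (u j) (ut0 j)) →
      HeatHeat.IsA1Solution Δt N ν κ f U →
      ∀ j : Fin J,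
        HeatHeat.nrm (u j T - (U j N).toXX) ^ 2
          + HeatHeat.kmax κ * Δt * HeatHeat.nrmInterface (u j T - (U j N).toXX) ^ 2
          + νmin * Δt * ∑ n ∈ Finset.range N,
              HeatHeat.nrmGrad (u j ((n + 1 : ℕ) * Δt) - (U j (n + 1)).toXX) ^ 2
        ≤ C * (HeatHeat.nrm (u j 0 - (U j 0).toXX) ^ 2
          + HeatHeat.kmax κ * Δt * HeatHeat.nrmInterface (u j 0 - (U j 0).toXX) ^ 2
          + Δt ^ 2 * (∫ t in (0 : ℝ)..T, HeatHeat.nrmGrad (ut j t) ^ 2)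
          + Δt ^ 2 * (∫ t in (0 : ℝ)..T, HeatHeat.normL2 (utt j t) ^ 2)
          + HeatHeat.bestInitial K l (HeatHeat.kmax κ * Δt) (u j 0)
          + HeatHeat.bestDeriv K l T (ut0 j)
          + T * ⨆ n : Fin (N + 1), HeatHeat.bestGrad K l (u j (n * Δt))) := by
  obtain ⟨CF, CT, CP, hCF, hCT, hCP, hconst⟩ :=
    HeatHeat.exists_constants (by omega : 1 ≤ d) hΩ hdisj hσ hl
  have hk : 0 ≤ |κbound| := abs_nonneg _
  -- No sign is imposed on `κbound`, and the ensemble may be empty; the absolute value keeps the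
  -- constant positive in every case.
  refine ⟨8 + 120 * |κbound| ^ 2 * CT ^ 4 / νmin + 12 * CF ^ 2 / νmin +
    (8 * CF ^ 2 * CP ^ 2 + 24 * |κbound| * CT ^ 2 * CP ^ 2 + 8 * νmin * CP ^ 2 +
      4 * ((6 * νmax ^ 2 + 90 * |κbound| ^ 2 * CT ^ 4) * CP ^ 2 / νmin)), by positivity, ?_⟩
  intro K hK hqu T hT N hN Δt hΔt ν hνm hν J κ hκ f u ut ut0 utt U hu hweak hU j
  have hN' : (0 : ℝ) < N := by exact_mod_cast hN
  have hΔ : 0 < Δt := hΔt ▸ div_pos hT hN'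
  have hNT : N * Δt = T := by rw [hΔt]; field_simp
  -- This sign comes from the bounds on `ν` at any point of the nonempty domain.
  have hνmax : 0 ≤ νmax := by
    obtain ⟨x, hx⟩ := (hΩ 0).1
    have h1 := hν 0 0 ⟨le_rfl, hT.le⟩ x hx
    linarith
  have hκj : κ j ≤ HeatHeat.kmax κ := le_ciSup (Set.finite_range κ).bddAbove j
  have hκm : HeatHeat.kmax κ ≤ |κbound| := by
    have : Nonempty (Fin J) := ⟨j⟩
    exact ciSup_le fun i => (hκ i).2.trans (le_abs_self _)
  -- The comparison function at each time level is the projection of the exact solution.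
  choose w hw using fun (n : ℕ) (i : Fin 2) =>
    HeatHeat.exists_isL2Proj (hK i) (hΩ i).isOpen (hΩ i).isBounded l (u j (n * Δt) i)
  have h : HeatHeat.ErrorData Ω K l T Δt N νmin νmax (HeatHeat.kmax κ) (κ j) |κbound| CF CT CP ν
      (f j) (u j) (ut j) (ut0 j) (utt j) (fun n => (U j n).toXX) w :=
    { meas := fun i => (hΩ i).isOpen.measurableSet
      step_pos := hΔ
      time_eq := hNT
      diffusion_pos := hνmin
      diffusion_meas := hνm
      diffusion_le := hν
      diffusion_max := hνmax
      friction_nonneg := (hκ j).1.le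
      friction_le := hκj
      friction_max := hκm
      CT_nonneg := hCT
      friedrichs := fun i => (hconst i).1
      trace := fun i => (hconst i).2.1
      stable := fun i => (hconst i).2.2 (K i) (hK i) (hqu i)
      regular := hu j
      weak := hweak j
      proj := hw
      mem := fun n i => (U j n i).2
      scheme := fun n hn i v hv => hU.step hn j i v hv }
  have hbdd : BddAbove (Set.range fun n : Fin (N + 1) =>
      HeatHeat.bestGrad K l (u j (n * Δt))) := (Set.finite_range _).bddAbove
  exact h.error_le (fun n hn => le_ciSup hbdd ⟨n, Nat.lt_succ_of_le hn⟩) hN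
    (Real.iSup_nonneg fun n => HeatHeat.bestGrad_nonneg K l _)
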